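/- All algebras are over $\mathbb{C}$, associative and unital. A \emph{Fréchet algebra} is an algebra whose underlying space is a Fréchet space (complete metrizable locally convex) with jointly continuous multiplication; homomorphisms are continuous and unital. Left, right and two-sided Fréchet modules are Fréchet spaces with jointly continuous unital actions, with continuous module maps as morphisms. $\widehat\otimes$ denotes the completed projective tensor product; for a right Fréchet $A$-module $M$ and a left Fréchet $A$-module $N$, $M\widehat\otimes_A N$ is the quotient of $M\widehat\otimes N$ by the closed linear span of the elements $x\cdot a\otimes y-x\otimes a\cdot y$. A chain complex of Fréchet modules is \emph{admissible} if it has a contracting homotopy consisting of continuous linear maps; a Fréchet module $P$ is \emph{projective} if $\mathrm{Hom}(P,-)$ takes admissible complexes to exact sequences; a projective resolution of $M$ is a complex $P_\bullet$ ($n\ge 0$) of projective modules with an augmentation $P_0\to M$ such that the augmented complex is admissible. $\mathrm{Tor}_n^A(M,N)$ is the $n$th homology of $P_\bullet\widehat\otimes_A N$, with the quotient topology, where $P_\bullet$ is a projective resolution of $M$ in the category of right Fréchet $A$-modules. A homomorphism $\varphi:A\to B$ of Fréchet algebras is \emph{$n$-pseudoflat} if $\mathrm{Tor}_m^A(B,B)=0$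 for $1\le m\le n$ and $\mathrm{Tor}_0^A(B,B)$ is Hausdorff, and an \emph{epimorphism} if it is one in the category of Fréchet algebras. $\mathrm{Der}(A,X)$ is the space of continuous derivations of $A$ with values in a Fréchet $A$-bimodule $X$. The bimodule of noncommutative differential $1$-forms $\Omega^1A$ is the kernel of the multiplication map $A\widehat\otimes A\to A$ (with universal derivation $a\mapsto 1\otimes a-a\otimes 1$). For a homomorphism $\varphi:A\to B$, let $$\check\varphi: B\widehat\otimes_A\Omega^1A\widehat\otimes_A B\to\Omega^1B,\qquad b\otimes\omega\otimes c\mapsto b\cdot(\varphi\otimes\varphi)(\omega)\cdot c,$$ be the canonical morphism of Fréchet $B$-bimodules. \textbf{Theorem.} For a Fréchet algebra homomorphism $\varphi:A\to B$ the following conditions are equivalent: (i) $\varphi$ is a $1$-pseudoflat epimorphism; (ii) for each Fréchet $B$-bimodule $X$ the restriction map $\mathrm{Der}(B,X)\to\mathrm{Der}(A,X)$, $D\mapsto D\circ\varphi$, is bijective, and condition $(*)$ holds; (iii) $\check\varphi: B\widehat\otimes_A\Omega^1A\widehat\otimes_A B\to\Omega^1B$ is an isomorphism of Fréchet $B$-bimodules,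 and condition $(*)$ holds. Here $(*)$ is the condition that $\mathrm{Tor}_0^A(B\widehat\otimes_A\Omega^1A,\,B)$ is Hausdorff. -/

import Mathlib

open scoped TensorProduct Topology Uniformity

universe u v w

set_option linter.unusedSectionVars false

/-- A Fréchet space over `ℂ`: a complete metrizable (i.e. Hausdorff with countably generated
uniformity) locally convex space (i.e. its topology is given by a family of seminorms). -/
class IsFrechetSpace (E : Type*) [AddCommGroup E] [Module ℂ E] [UniformSpace E] : Prop extends
    IsUniformAddGroup E, ContinuousSMul ℂ E, PolynormableSpace ℂ E, T2Space E, CompleteSpace E,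
    Filter.IsCountablyGenerated (𝓤 E)

/-- A (unital) Fréchet algebra: an algebra that is a Fréchet space, with jointly continuous
multiplication. -/
class IsFrechetAlgebra (A : Type*) [Ring A] [Algebra ℂ A] [UniformSpace A] : Prop extends
    IsFrechetSpace A, ContinuousMul A

instance : IsFrechetAlgebra ℂ where

section ProjectiveTensor

variable (E : Type*) [AddCommGroup E] [Module ℂ E] [UniformSpace E]
variable (F : Type*) [AddCommGroup F] [Module ℂ F] [UniformSpace F]

/-- The algebraic tensor product `E ⊗ F`, to be equipped with the projective topology. -/
def PreTensor : Type _ := E ⊗[ℂ] F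

noncomputable instance : AddCommGroup (PreTensor E F) := inferInstanceAs (AddCommGroup (E ⊗[ℂ] F))
noncomputable instance : Module ℂ (PreTensor E F) := inferInstanceAs (Module ℂ (E ⊗[ℂ] F))

/-- The canonical bilinear map `E × F → E ⊗ F`. -/
noncomputable def PreTensor.mk : E →ₗ[ℂ] F →ₗ[ℂ] PreTensor E F := TensorProduct.mk ℂ E F

/-- The seminorms on `E ⊗ F` for which the canonical bilinear map is continuous. -/
noncomputable def PreTensor.seminorms :
    SeminormFamily ℂ (PreTensor E F)
      {s : Seminorm ℂ (PreTensor E F) //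
        Continuous fun p : E × F => s (PreTensor.mk E F p.1 p.2)} :=
  fun s => s.1

instance : Nonempty {s : Seminorm ℂ (PreTensor E F) //
        Continuous fun p : E × F => s (PreTensor.mk E F p.1 p.2)} :=
  ⟨⟨0, continuous_const⟩⟩

/-- The projective topology: the finest locally convex topology on `E ⊗ F` for which the
canonical bilinear map `E × F → E ⊗ F` is continuous. -/
noncomputable instance : TopologicalSpace (PreTensor E F) :=
  (PreTensor.seminorms E F).moduleFilterBasis.topology

theorem PreTensor.withSeminorms : WithSeminorms (PreTensor.seminorms E F) := ⟨rfl⟩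

instance : IsTopologicalAddGroup (PreTensor E F) :=
  (PreTensor.withSeminorms E F).topologicalAddGroup

instance : ContinuousSMul ℂ (PreTensor E F) := (PreTensor.withSeminorms E F).continuousSMul

noncomputable instance : UniformSpace (PreTensor E F) :=
  IsTopologicalAddGroup.rightUniformSpace (PreTensor E F)

instance : IsUniformAddGroup (PreTensor E F) := isUniformAddGroup_of_addCommGroup

instance : UniformContinuousConstSMul ℂ (PreTensor E F) :=
  uniformContinuousConstSMul_of_continuousConstSMul ℂ (PreTensor E F)

/-- The completed projective tensor product `E ⊗̂ F`: the (Hausdorff) completion of `E ⊗ F` in the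
projective topology. -/
def ProjTensor : Type _ := UniformSpace.Completion (PreTensor E F)

noncomputable instance : AddCommGroup (ProjTensor E F) :=
  inferInstanceAs (AddCommGroup (UniformSpace.Completion (PreTensor E F)))
noncomputable instance : Module ℂ (ProjTensor E F) :=
  inferInstanceAs (Module ℂ (UniformSpace.Completion (PreTensor E F)))
noncomputable instance : UniformSpace (ProjTensor E F) :=
  inferInstanceAs (UniformSpace (UniformSpace.Completion (PreTensor E F)))
instance : IsUniformAddGroup (ProjTensor E F) :=
  inferInstanceAs (IsUniformAddGroup (UniformSpace.Completion (PreTensor E F)))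
instance : CompleteSpace (ProjTensor E F) :=
  inferInstanceAs (CompleteSpace (UniformSpace.Completion (PreTensor E F)))
instance : T2Space (ProjTensor E F) :=
  inferInstanceAs (T2Space (UniformSpace.Completion (PreTensor E F)))
instance : UniformContinuousConstSMul ℂ (ProjTensor E F) :=
  inferInstanceAs (UniformContinuousConstSMul ℂ (UniformSpace.Completion (PreTensor E F)))

/-- The canonical map `E ⊗ F → E ⊗̂ F`. -/
noncomputable def PreTensor.toProj : PreTensor E F →L[ℂ] ProjTensor E F where
  toFun := ((↑) : PreTensor E F → UniformSpace.Completion (PreTensor E F))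
  map_add' := UniformSpace.Completion.coe_add
  map_smul' := UniformSpace.Completion.coe_smul
  cont := UniformSpace.Completion.continuous_coe _

theorem PreTensor.isDenseInducing_toProj : IsDenseInducing (PreTensor.toProj E F) :=
  (UniformSpace.Completion.isDenseInducing_coe :
    IsDenseInducing ((↑) : PreTensor E F → UniformSpace.Completion (PreTensor E F)))

/-- The canonical bilinear map `E × F → E ⊗̂ F`, `(x, y) ↦ x ⊗ y`. -/
noncomputable def ProjTensor.mk : E →ₗ[ℂ] F →ₗ[ℂ] ProjTensor E F :=
  (PreTensor.mk E F).compr₂ (PreTensor.toProj E F).toLinearMap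

end ProjectiveTensor

section Seminorms

variable {E : Type*} [AddCommGroup E] [Module ℂ E]
variable {F : Type*} [AddCommGroup F] [Module ℂ F]

theorem Seminorm.map_smul_inv_lt_one (p : Seminorm ℂ E) (x : E) {a : ℝ} (h : p x < a) :
    p (((a : ℂ)⁻¹) • x) < 1 := by
  have ha : 0 < a := lt_of_le_of_lt (apply_nonneg p x) h
  rw [map_smul_eq_mul, norm_inv, Complex.norm_real, Real.norm_of_nonneg ha.le,
    inv_mul_lt_iff₀ ha]
  linarith

theorem Seminorm.le_of_unit_ball {p p' : Seminorm ℂ E} (h : ∀ x, p' x < 1 → p x ≤ 1) (x : E) :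
    p x ≤ p' x := by
  refine le_of_forall_gt_imp_ge_of_dense fun a ha => ?_
  have ha' : 0 < a := lt_of_le_of_lt (apply_nonneg p' x) ha
  have := h _ (p'.map_smul_inv_lt_one x ha)
  rwa [map_smul_eq_mul, norm_inv, Complex.norm_real, Real.norm_of_nonneg ha'.le,
    inv_mul_le_iff₀ ha', mul_one] at this

theorem exists_seminorm_ball_subset [TopologicalSpace E] [PolynormableSpace ℂ E]
    {U : Set E} (hU : U ∈ 𝓝 (0 : E)) :
    ∃ p : Seminorm ℂ E, Continuous p ∧ ∀ x, p x < 1 → x ∈ U := by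
  classical
  obtain ⟨s, r, hr, hs⟩ := ((PolynormableSpace.withSeminorms ℂ E).mem_nhds_iff 0 U).1 hU
  have hc : ∀ s : Finset {p : Seminorm ℂ E // Continuous p},
      Continuous (s.sup fun p => p.1 : Seminorm ℂ E) := by
    intro s
    induction s using Finset.induction_on with
    | empty => exact continuous_const
    | insert a s _ ih =>
      rw [Finset.sup_insert]
      exact a.2.max ih
  let c : NNReal := ⟨r⁻¹, by positivity⟩
  refine ⟨c • s.sup fun p => p.1, (hc s).const_smul c, fun x hx => ?_⟩
  apply hs
  change r⁻¹ * _ < 1 at hx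
  rw [inv_mul_lt_iff₀ hr, mul_one] at hx
  simpa [Seminorm.mem_ball] using hx

/-- The projective tensor product of two seminorms: the largest seminorm `s` with
`s (x ⊗ y) ≤ p x * q y`. -/
noncomputable def PreTensor.projSeminorm (p : Seminorm ℂ E) (q : Seminorm ℂ F) :
    Seminorm ℂ (E ⊗[ℂ] F) :=
  sSup {s | ∀ x y, s (x ⊗ₜ[ℂ] y) ≤ p x * q y}

theorem PreTensor.bddAbove_projSeminorm (p : Seminorm ℂ E) (q : Seminorm ℂ F) :
    BddAbove {s : Seminorm ℂ (E ⊗[ℂ] F) | ∀ x y, s (x ⊗ₜ[ℂ] y) ≤ p x * q y} := by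
  suffices h : ∀ t : E ⊗[ℂ] F, ∃ c : ℝ, ∀ s : Seminorm ℂ (E ⊗[ℂ] F),
      (∀ x y, s (x ⊗ₜ[ℂ] y) ≤ p x * q y) → s t ≤ c by
    rw [Seminorm.bddAbove_iff]
    choose c hc using h
    refine ⟨c, ?_⟩
    rintro _ ⟨s, hs, rfl⟩ t
    exact hc t s hs
  intro t
  induction t with
  | zero => exact ⟨0, fun s _ => by simp⟩
  | tmul x y => exact ⟨p x * q y, fun s hs => hs x y⟩
  | add a b ha hb =>
    obtain ⟨c, hc⟩ := ha
    obtain ⟨d, hd⟩ := hb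
    exact ⟨c + d, fun s hs => (map_add_le_add s a b).trans (add_le_add (hc s hs) (hd s hs))⟩

theorem PreTensor.projSeminorm_tmul_le (p : Seminorm ℂ E) (q : Seminorm ℂ F) (x : E) (y : F) :
    projSeminorm p q (x ⊗ₜ[ℂ] y) ≤ p x * q y := by
  have hne : Nonempty {s : Seminorm ℂ (E ⊗[ℂ] F) | ∀ x y, s (x ⊗ₜ[ℂ] y) ≤ p x * q y} :=
    ⟨⟨0, fun x y => by simpa using mul_nonneg (apply_nonneg p x) (apply_nonneg q y)⟩⟩
  rw [projSeminorm, Seminorm.sSup_apply (bddAbove_projSeminorm p q)]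
  exact ciSup_le fun s => s.2 x y

theorem PreTensor.le_projSeminorm (p : Seminorm ℂ E) (q : Seminorm ℂ F)
    (s : Seminorm ℂ (E ⊗[ℂ] F)) (c : ℝ) (hc : 0 ≤ c)
    (h : ∀ x y, s (x ⊗ₜ[ℂ] y) ≤ c * (p x * q y)) (t : E ⊗[ℂ] F) :
    s t ≤ c * projSeminorm p q t := by
  rcases hc.eq_or_lt with rfl | hc
  · suffices s t = 0 by simp [this]
    induction t with
    | zero => simp
    | tmul x y => exact le_antisymm (by simpa using h x y) (apply_nonneg s _)
    | add a b ha hb =>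
      exact le_antisymm ((map_add_le_add s a b).trans (by simp [ha, hb])) (apply_nonneg s _)
  · let d : NNReal := ⟨c⁻¹, by positivity⟩
    have := (le_csSup (bddAbove_projSeminorm p q) (a := d • s)
      fun x y => by
        change c⁻¹ * s _ ≤ _
        rw [inv_mul_le_iff₀ hc]; exact h x y) t
    change c⁻¹ * s t ≤ _ at this
    rwa [inv_mul_le_iff₀ hc] at this

end Seminorms

section ProjectiveTensor

variable {E : Type*} [AddCommGroup E] [Module ℂ E] [UniformSpace E]
variable {F : Type*} [AddCommGroup F] [Module ℂ F] [UniformSpace F]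
variable {G : Type*} [AddCommGroup G] [Module ℂ G] [UniformSpace G]

theorem PreTensor.continuous_mk [IsFrechetSpace E] [IsFrechetSpace F] :
    Continuous fun p : E × F => PreTensor.mk E F p.1 p.2 := by
  rw [continuous_iff_continuousAt]
  rintro ⟨x₀, y₀⟩
  refine ((PreTensor.withSeminorms E F).tendsto_nhds _ _).2 fun s ε hε => ?_
  have h : Continuous fun p : E × F =>
      s.1 (PreTensor.mk E F (p.1 - x₀) p.2) + s.1 (PreTensor.mk E F x₀ (p.2 - y₀)) :=
    (s.2.comp (f := fun p : E × F => (p.1 - x₀, p.2)) (by fun_prop)).add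
      (s.2.comp (f := fun p : E × F => (x₀, p.2 - y₀)) (by fun_prop))
  have h0 := (h.tendsto (x₀, y₀)).eventually_lt_const (u := ε) (by simpa using hε)
  filter_upwards [h0] with p hp
  refine lt_of_le_of_lt ?_ hp
  refine le_trans (le_of_eq ?_) (map_add_le_add s.1 _ _)
  change s.1 _ = _
  simp

theorem PreTensor.continuous_seminorm_of_le [IsFrechetSpace E] [IsFrechetSpace F]
    (s : Seminorm ℂ (PreTensor E F)) (p : Seminorm ℂ E) (q : Seminorm ℂ F)
    (hp : Continuous p) (hq : Continuous q)
    (h : ∀ x y, s (PreTensor.mk E F x y) ≤ p x * q y) : Continuous s := by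
  refine (PreTensor.withSeminorms E F).continuous_seminorm ⟨s, ?_⟩
  rw [continuous_iff_continuousAt]
  rintro ⟨x₀, y₀⟩
  rw [ContinuousAt, tendsto_iff_norm_sub_tendsto_zero]
  have hb : Continuous fun z : E × F => p (z.1 - x₀) * q z.2 + p x₀ * q (z.2 - y₀) := by fun_prop
  have hb0 := hb.tendsto (x₀, y₀)
  simp only [sub_self, map_zero, zero_mul, mul_zero, add_zero] at hb0
  refine squeeze_zero (fun _ => norm_nonneg _) (fun z => ?_) hb0
  have e : PreTensor.mk E F z.1 z.2 - PreTensor.mk E F x₀ y₀ =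
      PreTensor.mk E F (z.1 - x₀) z.2 + PreTensor.mk E F x₀ (z.2 - y₀) := by simp
  refine (abs_sub_map_le_sub s _ _).trans ?_
  rw [e]
  exact (map_add_le_add s _ _).trans (add_le_add (h _ _) (h _ _))

theorem PreTensor.continuous_of_bilinear [IsFrechetSpace G] (f : PreTensor E F →ₗ[ℂ] G)
    (hf : Continuous fun p : E × F => f (PreTensor.mk E F p.1 p.2)) : Continuous f := by
  refine WithSeminorms.continuous_of_continuous_comp (PolynormableSpace.withSeminorms ℂ G) f
    fun s => ?_
  exact (PreTensor.withSeminorms E F).continuous_seminorm ⟨s.1.comp f, s.2.comp hf⟩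

/-- The continuous linear map `E ⊗̂ F → G` induced by a continuous bilinear map `E × F → G`. -/
noncomputable def ProjTensor.lift [IsFrechetSpace G] (f : E →ₗ[ℂ] F →ₗ[ℂ] G)
    (hf : Continuous fun p : E × F => f p.1 p.2) : ProjTensor E F →L[ℂ] G :=
  haveI := uniformContinuousConstSMul_of_continuousConstSMul ℂ G
  ContinuousLinearMap.fromCompletion
    (⟨TensorProduct.lift f, PreTensor.continuous_of_bilinear (TensorProduct.lift f) hf⟩ :
      PreTensor E F →L[ℂ] G)

theorem ProjTensor.lift_toProj [IsFrechetSpace G] (f : E →ₗ[ℂ] F →ₗ[ℂ] G)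
    (hf : Continuous fun p : E × F => f p.1 p.2) (t : PreTensor E F) :
    lift f hf (PreTensor.toProj E F t) = TensorProduct.lift f t :=
  haveI := uniformContinuousConstSMul_of_continuousConstSMul ℂ G
  ContinuousLinearMap.fromCompletion_apply_coe (⟨TensorProduct.lift f,
    PreTensor.continuous_of_bilinear (TensorProduct.lift f) hf⟩ : PreTensor E F →L[ℂ] G) t

@[simp]
theorem ProjTensor.lift_mk [IsFrechetSpace G] (f : E →ₗ[ℂ] F →ₗ[ℂ] G)
    (hf : Continuous fun p : E × F => f p.1 p.2) (x : E) (y : F) :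
    lift f hf (mk E F x y) = f x y :=
  lift_toProj f hf (x ⊗ₜ[ℂ] y)

/-- Continuous linear maps on `E ⊗̂ F` are determined by their values on elementary tensors. -/
theorem ProjTensor.ext [T2Space G] {f g : ProjTensor E F →L[ℂ] G}
    (h : ∀ x y, f (mk E F x y) = g (mk E F x y)) : f = g := by
  refine ContinuousLinearMap.coeFn_injective
    ((PreTensor.isDenseInducing_toProj E F).dense.equalizer f.continuous g.continuous ?_)
  funext t
  have : (f.toLinearMap ∘ₗ (PreTensor.toProj E F).toLinearMap : E ⊗[ℂ] F →ₗ[ℂ] G) =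
      g.toLinearMap ∘ₗ (PreTensor.toProj E F).toLinearMap := TensorProduct.ext' h
  exact LinearMap.congr_fun this t

theorem exists_seminorm_trilinear_bound {R : Type*} [AddCommGroup R] [Module ℂ R] [UniformSpace R]
    [IsFrechetSpace R] [IsFrechetSpace E] [IsFrechetSpace F]
    (τ : R →ₗ[ℂ] E →ₗ[ℂ] F →ₗ[ℂ] G)
    (hτ : Continuous fun p : R × E × F => τ p.1 p.2.1 p.2.2) (s : Seminorm ℂ G)
    (hs : Continuous s) :
    ∃ (ρ : Seminorm ℂ R) (p : Seminorm ℂ E) (q : Seminorm ℂ F),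
      Continuous ρ ∧ Continuous p ∧ Continuous q ∧
      ∀ r x y, s (τ r x y) ≤ ρ r * (p x * q y) := by
  have h0 : (fun p : R × E × F => s (τ p.1 p.2.1 p.2.2)) ⁻¹' Set.Iio 1 ∈ 𝓝 (0 : R × E × F) := by
    refine (hs.comp hτ).continuousAt.preimage_mem_nhds (Iio_mem_nhds ?_)
    simp
  rw [show (0 : R × E × F) = (0, 0, 0) from rfl, nhds_prod_eq, nhds_prod_eq] at h0
  obtain ⟨U, hU, W, hW, hUW⟩ := Filter.mem_prod_iff.1 h0
  obtain ⟨V, hV, V', hV', hVV⟩ := Filter.mem_prod_iff.1 hW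
  obtain ⟨ρ, hρ, hρU⟩ := exists_seminorm_ball_subset hU
  obtain ⟨p, hp, hpV⟩ := exists_seminorm_ball_subset hV
  obtain ⟨q, hq, hqV⟩ := exists_seminorm_ball_subset hV'
  refine ⟨ρ, p, q, hρ, hp, hq, fun r x y => ?_⟩
  have key : ∀ ε : ℝ, 0 < ε → s (τ r x y) ≤ (ρ r + ε) * ((p x + ε) * (q y + ε)) := by
    intro ε hε
    have a0 : 0 < ρ r + ε := by linarith [apply_nonneg ρ r]
    have b0 : 0 < p x + ε := by linarith [apply_nonneg p x]
    have c0 : 0 < q y + ε := by linarith [apply_nonneg q y]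
    have h1 := hρU _ (ρ.map_smul_inv_lt_one r (show ρ r < ρ r + ε by linarith))
    have h2 := hpV _ (p.map_smul_inv_lt_one x (show p x < p x + ε by linarith))
    have h3 := hqV _ (q.map_smul_inv_lt_one y (show q y < q y + ε by linarith))
    have := hUW (Set.mk_mem_prod h1 (hVV (Set.mk_mem_prod h2 h3)))
    simp only [Set.mem_preimage, map_smul, LinearMap.smul_apply, map_smul_eq_mul, norm_inv,
      Complex.norm_real, Real.norm_of_nonneg a0.le, Real.norm_of_nonneg b0.le,
      Real.norm_of_nonneg c0.le, Set.mem_Iio] at this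
    rw [inv_mul_lt_iff₀ c0, inv_mul_lt_iff₀ b0, inv_mul_lt_iff₀ a0] at this
    linarith
  refine ge_of_tendsto (x := 𝓝[>] (0 : ℝ))
    (f := fun ε : ℝ => (ρ r + ε) * ((p x + ε) * (q y + ε))) ?_
    (Filter.eventually_of_mem self_mem_nhdsWithin fun ε hε => key ε hε)
  have : Continuous fun ε : ℝ => (ρ r + ε) * ((p x + ε) * (q y + ε)) := by fun_prop
  simpa using (this.tendsto 0).mono_left nhdsWithin_le_nhds

/-- A jointly continuous trilinear map `R × E × F → G` induces a jointly continuous map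
`R × (E ⊗̂ F) → G`. -/
theorem ProjTensor.continuous_lift_param {R : Type*} [AddCommGroup R] [Module ℂ R] [UniformSpace R]
    [IsFrechetSpace R] [IsFrechetSpace E] [IsFrechetSpace F] [IsFrechetSpace G]
    (τ : R →ₗ[ℂ] E →ₗ[ℂ] F →ₗ[ℂ] G)
    (hτ : Continuous fun p : R × E × F => τ p.1 p.2.1 p.2.2)
    (T : R → ProjTensor E F →L[ℂ] G) (hT : ∀ r x y, T r (mk E F x y) = τ r x y) :
    Continuous fun p : R × ProjTensor E F => T p.1 p.2 := by
  let φ : R →ₗ[ℂ] E ⊗[ℂ] F →ₗ[ℂ] G :=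
    { toFun := fun r => TensorProduct.lift (τ r)
      map_add' := fun a b => TensorProduct.ext' fun x y => by simp
      map_smul' := fun a b => TensorProduct.ext' fun x y => by simp }
  have hTφ : ∀ r (t : PreTensor E F), T r (PreTensor.toProj E F t) = φ r t := by
    intro r t
    have : ((T r).toLinearMap ∘ₗ (PreTensor.toProj E F).toLinearMap : E ⊗[ℂ] F →ₗ[ℂ] G) = φ r :=
      TensorProduct.ext' fun x y => (hT r x y).trans (by simp [φ])
    exact LinearMap.congr_fun this t
  let ψ : R →+ PreTensor E F →+ G :=
    { toFun := fun r => (φ r).toAddMonoidHom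
      map_zero' := by ext t; simp; rfl
      map_add' := fun a b => by ext t; simp; rfl }
  have hψ : Continuous fun p : R × PreTensor E F => ψ p.1 p.2 := by
    refine continuous_of_continuousAt_zero₂ ψ ?_ ?_ ?_
    · rw [ContinuousAt]
      simp only [map_zero]
      refine ((PolynormableSpace.withSeminorms ℂ G).tendsto_nhds _ _).2 fun s ε hε => ?_
      obtain ⟨ρ, p, q, hρ, hp, hq, h⟩ := exists_seminorm_trilinear_bound τ hτ s.1 s.2
      have hpq : @Continuous (PreTensor E F) ℝ _ _ (PreTensor.projSeminorm p q) :=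
        PreTensor.continuous_seminorm_of_le (PreTensor.projSeminorm p q) p q hp hq
          (PreTensor.projSeminorm_tmul_le p q)
      have hb : Continuous fun z : R × PreTensor E F =>
          ρ z.1 * PreTensor.projSeminorm p q z.2 :=
        (hρ.comp continuous_fst).mul (hpq.comp continuous_snd)
      have h0 := (hb.tendsto (0, 0)).eventually_lt_const (u := ε) (by simpa using hε)
      filter_upwards [h0] with z hz
      refine lt_of_le_of_lt ?_ hz
      rw [sub_zero]
      exact PreTensor.le_projSeminorm p q (s.1.comp (φ z.1)) (ρ z.1) (apply_nonneg ρ _)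
        (fun x y => by simpa [φ] using h z.1 x y) z.2
    · intro r
      have : @Continuous (PreTensor E F) G _ _ (φ r) := by
        have := (T r).continuous.comp (PreTensor.toProj E F).continuous
        refine this.congr fun t => hTφ r t
      exact this.continuousAt
    · intro t
      refine Continuous.continuousAt ?_
      change Continuous fun r => TensorProduct.lift (τ r) t
      induction t using TensorProduct.induction_on with
      | zero => simpa using continuous_const
      | tmul x y =>
        simp only [TensorProduct.lift.tmul]
        exact hτ.comp (f := fun r => (r, x, y)) (by fun_prop)
      | add a b ha hb => simp only [map_add]; exact ha.add hb
  let e : PreTensor E F →+ ProjTensor E F := (PreTensor.toProj E F).toLinearMap.toAddMonoidHom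
  have de : IsDenseInducing e := PreTensor.isDenseInducing_toProj E F
  have di : IsDenseInducing (AddMonoidHom.id R) := IsDenseEmbedding.id.isDenseInducing
  have H := di.extend_Z_bilin de hψ
  refine H.congr ?_
  rintro ⟨r, t⟩
  refine congr_fun (de.dense.equalizer (H.comp (f := fun t => (r, t)) (by fun_prop))
    (T r).continuous ?_) t
  funext t
  exact ((di.prodMap de).extend_eq hψ (r, t)).trans (hTφ r t).symm

theorem exists_countable_seminorms (E : Type*) [AddCommGroup E] [Module ℂ E] [UniformSpace E]
    [IsFrechetSpace E] : ∃ p : ℕ → Seminorm ℂ E, (∀ n, Continuous (p n)) ∧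
      ∀ q : Seminorm ℂ E, Continuous q → ∃ n, ∀ x, q x ≤ p n x := by
  have : FirstCountableTopology E := UniformSpace.firstCountableTopology E
  obtain ⟨U, hU⟩ := (𝓝 (0 : E)).exists_antitone_basis
  choose p hp hpU using fun n => exists_seminorm_ball_subset (hU.mem n)
  refine ⟨p, hp, fun q hq => ?_⟩
  obtain ⟨n, hn⟩ := hU.mem_iff.1 (show q ⁻¹' Set.Iio 1 ∈ 𝓝 (0 : E) from
    hq.continuousAt.preimage_mem_nhds (Iio_mem_nhds (by simp)))
  exact ⟨n, Seminorm.le_of_unit_ball fun x hx => (hn (hpU n x hx)).le⟩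

theorem exists_seminorm_bilinear_bound [IsFrechetSpace E] [IsFrechetSpace F]
    (s : Seminorm ℂ (PreTensor E F))
    (hs : Continuous fun p : E × F => s (PreTensor.mk E F p.1 p.2)) :
    ∃ (p : Seminorm ℂ E) (q : Seminorm ℂ F), Continuous p ∧ Continuous q ∧
      ∀ x y, s (PreTensor.mk E F x y) ≤ p x * q y := by
  have hs' : Continuous s := (PreTensor.withSeminorms E F).continuous_seminorm ⟨s, hs⟩
  have hm : Continuous fun p : E × F => PreTensor.mk E F p.1 p.2 := PreTensor.continuous_mk
  obtain ⟨ρ, p, q, hρ, hp, hq, h⟩ := exists_seminorm_trilinear_bound (R := ℂ)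
    (LinearMap.toSpanSingleton ℂ _ (PreTensor.mk E F))
    (continuous_fst.smul (hm.comp continuous_snd)) s hs'
  let c : NNReal := ⟨ρ 1, apply_nonneg ρ _⟩
  refine ⟨c • p, q, hp.const_smul c, hq, fun x y => ?_⟩
  have := h 1 x y
  simp only [LinearMap.toSpanSingleton_apply, one_smul] at this
  rw [← mul_assoc] at this
  exact this

instance PreTensor.firstCountable [IsFrechetSpace E] [IsFrechetSpace F] :
    FirstCountableTopology (PreTensor E F) := by
  obtain ⟨p, hp, hp'⟩ := exists_countable_seminorms E
  obtain ⟨q, hq, hq'⟩ := exists_countable_seminorms F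
  let r : SeminormFamily ℂ (PreTensor E F) (ℕ × ℕ) := fun n =>
    PreTensor.projSeminorm (p n.1) (q n.2)
  have hr : WithSeminorms r := by
    refine (PreTensor.withSeminorms E F).congr (fun n => ?_) (fun s => ?_)
    · have hc : Continuous (r n) := PreTensor.continuous_seminorm_of_le (r n) (p n.1) (q n.2)
        (hp _) (hq _) (PreTensor.projSeminorm_tmul_le _ _)
      refine ⟨{⟨r n, hc.comp PreTensor.continuous_mk⟩}, 1, ?_⟩
      rw [Finset.sup_singleton, one_smul]
      exact le_refl (r n)
    · obtain ⟨a, b, ha, hb, h⟩ := exists_seminorm_bilinear_bound s.1 s.2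
      obtain ⟨n, hn⟩ := hp' a ha
      obtain ⟨m, hm⟩ := hq' b hb
      refine ⟨{(n, m)}, 1, fun t => ?_⟩
      have := PreTensor.le_projSeminorm (p n) (q m) s.1 1 zero_le_one (fun x y => by
        rw [one_mul]
        exact (h x y).trans (mul_le_mul (hn x) (hm y) (apply_nonneg b _) (apply_nonneg _ _))) t
      rw [one_mul] at this
      rw [Finset.sup_singleton, one_smul]
      exact this
  exact hr.firstCountableTopology

open scoped ComplexOrder in
theorem polynormableSpace_of_convex (E : Type*) [AddCommGroup E] [Module ℂ E] [TopologicalSpace E]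
    [IsTopologicalAddGroup E] [ContinuousSMul ℂ E]
    (h : ∀ U ∈ 𝓝 (0 : E), ∃ V ∈ 𝓝 (0 : E), Convex ℝ V ∧ V ⊆ U) :
    PolynormableSpace ℂ E := by
  have h1 : LocallyConvexSpace ℂ E := by
    rw [locallyConvexSpace_iff_exists_convex_subset_zero]
    intro U hU
    obtain ⟨V, hV, hc, hVU⟩ := h U hU
    exact ⟨V, hV, convex_RCLike_iff_convex_real.2 hc, hVU⟩
  have h2 : ContinuousSMul ℝ E := IsScalarTower.continuousSMul ℂ
  infer_instance

theorem exists_convex_nhds (E : Type*) [AddCommGroup E] [Module ℂ E] [TopologicalSpace E]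
    [PolynormableSpace ℂ E] {U : Set E} (hU : U ∈ 𝓝 (0 : E)) :
    ∃ V ∈ 𝓝 (0 : E), Convex ℝ V ∧ V ⊆ U := by
  obtain ⟨p, hp, hpU⟩ := exists_seminorm_ball_subset hU
  refine ⟨p.ball 0 1, ?_, p.convex_ball 0 1, fun x hx => hpU x (by simpa [Seminorm.mem_ball] using hx)⟩
  rw [Seminorm.ball_zero_eq]
  exact hp.continuousAt.preimage_mem_nhds (Iio_mem_nhds (by simp))

instance [IsFrechetSpace E] [IsFrechetSpace F] : IsFrechetSpace (ProjTensor E F) := by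
  have de := PreTensor.isDenseInducing_toProj E F
  have hsmul : ContinuousSMul ℂ (ProjTensor E F) := by
    let ψ : ℂ →+ PreTensor E F →+ ProjTensor E F :=
      { toFun := fun c => (c • (PreTensor.toProj E F)).toLinearMap.toAddMonoidHom
        map_zero' := by ext t; simp
        map_add' := fun a b => by ext t; simp [add_smul] }
    have hψ : Continuous fun p : ℂ × PreTensor E F => ψ p.1 p.2 := by
      refine ((PreTensor.toProj E F).continuous.comp continuous_smul).congr fun z => ?_
      simp [ψ]
    let e : PreTensor E F →+ ProjTensor E F := (PreTensor.toProj E F).toLinearMap.toAddMonoidHom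
    have de : IsDenseInducing e := PreTensor.isDenseInducing_toProj E F
    have di : IsDenseInducing (AddMonoidHom.id ℂ) := IsDenseEmbedding.id.isDenseInducing
    have H := di.extend_Z_bilin de hψ
    refine ⟨H.congr ?_⟩
    rintro ⟨c, t⟩
    refine congr_fun (de.dense.equalizer (H.comp (f := fun t => (c, t)) (by fun_prop))
      (continuous_const_smul c) ?_) t
    funext t
    exact (di.prodMap de).extend_eq hψ (c, t)
  have hpoly : PolynormableSpace ℂ (ProjTensor E F) := by
    refine polynormableSpace_of_convex _ fun U hU => ?_
    have hb := ((𝓝 (0 : PreTensor E F)).basis_sets).hasBasis_of_isDenseInducing de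
    rw [map_zero] at hb
    obtain ⟨V, hV, hVU⟩ := hb.mem_iff.1 hU
    have : PolynormableSpace ℂ (PreTensor E F) :=
      (PreTensor.withSeminorms E F).toPolynormableSpace
    obtain ⟨W, hW, hc, hWV⟩ := exists_convex_nhds _ hV
    have : ContinuousSMul ℝ (ProjTensor E F) := IsScalarTower.continuousSMul ℂ
    refine ⟨closure (PreTensor.toProj E F '' W), hb.mem_of_mem hW, ?_,
      (closure_mono (Set.image_mono hWV)).trans hVU⟩
    exact (hc.linear_image ((PreTensor.toProj E F).toLinearMap.restrictScalars ℝ)).closure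
  have hcount : (𝓝 (0 : ProjTensor E F)).IsCountablyGenerated := by
    obtain ⟨U, hU⟩ := (𝓝 (0 : PreTensor E F)).exists_antitone_basis
    have hb := hU.1.hasBasis_of_isDenseInducing de
    rw [map_zero] at hb
    exact hb.isCountablyGenerated
  have := IsUniformAddGroup.uniformity_countably_generated (α := ProjTensor E F)
  exact {}

theorem ProjTensor.continuous_mk [IsFrechetSpace E] [IsFrechetSpace F] :
    Continuous fun p : E × F => mk E F p.1 p.2 :=
  (PreTensor.toProj E F).continuous.comp PreTensor.continuous_mk

end ProjectiveTensor

section ProjectiveTensor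

variable {E : Type*} [AddCommGroup E] [Module ℂ E] [UniformSpace E] [IsFrechetSpace E]
variable {F : Type*} [AddCommGroup F] [Module ℂ F] [UniformSpace F] [IsFrechetSpace F]
variable {E' : Type*} [AddCommGroup E'] [Module ℂ E'] [UniformSpace E'] [IsFrechetSpace E']
variable {F' : Type*} [AddCommGroup F'] [Module ℂ F'] [UniformSpace F'] [IsFrechetSpace F']

/-- The map `f ⊗ g : E ⊗̂ F → E' ⊗̂ F'`. -/
noncomputable def ProjTensor.map (f : E →L[ℂ] E') (g : F →L[ℂ] F') :
    ProjTensor E F →L[ℂ] ProjTensor E' F' :=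
  lift ((mk E' F').compl₁₂ f.toLinearMap g.toLinearMap)
    (continuous_mk.comp (f := fun p : E × F => (f p.1, g p.2)) (by fun_prop))

@[simp]
theorem ProjTensor.map_mk (f : E →L[ℂ] E') (g : F →L[ℂ] F') (x : E) (y : F) :
    map f g (mk E F x y) = mk E' F' (f x) (g y) :=
  lift_mk _ _ x y

theorem ProjTensor.continuous_map_left {R : Type*} [AddCommGroup R] [Module ℂ R] [UniformSpace R]
    [IsFrechetSpace R] (l : R →ₗ[ℂ] E →L[ℂ] E) (hl : Continuous fun p : R × E => l p.1 p.2) :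
    Continuous fun p : R × ProjTensor E F =>
      map (l p.1) (ContinuousLinearMap.id ℂ F) p.2 := by
  let τ : R →ₗ[ℂ] E →ₗ[ℂ] F →ₗ[ℂ] ProjTensor E F :=
    { toFun r := (ProjTensor.mk E F).comp (l r).toLinearMap
      map_add' _ _ := by ext; simp
      map_smul' _ _ := by ext; simp }
  have hτ : Continuous fun p : R × E × F => τ p.1 p.2.1 p.2.2 :=
    ProjTensor.continuous_mk.comp (f := fun p : R × E × F => (l p.1 p.2.1, p.2.2))
      ((hl.comp (f := fun p : R × E × F => (p.1, p.2.1)) (by fun_prop)).prodMk (by fun_prop))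
  refine ProjTensor.continuous_lift_param τ hτ
    (fun r => map (l r) (ContinuousLinearMap.id ℂ F)) fun r x y => ?_
  rw [map_mk]
  rfl

theorem ProjTensor.continuous_map_right {R : Type*} [AddCommGroup R] [Module ℂ R] [UniformSpace R]
    [IsFrechetSpace R] (l : R →ₗ[ℂ] F →L[ℂ] F) (hl : Continuous fun p : R × F => l p.1 p.2) :
    Continuous fun p : R × ProjTensor E F =>
      map (ContinuousLinearMap.id ℂ E) (l p.1) p.2 := by
  let τ : R →ₗ[ℂ] E →ₗ[ℂ] F →ₗ[ℂ] ProjTensor E F :=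
    { toFun r := (ProjTensor.mk E F).compl₂ (l r).toLinearMap
      map_add' _ _ := by ext; simp
      map_smul' _ _ := by ext; simp }
  have hτ : Continuous fun p : R × E × F => τ p.1 p.2.1 p.2.2 :=
    ProjTensor.continuous_mk.comp (f := fun p : R × E × F => (p.2.1, l p.1 p.2.2))
      ((by fun_prop : Continuous fun p : R × E × F => p.2.1).prodMk
        (hl.comp (f := fun p : R × E × F => (p.1, p.2.2)) (by fun_prop)))
  refine ProjTensor.continuous_lift_param τ hτ
    (fun r => map (ContinuousLinearMap.id ℂ E) (l r)) fun r x y => ?_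
  rw [map_mk]
  rfl

end ProjectiveTensor

section ClosedQuotient

variable (E : Type*) [AddCommGroup E] [Module ℂ E] [UniformSpace E] [IsFrechetSpace E]

/-- The quotient of a Fréchet space by the closure of a subspace. -/
def ClosedQuotient (L : Submodule ℂ E) : Type _ := E ⧸ L.topologicalClosure

variable {E} (L : Submodule ℂ E)

noncomputable instance : AddCommGroup (ClosedQuotient E L) :=
  inferInstanceAs (AddCommGroup (E ⧸ L.topologicalClosure))
noncomputable instance : Module ℂ (ClosedQuotient E L) :=
  inferInstanceAs (Module ℂ (E ⧸ L.topologicalClosure))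
/-- The quotient topology. -/
instance : TopologicalSpace (ClosedQuotient E L) :=
  inferInstanceAs (TopologicalSpace (E ⧸ L.topologicalClosure))
instance : IsTopologicalAddGroup (ClosedQuotient E L) :=
  inferInstanceAs (IsTopologicalAddGroup (E ⧸ L.topologicalClosure))
instance : ContinuousSMul ℂ (ClosedQuotient E L) :=
  inferInstanceAs (ContinuousSMul ℂ (E ⧸ L.topologicalClosure))
noncomputable instance : UniformSpace (ClosedQuotient E L) :=
  IsTopologicalAddGroup.rightUniformSpace (ClosedQuotient E L)

/-- The quotient map. -/
noncomputable def ClosedQuotient.mk : E →L[ℂ] ClosedQuotient E L := L.topologicalClosure.mkQL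

theorem ClosedQuotient.isOpenQuotientMap_mk : IsOpenQuotientMap (mk L) :=
  L.topologicalClosure.isOpenQuotientMap_mkQL

instance : IsFrechetSpace (ClosedQuotient E L) := by
  have : FirstCountableTopology E := UniformSpace.firstCountableTopology E
  have hu : IsUniformAddGroup (ClosedQuotient E L) := isUniformAddGroup_of_addCommGroup
  have hcomp : CompleteSpace (ClosedQuotient E L) :=
    QuotientAddGroup.completeSpace_right E L.topologicalClosure.toAddSubgroup
  have ht2 : T2Space (ClosedQuotient E L) := by
    have : IsClosed (L.topologicalClosure : Set E) := L.isClosed_topologicalClosure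
    have : T3Space (E ⧸ L.topologicalClosure) := inferInstance
    exact inferInstanceAs (T2Space (E ⧸ L.topologicalClosure))
  have hnhds := (ClosedQuotient.isOpenQuotientMap_mk L).map_nhds_eq 0
  rw [map_zero] at hnhds
  have hpoly : PolynormableSpace ℂ (ClosedQuotient E L) := by
    refine polynormableSpace_of_convex _ fun U hU => ?_
    rw [← hnhds] at hU
    obtain ⟨V, hV, hc, hVU⟩ := exists_convex_nhds E hU
    refine ⟨ClosedQuotient.mk L '' V, ?_, ?_, Set.image_subset_iff.2 hVU⟩
    · rw [← hnhds]; exact Filter.image_mem_map hV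
    · exact hc.linear_image ((ClosedQuotient.mk L).toLinearMap.restrictScalars ℝ)
  have hcount : (𝓝 (0 : ClosedQuotient E L)).IsCountablyGenerated := by
    rw [← hnhds]; infer_instance
  have := IsUniformAddGroup.uniformity_countably_generated (α := ClosedQuotient E L)
  exact {}

variable {G : Type*} [AddCommGroup G] [Module ℂ G] [TopologicalSpace G] [T2Space G]

/-- A continuous linear map vanishing on `L` factors through the quotient. -/
noncomputable def ClosedQuotient.lift (f : E →L[ℂ] G) (h : ∀ x ∈ L, f x = 0) :
    ClosedQuotient E L →L[ℂ] G where
  __ := L.topologicalClosure.liftQ f.toLinearMap (by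
    refine L.topologicalClosure_minimal h ?_
    exact isClosed_singleton.preimage f.continuous)
  cont := (isOpenQuotientMap_mk L).continuous_comp_iff.1 f.continuous

@[simp]
theorem ClosedQuotient.lift_mk (f : E →L[ℂ] G) (h : ∀ x ∈ L, f x = 0) (x : E) :
    lift L f h (mk L x) = f x := rfl

theorem ClosedQuotient.ext {f g : ClosedQuotient E L →L[ℂ] G}
    (h : ∀ x, f (mk L x) = g (mk L x)) : f = g := by
  ext t
  obtain ⟨x, rfl⟩ := (isOpenQuotientMap_mk L).surjective t
  exact h x

theorem IsFrechetSpace.of_isClosed (L : Submodule ℂ E) (h : IsClosed (L : Set E)) :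
    IsFrechetSpace L := by
  have hu : IsUniformAddGroup L := inferInstanceAs (IsUniformAddGroup L.toAddSubgroup)
  have hc : CompleteSpace L := h.completeSpace_coe
  have : (𝓤 L).IsCountablyGenerated := inferInstanceAs ((𝓤 (L : Set E)).IsCountablyGenerated)
  exact {}

end ClosedQuotient

/-! ### Fréchet bimodules -/

section Bimodules

variable (R : Type v) [Ring R] [Algebra ℂ R] [UniformSpace R]
variable (S : Type w) [Ring S] [Algebra ℂ S] [UniformSpace S]

/-- A Fréchet `R`-`S`-bimodule: a Fréchet space with commuting (unital) left action of `R` and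
right action of `S` (i.e. unital algebra homomorphisms from `R` and from the opposite of `S` to the
endomorphisms), both jointly continuous. A right Fréchet `S`-module is a Fréchet
`ℂ`-`S`-bimodule, and a left Fréchet `R`-module is a Fréchet `R`-`ℂ`-bimodule. -/
structure FrechetBimod where
  carrier : Type u
  [addCommGroup : AddCommGroup carrier]
  [module : Module ℂ carrier]
  [uniformSpace : UniformSpace carrier]
  [frechet : IsFrechetSpace carrier]
  /-- The left action `lact r x = r · x`. -/
  lact : R →ₐ[ℂ] (carrier →L[ℂ] carrier)
  /-- The right action `ract (op s) x = x · s`. -/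
  ract : Sᵐᵒᵖ →ₐ[ℂ] (carrier →L[ℂ] carrier)
  lact_ract : ∀ r s x, lact r (ract s x) = ract s (lact r x)
  continuous_lact : Continuous fun p : R × carrier => lact p.1 p.2
  continuous_ract : Continuous fun p : S × carrier => ract (MulOpposite.op p.1) p.2

attribute [instance] FrechetBimod.addCommGroup FrechetBimod.module FrechetBimod.uniformSpace
  FrechetBimod.frechet

instance : CoeSort (FrechetBimod.{u} R S) (Type u) := ⟨FrechetBimod.carrier⟩

/-- Right Fréchet modules. -/
abbrev FrechetRightMod := FrechetBimod.{u} ℂ S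

/-- Left Fréchet modules. -/
abbrev FrechetLeftMod := FrechetBimod.{u} R ℂ

end Bimodules

namespace FrechetBimod

section Basic

variable {R : Type v} [Ring R] [Algebra ℂ R] [UniformSpace R]
variable {S : Type w} [Ring S] [Algebra ℂ S] [UniformSpace S]

/-- The left action `r · x`. -/
def lsmul (M : FrechetBimod.{u} R S) (r : R) (x : M) : M := M.lact r x

/-- The right action `x · s`. -/
def rsmul (M : FrechetBimod.{u} R S) (x : M) (s : S) : M := M.ract (MulOpposite.op s) x

/-- Morphisms of Fréchet bimodules: continuous linear maps commuting with the actions. -/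
structure Hom (M N : FrechetBimod.{u} R S) where
  toCLM : M →L[ℂ] N
  map_lsmul : ∀ r x, toCLM (M.lsmul r x) = N.lsmul r (toCLM x)
  map_rsmul : ∀ x s, toCLM (M.rsmul x s) = N.rsmul (toCLM x) s

instance (M N : FrechetBimod.{u} R S) : CoeFun (Hom M N) (fun _ => M → N) := ⟨fun f => f.toCLM⟩

/-- Isomorphisms in the category of Fréchet bimodules. -/
def Hom.IsIso {M N : FrechetBimod.{u} R S} (f : Hom M N) : Prop :=
  ∃ g : Hom N M, (∀ x, g (f x) = x) ∧ ∀ y, f (g y) = y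

/-- Composition of morphisms. -/
def Hom.comp {L M N : FrechetBimod.{u} R S} (g : Hom M N) (f : Hom L M) : Hom L N where
  toCLM := g.toCLM.comp f.toCLM
  map_lsmul r x := by simp [f.map_lsmul, g.map_lsmul]
  map_rsmul x s := by simp [f.map_rsmul, g.map_rsmul]

/-- The kernel of a morphism, as a closed sub-bimodule. -/
noncomputable def ker {M N : FrechetBimod.{u} R S} (f : Hom M N) : FrechetBimod.{u} R S where
  carrier := LinearMap.ker f.toCLM.toLinearMap
  frechet := IsFrechetSpace.of_isClosed _ (isClosed_singleton.preimage f.toCLM.continuous)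
  lact :=
    { toFun r := (M.lact r).restrict fun x hx => by
        have := f.map_lsmul r x
        simp_all [lsmul]
      map_one' := by ext; simp
      map_mul' _ _ := by ext; simp
      map_zero' := by ext; simp
      map_add' _ _ := by ext; simp
      commutes' _ := by ext; simp [Algebra.algebraMap_eq_smul_one] }
  ract :=
    { toFun r := (M.ract r).restrict fun x hx => by
        have := f.map_rsmul x r.unop
        simp_all [rsmul]
      map_one' := by ext; simp
      map_mul' _ _ := by ext; simp
      map_zero' := by ext; simp
      map_add' _ _ := by ext; simp
      commutes' _ := by ext; simp [Algebra.algebraMap_eq_smul_one] }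
  lact_ract r s x := Subtype.ext (M.lact_ract r s x)
  continuous_lact := Continuous.subtype_mk
    (M.continuous_lact.comp (f := fun p : R × LinearMap.ker f.toCLM.toLinearMap => (p.1, (p.2 : M)))
      (by fun_prop)) _
  continuous_ract := Continuous.subtype_mk
    (M.continuous_ract.comp (f := fun p : S × LinearMap.ker f.toCLM.toLinearMap => (p.1, (p.2 : M)))
      (by fun_prop)) _

/-- The inclusion of the kernel. -/
noncomputable def kerIncl {M N : FrechetBimod.{u} R S} (f : Hom M N) : Hom (ker f) M where
  toCLM := (LinearMap.ker f.toCLM.toLinearMap).subtypeL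
  map_lsmul _ _ := rfl
  map_rsmul _ _ := rfl

/-- A morphism into `M` whose composition with `f : M → N` vanishes factors through `ker f`. -/
noncomputable def kerLift {L M N : FrechetBimod.{u} R S} (f : Hom M N) (g : Hom L M)
    (h : ∀ x, f (g x) = 0) : Hom L (ker f) where
  toCLM := g.toCLM.codRestrict _ h
  map_lsmul r x := Subtype.ext (g.map_lsmul r x)
  map_rsmul x s := Subtype.ext (g.map_rsmul x s)

/-- Restriction of scalars along `φ : R' → R` and `ψ : S' → S`. -/
abbrev restrict {R' : Type*} [Ring R'] [Algebra ℂ R'] [UniformSpace R']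
    {S' : Type*} [Ring S'] [Algebra ℂ S'] [UniformSpace S']
    (φ : R' →A[ℂ] R) (ψ : S' →A[ℂ] S) (M : FrechetBimod.{u} R S) : FrechetBimod.{u} R' S' where
  carrier := M
  lact := M.lact.comp φ.toAlgHom
  ract := M.ract.comp (AlgHom.op ψ.toAlgHom)
  lact_ract _ _ x := M.lact_ract _ _ x
  continuous_lact := M.continuous_lact.comp (f := fun p : R' × M => (φ p.1, p.2))
    ((φ.cont.comp continuous_fst).prodMk continuous_snd)
  continuous_ract := M.continuous_ract.comp (f := fun p : S' × M => (ψ p.1, p.2))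
    ((ψ.cont.comp continuous_fst).prodMk continuous_snd)

end Basic

/-- The structure map `ℂ → R`. -/
noncomputable def scalars (R : Type*) [Ring R] [Algebra ℂ R] [UniformSpace R] [IsFrechetAlgebra R] :
    ℂ →A[ℂ] R where
  toAlgHom := Algebra.ofId ℂ R
  cont := continuous_algebraMap ℂ R

section Forget

variable {R : Type v} [Ring R] [Algebra ℂ R] [UniformSpace R]
variable {S : Type w} [Ring S] [Algebra ℂ S] [UniformSpace S]

/-- The underlying right module of a bimodule. -/
noncomputable abbrev toRight [IsFrechetAlgebra R] (M : FrechetBimod.{u} R S) : FrechetRightMod.{u} S :=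
  M.restrict (scalars R) (ContinuousAlgHom.id ℂ S)

/-- The underlying left module of a bimodule. -/
noncomputable abbrev toLeft [IsFrechetAlgebra S] (M : FrechetBimod.{u} R S) : FrechetLeftMod.{u} R :=
  M.restrict (ContinuousAlgHom.id ℂ R) (scalars S)

end Forget

/-- A Fréchet algebra as a bimodule over itself. -/
abbrev self (A : Type u) [Ring A] [Algebra ℂ A] [UniformSpace A] [IsFrechetAlgebra A] :
    FrechetBimod.{u} A A where
  carrier := A
  lact :=
    { toFun a := ⟨LinearMap.mulLeft ℂ a, continuous_const_mul a⟩
      map_one' := ContinuousLinearMap.ext fun x => one_mul x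
      map_mul' a b := ContinuousLinearMap.ext fun x => mul_assoc a b x
      map_zero' := ContinuousLinearMap.ext fun x => zero_mul x
      map_add' a b := ContinuousLinearMap.ext fun x => add_mul a b x
      commutes' c := ContinuousLinearMap.ext fun x => (Algebra.smul_def c x).symm }
  ract :=
    { toFun a := ⟨LinearMap.mulRight ℂ a.unop, continuous_mul_const a.unop⟩
      map_one' := ContinuousLinearMap.ext fun x => mul_one x
      map_mul' a b := ContinuousLinearMap.ext fun x => (mul_assoc x b.unop a.unop).symm
      map_zero' := ContinuousLinearMap.ext fun x => mul_zero x
      map_add' a b := ContinuousLinearMap.ext fun x => mul_add x a.unop b.unop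
      commutes' c := ContinuousLinearMap.ext fun x =>
        (Algebra.commutes c x).symm.trans (Algebra.smul_def c x).symm }
  lact_ract a b x := (mul_assoc a x b.unop).symm
  continuous_lact := continuous_fst.mul continuous_snd
  continuous_ract := continuous_snd.mul continuous_fst

section Tensor

variable {R : Type*} [Ring R] [Algebra ℂ R] [UniformSpace R] [IsFrechetAlgebra R]
variable {S : Type*} [Ring S] [Algebra ℂ S] [UniformSpace S] [IsFrechetAlgebra S]
variable {R' : Type*} [Ring R'] [Algebra ℂ R'] [UniformSpace R']
variable {S' : Type*} [Ring S'] [Algebra ℂ S'] [UniformSpace S']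

/-- The completed projective tensor product `M ⊗̂ N` (over `ℂ`) with the outer actions
`r · (x ⊗ y) · s = (r · x) ⊗ (y · s)`. -/
noncomputable def outer (M : FrechetBimod.{u} R S') (N : FrechetBimod.{u} R' S) :
    FrechetBimod.{u} R S where
  carrier := ProjTensor M N
  lact :=
    { toFun r := ProjTensor.map (M.lact r) (ContinuousLinearMap.id ℂ N)
      map_one' := ProjTensor.ext fun x y => by simp
      map_mul' _ _ := ProjTensor.ext fun x y => by simp
      map_zero' := ProjTensor.ext fun x y => by simp
      map_add' _ _ := ProjTensor.ext fun x y => by simp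
      commutes' _ := ProjTensor.ext fun x y => by simp [Algebra.algebraMap_eq_smul_one] }
  ract :=
    { toFun s := ProjTensor.map (ContinuousLinearMap.id ℂ M) (N.ract s)
      map_one' := ProjTensor.ext fun x y => by simp
      map_mul' _ _ := ProjTensor.ext fun x y => by simp
      map_zero' := ProjTensor.ext fun x y => by simp
      map_add' _ _ := ProjTensor.ext fun x y => by simp
      commutes' _ := ProjTensor.ext fun x y => by simp [Algebra.algebraMap_eq_smul_one] }
  lact_ract r s t := by
    have : (ProjTensor.map (M.lact r) (.id ℂ N)).comp (ProjTensor.map (.id ℂ M) (N.ract s)) =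
        (ProjTensor.map (.id ℂ M) (N.ract s)).comp (ProjTensor.map (M.lact r) (.id ℂ N)) :=
      ProjTensor.ext fun x y => by simp
    exact DFunLike.congr_fun this t
  continuous_lact := ProjTensor.continuous_map_left M.lact.toLinearMap M.continuous_lact
  continuous_ract := ProjTensor.continuous_map_right
    (N.ract.toLinearMap ∘ₗ (MulOpposite.opLinearEquiv ℂ).toLinearMap) N.continuous_ract

end Tensor

end FrechetBimod

namespace FrechetBimod

section BalancedTensor

variable {A : Type*} [Ring A] [Algebra ℂ A] [UniformSpace A]
variable {R : Type*} [Ring R] [Algebra ℂ R] [UniformSpace R]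
variable {S : Type*} [Ring S] [Algebra ℂ S] [UniformSpace S]

/-- The linear span of the elements `x · a ⊗ y - x ⊗ a · y` of `M ⊗̂ N`. -/
noncomputable def balanceSpan (M : FrechetBimod.{u} R A) (N : FrechetBimod.{u} A S) :
    Submodule ℂ (ProjTensor M N) :=
  Submodule.span ℂ {t | ∃ (x : M) (a : A) (y : N),
    t = ProjTensor.mk M N (M.rsmul x a) y - ProjTensor.mk M N x (N.lsmul a y)}

/-- The underlying Fréchet space of `M ⊗̂_A N`: the quotient of `M ⊗̂ N` by the closed linear span
of the elements `x · a ⊗ y - x ⊗ a · y`. -/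
abbrev TensorSpace (M : FrechetBimod.{u} R A) (N : FrechetBimod.{u} A S) : Type u :=
  ClosedQuotient (ProjTensor M N) (balanceSpan M N)

/-- The canonical `A`-balanced bilinear map `M × N → M ⊗̂_A N`. -/
noncomputable def tmul (M : FrechetBimod.{u} R A) (N : FrechetBimod.{u} A S) :
    M →ₗ[ℂ] N →ₗ[ℂ] TensorSpace M N :=
  (ProjTensor.mk M N).compr₂ (ClosedQuotient.mk (balanceSpan M N)).toLinearMap

theorem tmul_balanced (M : FrechetBimod.{u} R A) (N : FrechetBimod.{u} A S) (x : M) (a : A)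
    (y : N) : tmul M N (M.rsmul x a) y = tmul M N x (N.lsmul a y) := by
  rw [← sub_eq_zero]
  change ClosedQuotient.mk (balanceSpan M N) _ - ClosedQuotient.mk (balanceSpan M N) _ = 0
  rw [← map_sub]
  exact (Submodule.Quotient.mk_eq_zero _).2
    (Submodule.le_topologicalClosure _ (Submodule.subset_span ⟨x, a, y, rfl⟩))

theorem continuous_tmul (M : FrechetBimod.{u} R A) (N : FrechetBimod.{u} A S) :
    Continuous fun p : M × N => tmul M N p.1 p.2 :=
  (ClosedQuotient.mk (balanceSpan M N)).continuous.comp ProjTensor.continuous_mk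

section

variable {G : Type*} [AddCommGroup G] [Module ℂ G] [UniformSpace G]

theorem tensor_ext {M : FrechetBimod.{u} R A} {N : FrechetBimod.{u} A S} [T2Space G]
    {f g : TensorSpace M N →L[ℂ] G} (h : ∀ x y, f (tmul M N x y) = g (tmul M N x y)) : f = g := by
  refine ClosedQuotient.ext _ fun t => ?_
  have : f.comp (ClosedQuotient.mk (balanceSpan M N)) =
    g.comp (ClosedQuotient.mk (balanceSpan M N)) := ProjTensor.ext h
  exact DFunLike.congr_fun this t

/-- The map `M ⊗̂_A N → G` induced by a continuous balanced bilinear map `M × N → G`. -/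
noncomputable def tensorLift (M : FrechetBimod.{u} R A) (N : FrechetBimod.{u} A S)
    [IsFrechetSpace G] (f : M →ₗ[ℂ] N →ₗ[ℂ] G) (hf : Continuous fun p : M × N => f p.1 p.2)
    (hb : ∀ x a y, f (M.rsmul x a) y = f x (N.lsmul a y)) : TensorSpace M N →L[ℂ] G :=
  ClosedQuotient.lift _ (ProjTensor.lift f hf) (by
    intro t ht
    induction ht using Submodule.span_induction with
    | mem t ht => obtain ⟨x, a, y, rfl⟩ := ht; simp [hb]
    | zero => simp
    | add _ _ _ _ ha hb => simp [ha, hb]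
    | smul _ _ _ ha => simp [ha])

@[simp]
theorem tensorLift_tmul (M : FrechetBimod.{u} R A) (N : FrechetBimod.{u} A S)
    [IsFrechetSpace G] (f : M →ₗ[ℂ] N →ₗ[ℂ] G) (hf : Continuous fun p : M × N => f p.1 p.2)
    (hb : ∀ x a y, f (M.rsmul x a) y = f x (N.lsmul a y)) (x : M) (y : N) :
    tensorLift M N f hf hb (tmul M N x y) = f x y :=
  ProjTensor.lift_mk f hf x y

end

/-- The map `f ⊗ g : M ⊗̂_A N → M' ⊗̂_A N'` on underlying spaces. -/
noncomputable def tensorMap {R' : Type*} [Ring R'] [Algebra ℂ R'] [UniformSpace R']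
    {S' : Type*} [Ring S'] [Algebra ℂ S'] [UniformSpace S']
    {M : FrechetBimod.{u} R A} {N : FrechetBimod.{u} A S}
    {M' : FrechetBimod.{u} R' A} {N' : FrechetBimod.{u} A S'} (f : M →L[ℂ] M') (g : N →L[ℂ] N')
    (hf : ∀ x a, f (M.rsmul x a) = M'.rsmul (f x) a)
    (hg : ∀ a y, g (N.lsmul a y) = N'.lsmul a (g y)) : TensorSpace M N →L[ℂ] TensorSpace M' N' :=
  tensorLift M N ((tmul M' N').compl₁₂ f.toLinearMap g.toLinearMap)
    ((continuous_tmul M' N').comp (f := fun p : M × N => (f p.1, g p.2)) (by fun_prop))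
    fun x a y => by
      change tmul M' N' (f (M.rsmul x a)) (g y) = tmul M' N' (f x) (g (N.lsmul a y))
      rw [hf, hg, tmul_balanced]

@[simp]
theorem tensorMap_tmul {R' : Type*} [Ring R'] [Algebra ℂ R'] [UniformSpace R']
    {S' : Type*} [Ring S'] [Algebra ℂ S'] [UniformSpace S']
    {M : FrechetBimod.{u} R A} {N : FrechetBimod.{u} A S}
    {M' : FrechetBimod.{u} R' A} {N' : FrechetBimod.{u} A S'} (f : M →L[ℂ] M') (g : N →L[ℂ] N')
    (hf : ∀ x a, f (M.rsmul x a) = M'.rsmul (f x) a)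
    (hg : ∀ a y, g (N.lsmul a y) = N'.lsmul a (g y)) (x : M) (y : N) :
    tensorMap f g hf hg (tmul M N x y) = tmul M' N' (f x) (g y) :=
  tensorLift_tmul M N _ _ _ x y

/-- The left action on `M ⊗̂_A N`. -/
noncomputable def tensorLact (M : FrechetBimod.{u} R A) (N : FrechetBimod.{u} A S) (r : R) :
    TensorSpace M N →L[ℂ] TensorSpace M N :=
  tensorMap (M.lact r) (.id ℂ N) (fun _ _ => M.lact_ract _ _ _) fun _ _ => by simp

@[simp]
theorem tensorLact_tmul (M : FrechetBimod.{u} R A) (N : FrechetBimod.{u} A S) (r : R) (x : M)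
    (y : N) : tensorLact M N r (tmul M N x y) = tmul M N (M.lact r x) y :=
  tensorMap_tmul _ _ _ _ x y

/-- The right action on `M ⊗̂_A N`. -/
noncomputable def tensorRact (M : FrechetBimod.{u} R A) (N : FrechetBimod.{u} A S) (s : Sᵐᵒᵖ) :
    TensorSpace M N →L[ℂ] TensorSpace M N :=
  tensorMap (.id ℂ M) (N.ract s) (fun _ _ => by simp) fun _ _ => (N.lact_ract _ _ _).symm

@[simp]
theorem tensorRact_tmul (M : FrechetBimod.{u} R A) (N : FrechetBimod.{u} A S) (s : Sᵐᵒᵖ) (x : M)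
    (y : N) : tensorRact M N s (tmul M N x y) = tmul M N x (N.ract s y) :=
  tensorMap_tmul _ _ _ _ x y

/-- The `A`-module tensor product `M ⊗̂_A N`, with the actions
`r · (x ⊗ y) · s = (r · x) ⊗ (y · s)`. -/
noncomputable def tensor [IsFrechetAlgebra R] [IsFrechetAlgebra S]
    (M : FrechetBimod.{u} R A) (N : FrechetBimod.{u} A S) : FrechetBimod.{u} R S where
  carrier := TensorSpace M N
  lact :=
    { toFun := tensorLact M N
      map_one' := tensor_ext fun x y => by simp
      map_mul' _ _ := tensor_ext fun x y => by simp
      map_zero' := tensor_ext fun x y => by simp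
      map_add' _ _ := tensor_ext fun x y => by simp
      commutes' _ := tensor_ext fun x y => by simp [Algebra.algebraMap_eq_smul_one] }
  ract :=
    { toFun := tensorRact M N
      map_one' := tensor_ext fun x y => by simp
      map_mul' _ _ := tensor_ext fun x y => by simp
      map_zero' := tensor_ext fun x y => by simp
      map_add' _ _ := tensor_ext fun x y => by simp
      commutes' _ := tensor_ext fun x y => by simp [Algebra.algebraMap_eq_smul_one] }
  lact_ract r s t := by
    have : (tensorLact M N r).comp (tensorRact M N s) =
        (tensorRact M N s).comp (tensorLact M N r) := tensor_ext fun x y => by simp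
    exact DFunLike.congr_fun this t
  continuous_lact := by
    refine ((IsOpenQuotientMap.id.prodMap
      (ClosedQuotient.isOpenQuotientMap_mk (balanceSpan M N))).continuous_comp_iff).1 ?_
    refine ((ClosedQuotient.mk (balanceSpan M N)).continuous.comp
      (outer M N).continuous_lact).congr fun p => ?_
    have : (ClosedQuotient.mk (balanceSpan M N)).comp (ProjTensor.map (M.lact p.1) (.id ℂ N)) =
        (tensorLact M N p.1).comp (ClosedQuotient.mk (balanceSpan M N)) :=
      ProjTensor.ext fun x y => by
        rw [ContinuousLinearMap.comp_apply, ProjTensor.map_mk]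
        exact (tensorLact_tmul M N p.1 x y).symm
    exact DFunLike.congr_fun this p.2
  continuous_ract := by
    refine ((IsOpenQuotientMap.id.prodMap
      (ClosedQuotient.isOpenQuotientMap_mk (balanceSpan M N))).continuous_comp_iff).1 ?_
    refine ((ClosedQuotient.mk (balanceSpan M N)).continuous.comp
      (outer M N).continuous_ract).congr fun p => ?_
    have : (ClosedQuotient.mk (balanceSpan M N)).comp
        (ProjTensor.map (.id ℂ M) (N.ract (MulOpposite.op p.1))) =
        (tensorRact M N (MulOpposite.op p.1)).comp (ClosedQuotient.mk (balanceSpan M N)) :=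
      ProjTensor.ext fun x y => by
        rw [ContinuousLinearMap.comp_apply, ProjTensor.map_mk]
        exact (tensorRact_tmul M N (MulOpposite.op p.1) x y).symm
    exact DFunLike.congr_fun this p.2

end BalancedTensor
end FrechetBimod

namespace FrechetBimod

section Homological

variable {R : Type v} [Ring R] [Algebra ℂ R] [UniformSpace R]
variable {S : Type w} [Ring S] [Algebra ℂ S] [UniformSpace S]

section

variable {A : Type*} [Ring A] [Algebra ℂ A] [UniformSpace A]

/-- The map `f ⊗ 1 : M ⊗̂_A N → M' ⊗̂_A N` on underlying spaces. -/
noncomputable def Hom.tensorRightAux {M M' : FrechetBimod.{u} R A} (f : Hom M M')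
    (N : FrechetBimod.{u} A S) : TensorSpace M N →L[ℂ] TensorSpace M' N :=
  tensorMap f.toCLM (.id ℂ N) f.map_rsmul fun _ _ => by simp

@[simp]
theorem Hom.tensorRightAux_tmul {M M' : FrechetBimod.{u} R A} (f : Hom M M')
    (N : FrechetBimod.{u} A S) (x : M) (y : N) :
    f.tensorRightAux N (tmul M N x y) = tmul M' N (f x) y :=
  tensorMap_tmul _ _ _ _ x y

/-- The morphism `f ⊗ 1 : M ⊗̂_A N → M' ⊗̂_A N`. -/
noncomputable def Hom.tensorRight
    [IsFrechetAlgebra R] [IsFrechetAlgebra S] {M M' : FrechetBimod.{u} R A} (f : Hom M M')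
    (N : FrechetBimod.{u} A S) : Hom (M.tensor N) (M'.tensor N) where
  toCLM := f.tensorRightAux N
  map_lsmul r t := by
    have : (f.tensorRightAux N).comp (tensorLact M N r) =
        (tensorLact M' N r).comp (f.tensorRightAux N) :=
      tensor_ext fun x y => by
        have := f.map_lsmul r x
        simp only [lsmul] at this
        simp [this]
    exact DFunLike.congr_fun this t
  map_rsmul t s := by
    have : (f.tensorRightAux N).comp (tensorRact M N (MulOpposite.op s)) =
        (tensorRact M' N (MulOpposite.op s)).comp (f.tensorRightAux N) :=
      tensor_ext fun x y => by simp
    exact DFunLike.congr_fun this t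

end

variable (R S) in
/-- Chain complexes of Fréchet bimodules, indexed by `ℤ`. -/
structure FrechetComplex where
  X : ℤ → FrechetBimod.{u} R S
  d : ∀ n, Hom (X (n + 1)) (X n)
  d_d : ∀ n x, d n (d (n + 1) x) = 0

/-- A complex is admissible if it has a contracting homotopy consisting of continuous linear
maps. -/
def FrechetComplex.IsAdmissible (C : FrechetComplex.{u} R S) : Prop :=
  ∃ s : ∀ n, C.X n →L[ℂ] C.X (n + 1),
    ∀ n x, C.d (n + 1) (s (n + 1) x) + s n (C.d n x) = x

/-- A Fréchet bimodule `P` is projective if `Hom(P, -)` takes admissible complexes to exact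
sequences. -/
def IsProjective (P : FrechetBimod.{u} R S) : Prop :=
  ∀ C : FrechetComplex.{u} R S, C.IsAdmissible → ∀ (n : ℤ) (f : Hom P (C.X (n + 1))),
    (∀ x, C.d n (f x) = 0) → ∃ g : Hom P (C.X (n + 1 + 1)), ∀ x, C.d (n + 1) (g x) = f x

/-- A projective resolution `0 ← M ← X 0 ← X 1 ← ⋯`: the modules `X n` are projective, and the
augmented complex is admissible. -/
structure ProjectiveResolution (M : FrechetBimod.{u} R S) where
  X : ℕ → FrechetBimod.{u} R S
  d : ∀ n, Hom (X (n + 1)) (X n)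
  ε : Hom (X 0) M
  projective : ∀ n, (X n).IsProjective
  ε_d : ∀ x, ε (d 0 x) = 0
  d_d : ∀ n x, d n (d (n + 1) x) = 0
  admissible : ∃ (σ : M →L[ℂ] X 0) (s : ∀ n, X n →L[ℂ] X (n + 1)),
    (∀ x, ε (σ x) = x) ∧ (∀ x, d 0 (s 0 x) + σ (ε x) = x) ∧
    ∀ n x, d (n + 1) (s (n + 1) x) + s n (d n x) = x

end Homological

section Free

variable {A : Type u} [Ring A] [Algebra ℂ A] [UniformSpace A] [IsFrechetAlgebra A]

theorem lsmul_eq_smul {S : Type w} [Ring S] [Algebra ℂ S] [UniformSpace S]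
    (M : FrechetBimod.{u} ℂ S) (c : ℂ) (x : M) : M.lsmul c x = c • x := by
  have : M.lact c = algebraMap ℂ (M →L[ℂ] M) c := M.lact.commutes c
  rw [lsmul, this, Algebra.algebraMap_eq_smul_one]
  simp

/-- The free right module `K ⊗̂ A`, with `(x ⊗ a) · b = x ⊗ ab`. -/
noncomputable def free (K : FrechetRightMod.{u} A) : FrechetRightMod.{u} A := outer K (self A)

theorem free_rsmul (K : FrechetRightMod.{u} A) (x : K) (a b : A) :
    (free K).rsmul (ProjTensor.mk K A x a) b = ProjTensor.mk K A x (a * b) :=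
  ProjTensor.map_mk _ _ x a

/-- A continuous linear map `T : K → X` induces a morphism `K ⊗̂ A → X`, `x ⊗ a ↦ T x · a`. -/
noncomputable def freeLiftAux (K : FrechetRightMod.{u} A) {X : FrechetRightMod.{u} A}
    (T : K →L[ℂ] X) : ProjTensor K A →L[ℂ] X :=
  ProjTensor.lift
    ({ toFun x :=
        { toFun a := X.rsmul (T x) a
          map_add' a b := by simp [rsmul]
          map_smul' c a := by simp [rsmul] }
       map_add' x y := by ext; simp [rsmul]
       map_smul' c x := by ext; simp [rsmul] } : K →ₗ[ℂ] A →ₗ[ℂ] X)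
    (X.continuous_ract.comp (f := fun p : K × A => (p.2, T p.1)) (by fun_prop))

theorem freeLiftAux_mk (K : FrechetRightMod.{u} A) {X : FrechetRightMod.{u} A}
    (T : K →L[ℂ] X) (x : K) (a : A) :
    freeLiftAux K T (ProjTensor.mk K A x a) = X.rsmul (T x) a :=
  ProjTensor.lift_mk _ _ x a

theorem rsmul_rsmul {R : Type*} [Ring R] [Algebra ℂ R] [UniformSpace R] (X : FrechetBimod.{u} R A)
    (x : X) (a b : A) : X.rsmul (X.rsmul x a) b = X.rsmul x (a * b) := by
  simp [rsmul]

/-- The map `freeLiftAux` as a morphism of right Fréchet modules `K ⊗̂ A → X`. -/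
noncomputable def freeLift (K : FrechetRightMod.{u} A) {X : FrechetRightMod.{u} A}
    (T : K →L[ℂ] X) : Hom (free K) X where
  toCLM := freeLiftAux K T
  map_lsmul c t := by
    rw [lsmul_eq_smul, lsmul_eq_smul]
    exact map_smul (freeLiftAux K T) c t
  map_rsmul t s := by
    have : (freeLiftAux K T).comp ((free K).ract (MulOpposite.op s)) =
        (X.ract (MulOpposite.op s)).comp (freeLiftAux K T) := by
      refine ProjTensor.ext (F := A) fun x a => ?_
      change freeLiftAux K T ((free K).rsmul (ProjTensor.mk K A x a) s) =
        X.rsmul (freeLiftAux K T (ProjTensor.mk K A x a)) s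
      rw [free_rsmul, freeLiftAux_mk, freeLiftAux_mk, rsmul_rsmul]
    exact DFunLike.congr_fun this t

/-- The map `K → K ⊗̂ A`, `x ↦ x ⊗ 1`. -/
noncomputable def freeUnit (K : FrechetRightMod.{u} A) : K →L[ℂ] free K where
  toLinearMap := (ProjTensor.mk K A).flip 1
  cont := ProjTensor.continuous_mk.comp (f := fun x : K => (x, (1 : A))) (by fun_prop)

theorem freeLift_unit (K : FrechetRightMod.{u} A) {X : FrechetRightMod.{u} A}
    (T : K →L[ℂ] X) (x : K) : freeLift K T (freeUnit K x) = T x := by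
  refine (freeLiftAux_mk K T x 1).trans ?_
  simp [rsmul]

theorem isProjective_free (K : FrechetRightMod.{u} A) : (free K).IsProjective := by
  rintro C ⟨s, hs⟩ n f hf
  refine ⟨freeLift K ((s (n + 1)).comp (f.toCLM.comp (freeUnit K))), fun t => ?_⟩
  have : (C.d (n + 1)).toCLM.comp (freeLiftAux K ((s (n + 1)).comp (f.toCLM.comp (freeUnit K)))) =
      f.toCLM := by
    refine ProjTensor.ext (F := A) fun x a => ?_
    change (C.d (n + 1)).toCLM (freeLiftAux K _ (ProjTensor.mk K A x a)) = _
    rw [freeLiftAux_mk, (C.d (n + 1)).map_rsmul]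
    have h := hs n (f (freeUnit K x))
    rw [hf, map_zero, add_zero] at h
    change (C.X (n + 1)).rsmul ((C.d (n + 1)).toCLM (s (n + 1) (f (freeUnit K x)))) a = _
    rw [h, ← f.map_rsmul]
    congr 1
    exact (free_rsmul K x 1 a).trans (by rw [one_mul])
  exact DFunLike.congr_fun this t

/-- The action map `K ⊗̂ A → K`, `x ⊗ a ↦ x · a`. -/
noncomputable def action (K : FrechetRightMod.{u} A) : Hom (free K) K := freeLift K (.id ℂ K)

theorem action_unit (K : FrechetRightMod.{u} A) (x : K) : action K (freeUnit K x) = x :=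
  freeLift_unit K _ x

/-- The successive kernels in the standard resolution of `M`: `K₀ = M`, and `Kₙ₊₁` is the kernel
of the action map `Kₙ ⊗̂ A → Kₙ`. -/
noncomputable def syzygy (M : FrechetRightMod.{u} A) : ℕ → FrechetRightMod.{u} A
  | 0 => M
  | n + 1 => ker (action (syzygy M n))

/-- The map `Kₙ ⊗̂ A → Kₙ₊₁`, `t ↦ t - action t ⊗ 1`. -/
noncomputable def toSyzygy (M : FrechetRightMod.{u} A) (n : ℕ) :
    free (syzygy M n) →L[ℂ] syzygy M (n + 1) :=
  (ContinuousLinearMap.id ℂ (free (syzygy M n)) -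
    (freeUnit (syzygy M n)).comp (action (syzygy M n)).toCLM).codRestrict
      (LinearMap.ker (action (syzygy M n)).toCLM.toLinearMap) fun t => by
        simp [action_unit]

/-- The standard projective resolution of a right Fréchet module `M`, with `n`th term
`Kₙ ⊗̂ A`. -/
noncomputable def standardResolution (M : FrechetRightMod.{u} A) : ProjectiveResolution M where
  X n := free (syzygy M n)
  d n := (kerIncl (action (syzygy M n))).comp (action (syzygy M (n + 1)))
  ε := action M
  projective n := isProjective_free _
  ε_d x := (action (syzygy M 1) x).2
  d_d n x := by
    have h : action (syzygy M (n + 1)) (kerIncl (action (syzygy M (n + 1)))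
      (action (syzygy M (n + 2)) x)) = 0 := (action (syzygy M (n + 2)) x).2
    exact (congrArg (kerIncl (action (syzygy M n))) h).trans
      (map_zero (kerIncl (action (syzygy M n))).toCLM)
  admissible := by
    have key : ∀ (n : ℕ) (t : free (syzygy M n)),
        kerIncl (action (syzygy M n)) (action (syzygy M (n + 1))
          (freeUnit (syzygy M (n + 1)) (toSyzygy M n t))) =
        t - freeUnit (syzygy M n) (action (syzygy M n) t) := by
      intro n t
      rw [action_unit]
      rfl
    have key2 : ∀ (n : ℕ) (u : syzygy M (n + 1)),
        toSyzygy M n (kerIncl (action (syzygy M n)) u) = u := by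
      intro n u
      refine Subtype.ext ?_
      have hu : action (syzygy M n) (kerIncl (action (syzygy M n)) u) = 0 := u.2
      change kerIncl (action (syzygy M n)) u - freeUnit (syzygy M n)
        (action (syzygy M n) (kerIncl (action (syzygy M n)) u)) = kerIncl (action (syzygy M n)) u
      rw [hu, map_zero, sub_zero]
    refine ⟨freeUnit M, fun n => (freeUnit (syzygy M (n + 1))).comp (toSyzygy M n),
      fun x => action_unit M x, fun x => ?_, fun n x => ?_⟩
    · have h := key 0 x
      exact (congrArg (· + freeUnit M (action M x)) h).trans (sub_add_cancel _ _)
    · have h := key (n + 1) x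
      have h2 : freeUnit (syzygy M (n + 1)) (toSyzygy M n (kerIncl (action (syzygy M n))
          (action (syzygy M (n + 1)) x))) =
          freeUnit (syzygy M (n + 1)) (action (syzygy M (n + 1)) x) := by rw [key2]
      exact (congrArg₂ (· + ·) h h2).trans (sub_add_cancel _ _)

end Free

end FrechetBimod

namespace FrechetBimod

section Tor

variable {A : Type u} [Ring A] [Algebra ℂ A] [UniformSpace A] [IsFrechetAlgebra A]

namespace ProjectiveResolution

variable {M : FrechetRightMod.{u} A} (P : ProjectiveResolution M) (N : FrechetLeftMod.{u} A)

/-- The `n`-cycles of the complex `P ⊗̂_A N`. -/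
noncomputable def cycles : ∀ n : ℕ, Submodule ℂ ((P.X n).tensor N)
  | 0 => ⊤
  | n + 1 => LinearMap.ker ((P.d n).tensorRight N).toCLM.toLinearMap

/-- The `n`-boundaries of the complex `P ⊗̂_A N`. -/
noncomputable def boundaries (n : ℕ) : Submodule ℂ ((P.X n).tensor N) :=
  LinearMap.range ((P.d n).tensorRight N).toCLM.toLinearMap

/-- The `n`th homology of the complex `P ⊗̂_A N`, as a topological vector space (with the quotient
topology, which need not be Hausdorff). -/
abbrev Homology (n : ℕ) : Type u :=
  P.cycles N n ⧸ (P.boundaries N n).comap (P.cycles N n).subtype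

end ProjectiveResolution

/-- `Tor_n^A(M, N)`: the `n`th homology of `P ⊗̂_A N`, where `P` is the standard projective
resolution of `M`. -/
abbrev Tor (n : ℕ) (M : FrechetRightMod.{u} A) (N : FrechetLeftMod.{u} A) : Type u :=
  (standardResolution M).Homology N n

/-- `M` and `N` are `n`-transversal over `A`. -/
def IsTransversal (n : ℕ) (M : FrechetRightMod.{u} A) (N : FrechetLeftMod.{u} A) : Prop :=
  (∀ m, 1 ≤ m → m ≤ n → Subsingleton (Tor m M N)) ∧ T2Space (Tor 0 M N)

end Tor

section Forms

variable (A : Type u) [Ring A] [Algebra ℂ A] [UniformSpace A] [IsFrechetAlgebra A]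

/-- The multiplication map `μ_A : A ⊗̂ A → A` on underlying spaces. -/
noncomputable def mulMap : ProjTensor A A →L[ℂ] A :=
  ProjTensor.lift (LinearMap.mul ℂ A) continuous_mul

variable {A} in
@[simp]
theorem mulMap_mk (a b : A) : mulMap A (ProjTensor.mk A A a b) = a * b :=
  ProjTensor.lift_mk _ _ a b

variable {A} in
theorem outer_self_lsmul (r x y : A) :
    (outer (self A) (self A)).lsmul r (ProjTensor.mk A A x y) = ProjTensor.mk A A (r * x) y :=
  ProjTensor.map_mk _ _ x y

variable {A} in
theorem outer_self_rsmul (x y s : A) :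
    (outer (self A) (self A)).rsmul (ProjTensor.mk A A x y) s = ProjTensor.mk A A x (y * s) :=
  ProjTensor.map_mk _ _ x y

/-- The multiplication map `μ_A : A ⊗̂ A → A` as a morphism of `A`-bimodules. -/
noncomputable def mulHom : Hom (outer (self A) (self A)) (self A) where
  toCLM := mulMap A
  map_lsmul r t := by
    have : (mulMap A).comp ((outer (self A) (self A)).lact r) =
        ((self A).lact r).comp (mulMap A) := by
      refine ProjTensor.ext (E := A) (F := A) fun x y => ?_
      refine (congrArg (mulMap A) (outer_self_lsmul r x y)).trans ?_
      refine (mulMap_mk (r * x) y).trans ((mul_assoc r x y).trans ?_)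
      exact (congrArg (r * ·) (mulMap_mk x y)).symm
    exact DFunLike.congr_fun this t
  map_rsmul t s := by
    have : (mulMap A).comp ((outer (self A) (self A)).ract (MulOpposite.op s)) =
        ((self A).ract (MulOpposite.op s)).comp (mulMap A) := by
      refine ProjTensor.ext (E := A) (F := A) fun x y => ?_
      refine (congrArg (mulMap A) (outer_self_rsmul x y s)).trans ?_
      refine (mulMap_mk x (y * s)).trans ((mul_assoc x y s).symm.trans ?_)
      exact (congrArg (· * s) (mulMap_mk x y)).symm
    exact DFunLike.congr_fun this t

/-- The bimodule `Ω¹A` of noncommutative differential `1`-forms: the kernel of the multiplication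
map `A ⊗̂ A → A`, with universal derivation `a ↦ 1 ⊗ a - a ⊗ 1`. -/
noncomputable def Omega : FrechetBimod.{u} A A := ker (mulHom A)

end Forms

section Morphism

variable {A B : Type u} [Ring A] [Algebra ℂ A] [UniformSpace A] [IsFrechetAlgebra A]
  [Ring B] [Algebra ℂ B] [UniformSpace B] [IsFrechetAlgebra B] (φ : A →A[ℂ] B)

/-- `B` as a Fréchet `B`-`A`-bimodule, via `φ`. -/
abbrev selfBA : FrechetBimod.{u} B A := (self B).restrict (.id ℂ B) φ

/-- `B` as a Fréchet `A`-`B`-bimodule, via `φ`. -/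
abbrev selfAB : FrechetBimod.{u} A B := (self B).restrict φ (.id ℂ B)

/-- `B ⊗̂_A Z ⊗̂_A B`, for a Fréchet `A`-bimodule `Z`. -/
noncomputable def baseChange (Z : FrechetBimod.{u} A A) : FrechetBimod.{u} B B :=
  ((selfBA φ).tensor Z).tensor (selfAB φ)

section BaseChangeLift

variable {φ} {Z : FrechetBimod.{u} A A} {X : FrechetBimod.{u} B B}
  (g : Hom Z (X.restrict φ φ))

/-- The map `B ⊗̂_A Z → X`, `b ⊗ z ↦ b · g z`. -/
noncomputable def baseChangeLiftLeft : TensorSpace (selfBA φ) Z →L[ℂ] X :=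
  tensorLift (selfBA φ) Z
    ({ toFun b := (X.lact b).toLinearMap ∘ₗ g.toCLM.toLinearMap
       map_add' b c := by ext; simp
       map_smul' b c := by ext; simp } : B →ₗ[ℂ] Z →ₗ[ℂ] X)
    (X.continuous_lact.comp (f := fun p : B × Z => (p.1, g p.2)) (by fun_prop))
    fun b a z => by
      have h : g (Z.lsmul a z) = X.lsmul (φ a) (g z) := g.map_lsmul a z
      change X.lact (b * φ a) (g z) = X.lact b (g (Z.lsmul a z))
      rw [h, map_mul]
      rfl

theorem baseChangeLiftLeft_tmul (b : B) (z : Z) :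
    baseChangeLiftLeft g (tmul (selfBA φ) Z b z) = X.lsmul b (g z) :=
  tensorLift_tmul (selfBA φ) Z _ _ _ b z

theorem baseChangeLiftLeft_lsmul (b : B) (t : (selfBA φ).tensor Z) :
    baseChangeLiftLeft g (((selfBA φ).tensor Z).lsmul b t) =
      X.lsmul b (baseChangeLiftLeft g t) := by
  have : (baseChangeLiftLeft g).comp (tensorLact (selfBA φ) Z b) =
      (X.lact b).comp (baseChangeLiftLeft g) := by
    refine tensor_ext fun (c : B) z => ?_
    rw [ContinuousLinearMap.comp_apply, tensorLact_tmul]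
    refine (baseChangeLiftLeft_tmul g (b * c) z).trans ?_
    rw [ContinuousLinearMap.comp_apply, baseChangeLiftLeft_tmul]
    simp [lsmul]
  exact DFunLike.congr_fun this t

theorem baseChangeLiftLeft_rsmul (t : (selfBA φ).tensor Z) (a : A) :
    baseChangeLiftLeft g (((selfBA φ).tensor Z).rsmul t a) =
      X.rsmul (baseChangeLiftLeft g t) (φ a) := by
  have : (baseChangeLiftLeft g).comp (tensorRact (selfBA φ) Z (MulOpposite.op a)) =
      (X.ract (MulOpposite.op (φ a))).comp (baseChangeLiftLeft g) := by
    refine tensor_ext fun (c : B) z => ?_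
    have h : g (Z.ract (MulOpposite.op a) z) = X.rsmul (g z) (φ a) := g.map_rsmul z a
    rw [ContinuousLinearMap.comp_apply, tensorRact_tmul, baseChangeLiftLeft_tmul, h,
      ContinuousLinearMap.comp_apply, baseChangeLiftLeft_tmul]
    exact X.lact_ract _ _ _
  exact DFunLike.congr_fun this t

/-- The map `B ⊗̂_A Z ⊗̂_A B → X`, `b ⊗ z ⊗ c ↦ b · g z · c`, on underlying spaces. -/
noncomputable def baseChangeLiftAux :
    TensorSpace ((selfBA φ).tensor Z) (selfAB φ) →L[ℂ] X :=
  tensorLift ((selfBA φ).tensor Z) (selfAB φ)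
    ({ toFun t :=
        { toFun c := X.rsmul (baseChangeLiftLeft g t) c
          map_add' a b := by simp [rsmul]
          map_smul' c a := by simp [rsmul] }
       map_add' x y := by ext; simp [rsmul]
       map_smul' c x := by ext; simp [rsmul] } : TensorSpace (selfBA φ) Z →ₗ[ℂ] B →ₗ[ℂ] X)
    (X.continuous_ract.comp
      (f := fun p : TensorSpace (selfBA φ) Z × B => (p.2, baseChangeLiftLeft g p.1)) (by fun_prop))
    fun t a c => by
      change X.rsmul (baseChangeLiftLeft g (((selfBA φ).tensor Z).rsmul t a)) c =
        X.rsmul (baseChangeLiftLeft g t) (φ a * c)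
      rw [baseChangeLiftLeft_rsmul, rsmul_rsmul]

theorem baseChangeLiftAux_tmul (t : TensorSpace (selfBA φ) Z) (c : B) :
    baseChangeLiftAux g (tmul ((selfBA φ).tensor Z) (selfAB φ) t c) =
      X.rsmul (baseChangeLiftLeft g t) c :=
  tensorLift_tmul ((selfBA φ).tensor Z) (selfAB φ) _ _ _ t c

/-- The morphism of `B`-bimodules `B ⊗̂_A Z ⊗̂_A B → X`, `b ⊗ z ⊗ c ↦ b · g z · c`, induced by a
morphism of `A`-bimodules `g : Z → X`. -/
noncomputable def baseChangeLift : Hom (baseChange φ Z) X where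
  toCLM := baseChangeLiftAux g
  map_lsmul b t := by
    have : (baseChangeLiftAux g).comp (tensorLact ((selfBA φ).tensor Z) (selfAB φ) b) =
        (X.lact b).comp (baseChangeLiftAux g) := by
      refine tensor_ext fun t (c : B) => ?_
      rw [ContinuousLinearMap.comp_apply, tensorLact_tmul]
      refine (baseChangeLiftAux_tmul g (((selfBA φ).tensor Z).lsmul b t) c).trans ?_
      rw [baseChangeLiftLeft_lsmul]
      refine Eq.trans ?_ (congrArg (X.lact b) (baseChangeLiftAux_tmul g t c)).symm
      exact (X.lact_ract _ _ _).symm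
    exact DFunLike.congr_fun this t
  map_rsmul t s := by
    have : (baseChangeLiftAux g).comp
          (tensorRact ((selfBA φ).tensor Z) (selfAB φ) (MulOpposite.op s)) =
        (X.ract (MulOpposite.op s)).comp (baseChangeLiftAux g) := by
      refine tensor_ext fun t (c : B) => ?_
      rw [ContinuousLinearMap.comp_apply, tensorRact_tmul]
      refine (baseChangeLiftAux_tmul g t (c * s)).trans ?_
      refine Eq.trans ?_ (congrArg (X.ract (MulOpposite.op s)) (baseChangeLiftAux_tmul g t c)).symm
      exact (rsmul_rsmul X _ c s).symm
    exact DFunLike.congr_fun this t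

end BaseChangeLift

/-- The map `φ ⊗ φ : A ⊗̂ A → B ⊗̂ B`. -/
noncomputable def tensorSq : ProjTensor A A →L[ℂ] ProjTensor B B :=
  ProjTensor.map φ.toContinuousLinearMap φ.toContinuousLinearMap

theorem tensorSq_mk (a b : A) :
    tensorSq φ (ProjTensor.mk A A a b) = ProjTensor.mk B B (φ a) (φ b) :=
  ProjTensor.map_mk _ _ a b

/-- `φ ⊗ φ` as a morphism of `A`-bimodules. -/
noncomputable def tensorSqHom :
    Hom (outer (self A) (self A)) ((outer (self B) (self B)).restrict φ φ) where
  toCLM := tensorSq φ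
  map_lsmul r t := by
    have : (tensorSq φ).comp ((outer (self A) (self A)).lact r) =
        ((outer (self B) (self B)).lact (φ r)).comp (tensorSq φ) := by
      refine ProjTensor.ext (E := A) (F := A) fun x y => ?_
      refine (congrArg (tensorSq φ) (outer_self_lsmul r x y)).trans ?_
      refine (tensorSq_mk φ (r * x) y).trans ?_
      rw [map_mul]
      refine (outer_self_lsmul (φ r) (φ x) (φ y)).symm.trans ?_
      exact (congrArg ((outer (self B) (self B)).lact (φ r)) (tensorSq_mk φ x y)).symm
    exact DFunLike.congr_fun this t
  map_rsmul t s := by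
    have : (tensorSq φ).comp ((outer (self A) (self A)).ract (MulOpposite.op s)) =
        ((outer (self B) (self B)).ract (MulOpposite.op (φ s))).comp (tensorSq φ) := by
      refine ProjTensor.ext (E := A) (F := A) fun x y => ?_
      refine (congrArg (tensorSq φ) (outer_self_rsmul x y s)).trans ?_
      refine (tensorSq_mk φ x (y * s)).trans ?_
      rw [map_mul]
      refine (outer_self_rsmul (φ x) (φ y) (φ s)).symm.trans ?_
      exact (congrArg ((outer (self B) (self B)).ract (MulOpposite.op (φ s)))
        (tensorSq_mk φ x y)).symm
    exact DFunLike.congr_fun this t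

theorem mulMap_tensorSq (t : ProjTensor A A) : mulMap B (tensorSq φ t) = φ (mulMap A t) := by
  have : (mulMap B).comp (tensorSq φ) = φ.toContinuousLinearMap.comp (mulMap A) :=
    ProjTensor.ext fun x y => by simp [tensorSq_mk]
  exact DFunLike.congr_fun this t

/-- The morphism of `A`-bimodules `Ω¹A → Ω¹B` given by the restriction of `φ ⊗ φ`. -/
noncomputable def omegaMap : Hom (Omega A) ((Omega B).restrict φ φ) where
  toCLM := ((tensorSq φ).comp (kerIncl (mulHom A)).toCLM).codRestrict
    (LinearMap.ker (mulHom B).toCLM.toLinearMap) fun ω => by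
      have h : mulMap A ω.1 = 0 := ω.2
      refine (mulMap_tensorSq φ ω.1).trans ?_
      rw [h, map_zero]
  map_lsmul r ω := Subtype.ext ((tensorSqHom φ).map_lsmul r ω.1)
  map_rsmul ω s := Subtype.ext ((tensorSqHom φ).map_rsmul ω.1 s)

/-- The canonical morphism `φˇ : B ⊗̂_A Ω¹A ⊗̂_A B → Ω¹B`, `b ⊗ ω ⊗ c ↦ b · (φ ⊗ φ)(ω) · c`. -/
noncomputable def checkHom : Hom (baseChange φ (Omega A)) (Omega B) := baseChangeLift (omegaMap φ)

end Morphism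

end FrechetBimod

section Main

open FrechetBimod

/-- The space `Der(A, X)` of continuous derivations of `A` with values in `X`. -/
def Der (A : Type u) [Ring A] [Algebra ℂ A] [UniformSpace A]
    (X : FrechetBimod.{u} A A) : Submodule ℂ (A →L[ℂ] X) where
  carrier := {D | ∀ a b, D (a * b) = X.lsmul a (D b) + X.rsmul (D a) b}
  zero_mem' a b := by simp [lsmul, rsmul]
  add_mem' {D D'} h h' a b := by
    simp only [Set.mem_ofPred_eq, lsmul, rsmul] at h h'
    simp [lsmul, rsmul, h, h']
    abel
  smul_mem' c D h a b := by
    simp only [Set.mem_ofPred_eq, lsmul, rsmul] at h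
    simp [lsmul, rsmul, h]

variable {A B : Type u} [Ring A] [Algebra ℂ A] [UniformSpace A] [IsFrechetAlgebra A]
  [Ring B] [Algebra ℂ B] [UniformSpace B] [IsFrechetAlgebra B] (φ : A →A[ℂ] B)

/-- The restriction map `Der(B, X) → Der(A, X)`, `D ↦ D ∘ φ`. -/
def derRestrict (X : FrechetBimod.{u} B B) (D : Der B X) : Der A (X.restrict φ φ) :=
  ⟨(D : B →L[ℂ] X).comp φ.toContinuousLinearMap, fun a b => by
    have h := D.2 (φ a) (φ b)
    rw [← map_mul] at h
    exact h⟩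

/-- Epimorphisms in the category of Fréchet algebras. -/
def IsFrechetEpi : Prop :=
  ∀ (C : Type u) [Ring C] [Algebra ℂ C] [UniformSpace C] [IsFrechetAlgebra C] (ψ ψ' : B →A[ℂ] C),
    ψ.comp φ = ψ'.comp φ → ψ = ψ'

/-- `φ : A → B` is `n`-pseudoflat if `B` and `B` are `n`-transversal over `A`. -/
def IsPseudoflat (n : ℕ) : Prop :=
  IsTransversal n (selfBA φ).toRight (selfAB φ).toLeft

/-- Condition `(*)`: `Tor_0^A(B ⊗̂_A Ω¹A, B)` is Hausdorff. -/
def ConditionStar : Prop :=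
  T2Space (Tor 0 ((selfBA φ).tensor (Omega A)).toRight (selfAB φ).toLeft)

end Main

/-! Tensoring the start of the standard resolution of `B` over `A` with `B`, and cancelling the free
factors, gives B ⊗̂ B ← K ⊗̂ B ← K' ⊗̂ B, where K = ker (B ⊗̂ A → B) and K' = ker (K ⊗̂ A → K). The
first arrow is `syzMap`, contraction of the `A`-factor against `B`. Its range is that of `relMap`, x
⊗ a ⊗ y ↦ x ⊗ ay − xa ⊗ y, and the closure of this range is the subspace divided out in B ⊗̂_A B. So
Tor_0 is Hausdorff exactly when the range is closed (`t2Space_tor_zero_iff`), and Tor_1 vanishes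
exactly when the kernel of `syzMap` lies in the range, with no closure taken, of the relation map of
K (`subsingleton_tor_one_iff`).

The link with differential forms is the isomorphism of right `A`-modules B ⊗̂_A Ω¹A ≅ K
(`omegaSyz`). It turns `syzMap` into the composite (B ⊗̂_A Ω¹A) ⊗̂ B → B ⊗̂_A Ω¹A ⊗̂_A B → Ω¹B ⊆ B
⊗̂ B, whose middle arrow is φˇ (`omegaIncl_checkHom_baseChangeMk`). The kernel of the first arrow is
the closure of the relations, and (*) says that the relations are already closed. Therefore Tor_1 =
0 is the same as injectivity of φˇ together with (*). Surjectivity of φˇ means that ker μ_B is the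
range of `relMap` for B. This holds if φ is an epimorphism and Tor_0 is Hausdorff: testing φ against
square-zero extensions puts ker μ_B inside the closure of the range. Conversely, if ker μ_B is the
range, then the range is closed, and two homomorphisms that agree on `A` are equal because 1 ⊗ b − b
⊗ 1 is a combination of relations. A bijective φˇ is an isomorphism by the open mapping theorem.
Together this is `isPseudoflat_epi_iff`.

The equivalence of (ii) and (iii) is the Yoneda lemma: Der(B, X) is Hom(Ω¹B, X), Der(A, X) is Hom(B
⊗̂_A Ω¹A ⊗̂_A B, X), and restriction along φ is composition with φˇ
(`derRestrict_bijective_iff_checkHom_isIso`). -/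

/-! ### The open mapping theorem for Fréchet spaces. -/

section OpenMapping

variable {E : Type*} [AddCommGroup E] [Module ℂ E] [UniformSpace E] [IsFrechetSpace E]
variable {F : Type*} [AddCommGroup F] [Module ℂ F] [UniformSpace F] [IsFrechetSpace F]

/-- A surjective continuous linear map between Fréchet spaces is almost open. -/
theorem IsFrechetSpace.closure_image_mem_nhds (f : E →L[ℂ] F) (hf : Function.Surjective f)
    {U : Set E} (hU : U ∈ 𝓝 (0 : E)) : closure (f '' U) ∈ 𝓝 (0 : F) := by
  obtain ⟨V, hV, hVU⟩ : ∃ V ∈ 𝓝 (0 : E), ∀ x ∈ V, ∀ y ∈ V, x - y ∈ U := by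
    have h : Filter.Tendsto (fun p : E × E => p.1 - p.2) (𝓝 0 ×ˢ 𝓝 0) (𝓝 0) := by
      have := (continuous_fst.sub continuous_snd : Continuous fun p : E × E => p.1 - p.2).tendsto
        (0, 0)
      rw [nhds_prod_eq] at this
      simpa [Pi.sub_def] using this
    obtain ⟨V, hV, W, hW, h⟩ := Filter.mem_prod_iff.1 (h hU)
    exact ⟨V ∩ W, Filter.inter_mem hV hW, fun x hx y hy => h (Set.mk_mem_prod hx.1 hy.2)⟩
  -- Any nonzero scalars tending to 0 would do: every point of `E` is scaled into `V` by some of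
  -- them, so the sets of `y` with `c n • y` in the closure of `f '' V` cover `F`, and Baire's
  -- theorem applies.
  let c : ℕ → ℂ := fun n => ((n : ℂ) + 1)⁻¹
  have hc0 : ∀ n, c n ≠ 0 := fun n => inv_ne_zero (by exact_mod_cast n.succ_ne_zero)
  have hc : Filter.Tendsto c Filter.atTop (𝓝 0) := by
    simpa [c, one_div] using tendsto_one_div_add_atTop_nhds_zero_nat (𝕜 := ℂ)
  obtain ⟨n, y₀, hy₀⟩ := nonempty_interior_of_iUnion_of_closed
    (f := fun n => (fun y : F => c n • y) ⁻¹' closure (f '' V))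
    (fun n => isClosed_closure.preimage (continuous_const_smul (c n)))
    (Set.eq_univ_of_forall fun y => by
      obtain ⟨x, rfl⟩ := hf y
      have hx : Filter.Tendsto (fun n => c n • x) Filter.atTop (𝓝 0) := by
        simpa using hc.smul_const x
      obtain ⟨n, hn⟩ := (hx.eventually_mem hV).exists
      exact Set.mem_iUnion.2 ⟨n, subset_closure ⟨c n • x, hn, map_smul f _ _⟩⟩)
  have hcont : Continuous fun z : F => (c n)⁻¹ • z + y₀ := by fun_prop
  have hmem := hcont.continuousAt.preimage_mem_nhds (x := 0)
    (t := interior ((fun y : F => c n • y) ⁻¹' closure (f '' V)))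
    (isOpen_interior.mem_nhds (by simpa using hy₀))
  filter_upwards [hmem] with z hz
  have h1 : c n • ((c n)⁻¹ • z + y₀) ∈ closure (f '' V) :=
    interior_subset (s := (fun y : F => c n • y) ⁻¹' closure (f '' V)) hz
  have h2 : c n • y₀ ∈ closure (f '' V) :=
    interior_subset (s := (fun y : F => c n • y) ⁻¹' closure (f '' V)) hy₀
  -- A translate of the interior point is removed by writing `z` as a difference of two points of
  -- the closure of `f '' V`; this is why `V` was chosen with `V - V ⊆ U`.
  have h3 : z = c n • ((c n)⁻¹ • z + y₀) - c n • y₀ := by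
    rw [smul_add, smul_inv_smul₀ (hc0 n), add_sub_cancel_right]
  rw [h3]
  refine map_mem_closure₂ continuous_sub h1 h2 ?_
  rintro _ ⟨x, hx, rfl⟩ _ ⟨y, hy, rfl⟩
  exact ⟨x - y, hVU x hx y hy, map_sub f _ _⟩

/-- The open mapping theorem for Fréchet spaces. -/
theorem IsFrechetSpace.isOpenMap (f : E →L[ℂ] F) (hf : Function.Surjective f) : IsOpenMap f := by
  have : FirstCountableTopology E := UniformSpace.firstCountableTopology E
  suffices h : ∀ U ∈ 𝓝 (0 : E), f '' U ∈ 𝓝 (0 : F) by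
    refine IsOpenMap.of_nhds_le fun x => ?_
    intro s hs
    have hU : (fun z => z + x) ⁻¹' (f ⁻¹' s) ∈ 𝓝 (0 : E) :=
      (continuous_add_const x).continuousAt.preimage_mem_nhds (by simpa using hs)
    have hcont : Continuous fun y : F => y - f x := by fun_prop
    have := hcont.continuousAt.preimage_mem_nhds (x := f x) (by simpa using h _ hU)
    filter_upwards [this] with y hy
    obtain ⟨z, hz, hzy⟩ := hy
    have hz' : f (z + x) ∈ s := hz
    rwa [map_add, hzy, sub_add_cancel] at hz'
  intro U₀ hU₀
  -- The preimage will be a limit of partial sums, so they have to be kept in a closed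
  -- neighbourhood.
  obtain ⟨U₁, hU₁, hcl, hsub⟩ := exists_mem_nhds_isClosed_subset hU₀
  -- The basis satisfies `u (n + 1) + u (n + 1) ⊆ u n`, which plays the role of a geometric series
  -- of radii.
  obtain ⟨u, hu, hadd⟩ := IsTopologicalAddGroup.exists_antitone_basis_nhds_zero E
  obtain ⟨k, hk⟩ := hu.mem_iff.1 hU₁
  have key : ∀ n y, y ∈ closure (f '' u n) →
      ∃ x ∈ u n, y - f x ∈ closure (f '' u (n + 1)) := by
    intro n y hy
    have hm := closure_image_mem_nhds f hf (hu.mem (n + 1))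
    have hcont : Continuous fun z : F => y - z := by fun_prop
    obtain ⟨_, hz, x, hx, rfl⟩ := mem_closure_iff_nhds.1 hy _
      (hcont.continuousAt.preimage_mem_nhds (x := y) (by simpa using hm))
    exact ⟨x, hx, hz⟩
  choose! g hg hg' using key
  -- Starting at `k + 1` instead of `k` leaves one halving to spare, so that all partial sums remain
  -- in `u k ⊆ U₁`.
  refine Filter.mem_of_superset (closure_image_mem_nhds f hf (hu.mem (k + 1))) fun y hy => ?_
  -- Successive approximation: each term `g` corrects the current error `y - f (s n)` up to an
  -- element of the next, smaller closure.
  let s : ℕ → E := fun n => Nat.rec 0 (fun n x => x + g (k + 1 + n) (y - f x)) n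
  have hs : ∀ n, y - f (s n) ∈ closure (f '' u (k + 1 + n)) := by
    intro n
    induction n with
    | zero => simpa [s] using hy
    | succ n ih =>
      have := hg' _ _ ih
      rw [sub_sub, ← map_add] at this
      exact this
  have hstep : ∀ n, s (n + 1) - s n ∈ u (k + 1 + n) := fun n => by
    simpa [s] using hg _ _ (hs n)
  have hdiff : ∀ m n, s (n + m) - s n ∈ u (k + n) := by
    intro m
    induction m with
    | zero => intro n; simpa using mem_of_mem_nhds (hu.mem (k + n))
    | succ m ih =>
      intro n
      -- The first increment is split off rather than the last: it and the remaining tail both lie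
      -- in `u (k + n + 1)`, so their sum lies in `u (k + n)`.
      refine hadd (k + n) ⟨_, ih (n + 1), s (n + 1) - s n, ?_, ?_⟩
      · have := hstep n
        rwa [show k + 1 + n = k + n + 1 by omega] at this
      · simp only [show n + (m + 1) = n + 1 + m by omega]
        abel
  have hcauchy : CauchySeq s := by
    have hb := hu.1.uniformity_of_nhds_zero_swapped
    refine hb.cauchySeq_iff'.2 fun n _ => ⟨n, fun m hm => ?_⟩
    obtain ⟨d, rfl⟩ := Nat.exists_eq_add_of_le hm
    exact hu.2 (show n ≤ k + n by omega) (hdiff d n)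
  obtain ⟨x, hx⟩ := cauchySeq_tendsto_of_complete hcauchy
  refine ⟨x, hsub (hcl.mem_of_tendsto hx (Filter.Eventually.of_forall fun n => hk ?_)), ?_⟩
  · simpa [s] using hdiff n 0
  · have h1 : Filter.Tendsto (fun n => y - f (s n)) Filter.atTop (𝓝 (y - f x)) :=
      tendsto_const_nhds.sub ((f.continuous.tendsto x).comp hx)
    -- The errors lie only in closures of the images `f '' u _`, so the test neighbourhood is shrunk
    -- to a closed one before continuity of `f` is used.
    have h2 : Filter.Tendsto (fun n => y - f (s n)) Filter.atTop (𝓝 0) := by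
      intro W hW
      obtain ⟨W', hW', hWc, hWW⟩ := exists_mem_nhds_isClosed_subset hW
      obtain ⟨n, hn⟩ := hu.mem_iff.1
        (f.continuous.continuousAt.preimage_mem_nhds (x := 0) (by simpa using hW'))
      rw [Filter.mem_map]
      filter_upwards [Filter.Ici_mem_atTop n] with m hm
      refine hWW ?_
      refine closure_minimal (Set.image_subset_iff.2 ?_) hWc (hs m)
      exact (hu.2 (show n ≤ k + 1 + m from le_trans hm (by omega))).trans hn
    exact (sub_eq_zero.1 (tendsto_nhds_unique h1 h2)).symm

end OpenMapping

/-! ### Products of Fréchet spaces. -/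

section Prod

variable {E : Type*} [AddCommGroup E] [Module ℂ E] [UniformSpace E] [IsFrechetSpace E]
variable {F : Type*} [AddCommGroup F] [Module ℂ F] [UniformSpace F] [IsFrechetSpace F]

instance IsFrechetSpace.prod : IsFrechetSpace (E × F) := by
  have : PolynormableSpace ℂ (E × F) :=
    .inf (.induced (LinearMap.fst ℂ E F)) (.induced (LinearMap.snd ℂ E F))
  exact {}

end Prod

namespace FrechetBimod

/-! ### Identities for bimodule actions, and isomorphisms. -/

section Actions

variable {R : Type v} [Ring R] [Algebra ℂ R] [UniformSpace R]
variable {S : Type w} [Ring S] [Algebra ℂ S] [UniformSpace S]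
variable (M : FrechetBimod.{u} R S)

theorem one_lsmul (x : M) : M.lsmul 1 x = x := by simp [lsmul]

theorem rsmul_one (x : M) : M.rsmul x 1 = x := by simp [rsmul]

theorem lsmul_lsmul (r s : R) (x : M) : M.lsmul r (M.lsmul s x) = M.lsmul (r * s) x := by
  simp [lsmul]

theorem rsmul_mul (x : M) (r s : S) : M.rsmul x (r * s) = M.rsmul (M.rsmul x r) s := by
  simp [rsmul]

theorem lsmul_rsmul (r : R) (x : M) (s : S) :
    M.lsmul r (M.rsmul x s) = M.rsmul (M.lsmul r x) s := M.lact_ract _ _ _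

theorem lsmul_add (r : R) (x y : M) : M.lsmul r (x + y) = M.lsmul r x + M.lsmul r y :=
  map_add (M.lact r) x y

theorem lsmul_sub (r : R) (x y : M) : M.lsmul r (x - y) = M.lsmul r x - M.lsmul r y :=
  map_sub (M.lact r) x y

theorem rsmul_add (x y : M) (s : S) : M.rsmul (x + y) s = M.rsmul x s + M.rsmul y s :=
  map_add (M.ract _) x y

theorem rsmul_sub (x y : M) (s : S) : M.rsmul (x - y) s = M.rsmul x s - M.rsmul y s :=
  map_sub (M.ract _) x y

theorem add_lsmul (r s : R) (x : M) : M.lsmul (r + s) x = M.lsmul r x + M.lsmul s x := by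
  simp [lsmul]

theorem rsmul_add' (x : M) (r s : S) : M.rsmul x (r + s) = M.rsmul x r + M.rsmul x s := by
  simp [rsmul]

theorem Hom.ext_toCLM {M N : FrechetBimod.{u} R S} {f g : Hom M N} (h : f.toCLM = g.toCLM) :
    f = g := by
  cases f; cases g; cases h; rfl

/-- A bijective morphism of Fréchet bimodules is an isomorphism. -/
theorem Hom.isIso_of_bijective {M N : FrechetBimod.{u} R S} (f : Hom M N)
    (hf : Function.Bijective f) : f.IsIso := by
  let e : M ≃ₗ[ℂ] N := LinearEquiv.ofBijective f.toCLM.toLinearMap hf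
  have he : ∀ x, e x = f x := fun _ => rfl
  -- Preimages under the inverse are images under `f`, hence open by the open mapping theorem.
  have hcont : Continuous e.symm := by
    refine continuous_def.2 fun U hU => ?_
    have : e.symm ⁻¹' U = f.toCLM '' U := by
      rw [← LinearEquiv.image_eq_preimage_symm]; rfl
    rw [this]
    exact IsFrechetSpace.isOpenMap f.toCLM hf.2 U hU
  refine ⟨⟨⟨e.symm.toLinearMap, hcont⟩, fun r y => ?_, fun y s => ?_⟩,
    fun x => e.symm_apply_apply x, fun y => e.apply_symm_apply y⟩
  · refine hf.1 ((e.apply_symm_apply _).trans ?_)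
    refine Eq.trans ?_ (f.map_lsmul r _).symm
    exact (congrArg (N.lsmul r) (e.apply_symm_apply y)).symm
  · refine hf.1 ((e.apply_symm_apply _).trans ?_)
    refine Eq.trans ?_ (f.map_rsmul _ s).symm
    exact (congrArg (N.rsmul · s) (e.apply_symm_apply y)).symm

theorem Hom.IsIso.bijective {M N : FrechetBimod.{u} R S} {f : Hom M N} (hf : f.IsIso) :
    Function.Bijective f := by
  obtain ⟨g, h₁, h₂⟩ := hf
  exact ⟨Function.LeftInverse.injective h₁, Function.RightInverse.surjective h₂⟩

end Actions

/-! ### Universal property of the bimodule of 1-forms. -/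

section UniversalDerivation

variable (A : Type u) [Ring A] [Algebra ℂ A] [UniformSpace A] [IsFrechetAlgebra A]

/-- The inclusion `Ω¹A → A ⊗̂ A`. -/
noncomputable def omegaIncl : Omega A →L[ℂ] ProjTensor A A := (kerIncl (mulHom A)).toCLM

/-- The projection `A ⊗̂ A → Ω¹A`, `x ⊗ y ↦ x · dy = x ⊗ y - xy ⊗ 1`. -/
noncomputable def omegaProj : ProjTensor A A →L[ℂ] Omega A :=
  (ContinuousLinearMap.id ℂ (ProjTensor A A) -
    (⟨(ProjTensor.mk A A).flip 1, ProjTensor.continuous_mk.comp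
      (f := fun x : A => (x, (1 : A))) (by fun_prop)⟩ : A →L[ℂ] ProjTensor A A).comp
      (mulMap A)).codRestrict (LinearMap.ker (mulHom A).toCLM.toLinearMap) fun t => by
    change mulMap A (t - ProjTensor.mk A A (mulMap A t) 1) = 0
    simp

variable {A}

theorem omegaIncl_omegaProj (t : ProjTensor A A) :
    omegaIncl A (omegaProj A t) = t - ProjTensor.mk A A (mulMap A t) 1 := rfl

theorem mulMap_omegaIncl (ω : Omega A) : mulMap A (omegaIncl A ω) = 0 := ω.2

theorem omegaIncl_injective : Function.Injective (omegaIncl A) := Subtype.val_injective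

theorem omegaIncl_lsmul (r : A) (ω : Omega A) : omegaIncl A ((Omega A).lsmul r ω) =
    (outer (self A) (self A)).lsmul r (omegaIncl A ω) := rfl

theorem omegaIncl_rsmul (ω : Omega A) (s : A) : omegaIncl A ((Omega A).rsmul ω s) =
    (outer (self A) (self A)).rsmul (omegaIncl A ω) s := rfl

/-- The correction term `μ(t) ⊗ 1` vanishes on ker μ. Thus Ω¹A is a continuous retract of `A ⊗̂ A`,
which lets identities on Ω¹A be checked on elementary tensors. -/
theorem omegaProj_omegaIncl (ω : Omega A) : omegaProj A (omegaIncl A ω) = ω := by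
  refine omegaIncl_injective ?_
  rw [omegaIncl_omegaProj, mulMap_omegaIncl]
  simp

variable (A) in
/-- The universal derivation `a ↦ 1 ⊗ a - a ⊗ 1`. -/
noncomputable def universalDerCLM : A →L[ℂ] Omega A :=
  (omegaProj A).comp ⟨ProjTensor.mk A A 1, ProjTensor.continuous_mk.comp
    (f := fun x : A => ((1 : A), x)) (by fun_prop)⟩

theorem omegaIncl_universalDerCLM (a : A) : omegaIncl A (universalDerCLM A a) =
    ProjTensor.mk A A 1 a - ProjTensor.mk A A a 1 := by
  refine (omegaIncl_omegaProj _).trans ?_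
  change ProjTensor.mk A A 1 a - ProjTensor.mk A A (mulMap A (ProjTensor.mk A A 1 a)) 1 = _
  rw [mulMap_mk, one_mul]

/-- This is the identity x ⊗ y − xy ⊗ 1 = x · (1 ⊗ y − y ⊗ 1). -/
theorem omegaProj_mk (x y : A) :
    omegaProj A (ProjTensor.mk A A x y) = (Omega A).lsmul x (universalDerCLM A y) := by
  refine omegaIncl_injective ?_
  rw [omegaIncl_omegaProj, omegaIncl_lsmul, omegaIncl_universalDerCLM]
  refine Eq.trans ?_ (lsmul_sub (outer (self A) (self A)) x _ _).symm
  rw [mulMap_mk]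
  refine congrArg₂ (· - ·) ?_ ?_
  · exact (congrArg (ProjTensor.mk A A · y) (mul_one x).symm).trans (outer_self_lsmul x 1 y).symm
  · exact (outer_self_lsmul x y 1).symm

/-- The forms x · dy are the images of elementary tensors under the retraction of `A ⊗̂ A` onto Ω¹A,
so they span a dense subspace. -/
theorem omega_ext {G : Type*} [AddCommGroup G] [Module ℂ G] [UniformSpace G] [T2Space G]
    {f g : Omega A →L[ℂ] G}
    (h : ∀ x y, f ((Omega A).lsmul x (universalDerCLM A y)) =
      g ((Omega A).lsmul x (universalDerCLM A y))) : f = g := by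
  have h' : f.comp (omegaProj A) = g.comp (omegaProj A) :=
    ProjTensor.ext fun x y => by simpa [omegaProj_mk] using h x y
  ext ω
  simpa [omegaProj_omegaIncl] using DFunLike.congr_fun h' (omegaIncl A ω)

theorem omega_hom_ext {X : FrechetBimod.{u} A A} {f g : Hom (Omega A) X}
    (h : ∀ a, f (universalDerCLM A a) = g (universalDerCLM A a)) : f = g :=
  Hom.ext_toCLM (omega_ext fun x y => by rw [f.map_lsmul, g.map_lsmul, h])

/-- On the right-hand side the two terms a ⊗ b cancel. -/
theorem universalDerCLM_mul (a b : A) : universalDerCLM A (a * b) =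
    (Omega A).lsmul a (universalDerCLM A b) + (Omega A).rsmul (universalDerCLM A a) b := by
  refine omegaIncl_injective ?_
  rw [map_add, omegaIncl_lsmul, omegaIncl_rsmul, omegaIncl_universalDerCLM,
    omegaIncl_universalDerCLM, omegaIncl_universalDerCLM]
  refine Eq.trans ?_ (congrArg₂ (· + ·) (lsmul_sub (outer (self A) (self A)) a _ _)
    (rsmul_sub (outer (self A) (self A)) _ _ b)).symm
  refine Eq.trans ?_ (congrArg₂ (· + ·)
    (congrArg₂ (· - ·) (outer_self_lsmul a 1 b) (outer_self_lsmul a b 1))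
    (congrArg₂ (· - ·) (outer_self_rsmul 1 a b) (outer_self_rsmul a 1 b))).symm
  simp only [mul_one, one_mul]
  abel

variable (A) in
/-- The universal derivation as an element of `Der(A, Ω¹A)`. -/
noncomputable def universalDer : Der A (Omega A) := ⟨universalDerCLM A, universalDerCLM_mul⟩

/-- The composition of a derivation with a bimodule morphism. -/
noncomputable def Hom.compDer {X Y : FrechetBimod.{u} A A} (f : Hom X Y) (D : Der A X) : Der A Y :=
  ⟨f.toCLM.comp (D : A →L[ℂ] X), fun a b => by
    have h : (D : A →L[ℂ] X) (a * b) = _ := D.2 a b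
    simp [h, f.map_lsmul, f.map_rsmul]⟩

section DerLift

variable {X : FrechetBimod.{u} A A} (D : Der A X)

/-- The map `A ⊗̂ A → X`, `x ⊗ y ↦ x · D y`. -/
noncomputable def derLiftAux : ProjTensor A A →L[ℂ] X :=
  ProjTensor.lift
    ({ toFun x := (X.lact x).toLinearMap ∘ₗ (D : A →L[ℂ] X).toLinearMap
       map_add' x y := by ext; simp
       map_smul' c x := by ext; simp } : A →ₗ[ℂ] A →ₗ[ℂ] X)
    (X.continuous_lact.comp (f := fun p : A × A => (p.1, (D : A →L[ℂ] X) p.2)) (by fun_prop))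

theorem derLiftAux_mk (x y : A) :
    derLiftAux D (ProjTensor.mk A A x y) = X.lsmul x ((D : A →L[ℂ] X) y) :=
  ProjTensor.lift_mk _ _ x y

theorem derLiftAux_lsmul (r : A) (t : ProjTensor A A) :
    derLiftAux D ((outer (self A) (self A)).lsmul r t) = X.lsmul r (derLiftAux D t) := by
  have : (derLiftAux D).comp ((outer (self A) (self A)).lact r) =
      (X.lact r).comp (derLiftAux D) := by
    refine ProjTensor.ext (E := A) (F := A) fun x y => ?_
    refine (congrArg (derLiftAux D) (outer_self_lsmul r x y)).trans ?_
    rw [derLiftAux_mk, ContinuousLinearMap.comp_apply, derLiftAux_mk]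
    exact (lsmul_lsmul X r x _).symm
  exact DFunLike.congr_fun this t

/-- Leibniz gives x · D(ys) = (x · Dy) · s + xy · Ds. The failure of right linearity depends on `t`
only through μ(t), so it disappears on Ω¹A. -/
theorem derLiftAux_rsmul (t : ProjTensor A A) (s : A) :
    derLiftAux D ((outer (self A) (self A)).rsmul t s) =
      X.rsmul (derLiftAux D t) s + X.lsmul (mulMap A t) ((D : A →L[ℂ] X) s) := by
  let L : A →L[ℂ] X := ⟨((LinearMap.applyₗ ((D : A →L[ℂ] X) s)).comp
    (ContinuousLinearMap.coeLM ℂ)).comp X.lact.toLinearMap,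
    X.continuous_lact.comp (f := fun a : A => (a, (D : A →L[ℂ] X) s)) (by fun_prop)⟩
  have : (derLiftAux D).comp ((outer (self A) (self A)).ract (MulOpposite.op s)) =
      (X.ract (MulOpposite.op s)).comp (derLiftAux D) + L.comp (mulMap A) := by
    refine ProjTensor.ext (E := A) (F := A) fun x y => ?_
    refine (congrArg (derLiftAux D) (outer_self_rsmul x y s)).trans ?_
    have h : (D : A →L[ℂ] X) (y * s) = _ := D.2 y s
    rw [derLiftAux_mk, h, lsmul_add, lsmul_lsmul, lsmul_rsmul, add_comm]
    simp only [add_apply, ContinuousLinearMap.comp_apply, derLiftAux_mk,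
      mulMap_mk]
    rfl
  exact DFunLike.congr_fun this t

/-- The bimodule morphism `Ω¹A → X` that corresponds to a derivation `A → X`. -/
noncomputable def derLift : Hom (Omega A) X where
  toCLM := (derLiftAux D).comp (omegaIncl A)
  map_lsmul r ω := derLiftAux_lsmul D r (omegaIncl A ω)
  map_rsmul ω s := by
    refine (derLiftAux_rsmul D (omegaIncl A ω) s).trans ?_
    rw [mulMap_omegaIncl]
    simp [lsmul]

theorem derLift_universalDerCLM (a : A) :
    derLift D (universalDerCLM A a) = (D : A →L[ℂ] X) a := by
  -- The term −a ⊗ 1 of da contributes −a · D1, which has to vanish.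
  have h : (D : A →L[ℂ] X) 1 = 0 := by
    have h : (D : A →L[ℂ] X) (1 * 1) = _ := D.2 1 1
    rw [one_lsmul, rsmul_one, one_mul] at h
    simpa using h
  change derLiftAux D (omegaIncl A (universalDerCLM A a)) = _
  rw [omegaIncl_universalDerCLM, map_sub, derLiftAux_mk, derLiftAux_mk, h, one_lsmul]
  simp [lsmul]

end DerLift

end UniversalDerivation

/-! ### Elementary tensors in the bimodule M ⊗̂_A N. -/

section TensorMk

variable {A : Type*} [Ring A] [Algebra ℂ A] [UniformSpace A]
variable {R : Type*} [Ring R] [Algebra ℂ R] [UniformSpace R] [IsFrechetAlgebra R]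
variable {S : Type*} [Ring S] [Algebra ℂ S] [UniformSpace S] [IsFrechetAlgebra S]
variable (M : FrechetBimod.{u} R A) (N : FrechetBimod.{u} A S)

/-- The canonical bilinear map `M × N → M ⊗̂_A N` with values in the bimodule `M ⊗̂_A N`. -/
noncomputable def tensorMk : M →ₗ[ℂ] N →ₗ[ℂ] M.tensor N := tmul M N

theorem lsmul_tensorMk (r : R) (x : M) (y : N) :
    (M.tensor N).lsmul r (tensorMk M N x y) = tensorMk M N (M.lsmul r x) y :=
  tensorLact_tmul M N r x y

theorem rsmul_tensorMk (x : M) (y : N) (s : S) :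
    (M.tensor N).rsmul (tensorMk M N x y) s = tensorMk M N x (N.rsmul y s) :=
  tensorRact_tmul M N (MulOpposite.op s) x y

theorem tensorMk_balanced (x : M) (a : A) (y : N) :
    tensorMk M N (M.rsmul x a) y = tensorMk M N x (N.lsmul a y) := tmul_balanced M N x a y

variable {M N} in
theorem tensorMk_ext {G : Type*} [AddCommGroup G] [Module ℂ G] [UniformSpace G] [T2Space G]
    {f g : M.tensor N →L[ℂ] G} (h : ∀ x y, f (tensorMk M N x y) = g (tensorMk M N x y)) : f = g :=
  tensor_ext h

theorem continuous_tensorMk : Continuous fun p : M × N => tensorMk M N p.1 p.2 :=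
  continuous_tmul M N

/-- The map `x ↦ x ⊗ y`. -/
noncomputable def tensorMkLeft (y : N) : M →L[ℂ] M.tensor N where
  toLinearMap := (tensorMk M N).flip y
  cont := (continuous_tensorMk M N).comp (f := fun x : M => (x, y))
    (continuous_id.prodMk continuous_const)

/-- The map `y ↦ x ⊗ y`. -/
noncomputable def tensorMkRight (x : M) : N →L[ℂ] M.tensor N where
  toLinearMap := tensorMk M N x
  cont := (continuous_tensorMk M N).comp (f := fun y : N => (x, y))
    (continuous_const.prodMk continuous_id)

end TensorMk

/-! ### Base change of bimodules, and restriction of derivations as composition with φˇ. -/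

section Restriction

variable {A B : Type u} [Ring A] [Algebra ℂ A] [UniformSpace A] [IsFrechetAlgebra A]
  [Ring B] [Algebra ℂ B] [UniformSpace B] [IsFrechetAlgebra B] (φ : A →A[ℂ] B)

theorem omegaIncl_omegaMap (ω : Omega A) :
    omegaIncl B (omegaMap φ ω) = tensorSq φ (omegaIncl A ω) := rfl

theorem omegaMap_universalDerCLM (a : A) :
    omegaMap φ (universalDerCLM A a) = universalDerCLM B (φ a) := by
  refine omegaIncl_injective ?_
  refine (omegaIncl_omegaMap φ _).trans ?_
  rw [omegaIncl_universalDerCLM]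
  refine Eq.trans ?_ (omegaIncl_universalDerCLM (φ a)).symm
  rw [map_sub, tensorSq_mk, tensorSq_mk, map_one]

variable (Z : FrechetBimod.{u} A A)

/-- The canonical map `B × Z × B → B ⊗̂_A Z ⊗̂_A B`. -/
noncomputable def baseTmul (b : B) (z : Z) (c : B) : baseChange φ Z :=
  tensorMk ((selfBA φ).tensor Z) (selfAB φ) (tensorMk (selfBA φ) Z b z) c

variable {Z}

theorem lsmul_baseTmul (r b : B) (z : Z) (c : B) :
    (baseChange φ Z).lsmul r (baseTmul φ Z b z c) = baseTmul φ Z (r * b) z c :=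
  (lsmul_tensorMk _ _ _ _ _).trans (congrArg (tensorMk ((selfBA φ).tensor Z) (selfAB φ) · c)
    (lsmul_tensorMk _ _ _ _ _))

theorem rsmul_baseTmul (b : B) (z : Z) (c r : B) :
    (baseChange φ Z).rsmul (baseTmul φ Z b z c) r = baseTmul φ Z b z (c * r) :=
  rsmul_tensorMk _ _ _ _ _

theorem baseTmul_lsmul (b : B) (a : A) (z : Z) (c : B) :
    baseTmul φ Z b (Z.lsmul a z) c = baseTmul φ Z (b * φ a) z c :=
  (congrArg (tensorMk ((selfBA φ).tensor Z) (selfAB φ) · c)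
    (tensorMk_balanced (selfBA φ) Z b a z)).symm

/-- The element of `A` moves in two steps: out of `Z` as the right action on B ⊗̂_A Z, then across
the second tensor sign. -/
theorem baseTmul_rsmul (b : B) (z : Z) (a : A) (c : B) :
    baseTmul φ Z b (Z.rsmul z a) c = baseTmul φ Z b z (φ a * c) :=
  (congrArg (tensorMk ((selfBA φ).tensor Z) (selfAB φ) · c)
    (rsmul_tensorMk (selfBA φ) Z b z a).symm).trans
    (tensorMk_balanced ((selfBA φ).tensor Z) (selfAB φ) _ a c)

theorem baseChange_ext {G : Type*} [AddCommGroup G] [Module ℂ G] [UniformSpace G] [T2Space G]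
    {f g : baseChange φ Z →L[ℂ] G}
    (h : ∀ b z c, f (baseTmul φ Z b z c) = g (baseTmul φ Z b z c)) : f = g := by
  refine tensorMk_ext fun t c => ?_
  have : f.comp (tensorMkLeft ((selfBA φ).tensor Z) (selfAB φ) c) =
      g.comp (tensorMkLeft ((selfBA φ).tensor Z) (selfAB φ) c) :=
    tensorMk_ext fun (b : B) z => h b z c
  exact DFunLike.congr_fun this t

variable (Z) in
/-- The morphism of `A`-bimodules `Z → B ⊗̂_A Z ⊗̂_A B`, `z ↦ 1 ⊗ z ⊗ 1`. -/
noncomputable def baseChangeUnit : Hom Z ((baseChange φ Z).restrict φ φ) where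
  toCLM := (tensorMkLeft ((selfBA φ).tensor Z) (selfAB φ) (1 : B)).comp
    (tensorMkRight (selfBA φ) Z (1 : B))
  map_lsmul a z := by
    refine (baseTmul_lsmul φ 1 a z 1).trans ?_
    rw [one_mul]
    refine Eq.trans ?_ (lsmul_baseTmul φ (φ a) 1 z 1).symm
    rw [mul_one]
  map_rsmul z a := by
    refine (baseTmul_rsmul φ 1 z a 1).trans ?_
    rw [mul_one]
    refine Eq.trans ?_ (rsmul_baseTmul φ 1 z 1 (φ a)).symm
    rw [one_mul]

theorem baseChangeUnit_apply (z : Z) : baseChangeUnit φ Z z = baseTmul φ Z 1 z 1 := rfl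

variable {φ} in
theorem baseChangeLift_baseTmul {X : FrechetBimod.{u} B B} (g : Hom Z (X.restrict φ φ))
    (b : B) (z : Z) (c : B) :
    baseChangeLift g (baseTmul φ Z b z c) = X.rsmul (X.lsmul b (g z)) c :=
  (baseChangeLiftAux_tmul g _ _).trans (congrArg (X.rsmul · c) (baseChangeLiftLeft_tmul g b z))

variable {φ} in
theorem baseChangeLift_unit {X : FrechetBimod.{u} B B} (g : Hom Z (X.restrict φ φ)) (z : Z) :
    baseChangeLift g (baseChangeUnit φ Z z) = g z := by
  rw [baseChangeUnit_apply, baseChangeLift_baseTmul, one_lsmul, rsmul_one]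

theorem baseTmul_eq (b c : B) (z : Z) : baseTmul φ Z b z c =
    (baseChange φ Z).lsmul b ((baseChange φ Z).rsmul (baseChangeUnit φ Z z) c) := by
  rw [baseChangeUnit_apply, rsmul_baseTmul, lsmul_baseTmul, one_mul, mul_one]

/-- The elements 1 ⊗ z ⊗ 1 generate a dense sub-bimodule, by `baseTmul_eq`. Together with
`baseChangeLift` this gives the adjunction between base change and restriction of scalars. -/
theorem baseChange_hom_ext {X : FrechetBimod.{u} B B} {f g : Hom (baseChange φ Z) X}
    (h : ∀ z, f (baseChangeUnit φ Z z) = g (baseChangeUnit φ Z z)) : f = g :=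
  Hom.ext_toCLM (baseChange_ext φ fun b z c => by
    rw [baseTmul_eq, f.map_lsmul, f.map_rsmul, g.map_lsmul, g.map_rsmul, h])

/-- Restriction of scalars of a morphism. -/
noncomputable def Hom.restrictScalars {X Y : FrechetBimod.{u} B B} (f : Hom X Y) :
    Hom (X.restrict φ φ) (Y.restrict φ φ) where
  toCLM := f.toCLM
  map_lsmul a x := f.map_lsmul (φ a) x
  map_rsmul x a := f.map_rsmul x (φ a)

theorem checkHom_unit_universalDerCLM (a : A) :
    checkHom φ (baseChangeUnit φ (Omega A) (universalDerCLM A a)) = universalDerCLM B (φ a) :=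
  (baseChangeLift_unit (omegaMap φ) _).trans (omegaMap_universalDerCLM φ a)

theorem derRestrict_apply {X : FrechetBimod.{u} B B} (D : Der B X) (a : A) :
    (derRestrict φ X D : A →L[ℂ] X.restrict φ φ) a = (D : B →L[ℂ] X) (φ a) := rfl

theorem der_ext {X : FrechetBimod.{u} A A} {D D' : Der A X}
    (h : ∀ a, (D : A →L[ℂ] X) a = (D' : A →L[ℂ] X) a) : D = D' :=
  Subtype.ext (ContinuousLinearMap.ext h)

/-- If two morphisms on `Ω¹B` give derivations that agree on `A`, then they agree on the image of
`φˇ`. -/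
theorem comp_checkHom_eq {X : FrechetBimod.{u} B B} {f : Hom (baseChange φ (Omega A)) X}
    {g : Hom (Omega B) X}
    (h : ∀ a, f (baseChangeUnit φ (Omega A) (universalDerCLM A a)) = g (universalDerCLM B (φ a))) :
    f = g.comp (checkHom φ) := by
  refine baseChange_hom_ext φ fun ω => ?_
  have : (f.restrictScalars φ).comp (baseChangeUnit φ (Omega A)) =
      ((g.comp (checkHom φ)).restrictScalars φ).comp (baseChangeUnit φ (Omega A)) := by
    refine omega_hom_ext fun a => (h a).trans ?_
    exact (congrArg g (checkHom_unit_universalDerCLM φ a)).symm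
  exact congrArg (fun k => k.toCLM ω) this

/-- Yoneda: both derivation functors are represented, by Ω¹B and by B ⊗̂_A Ω¹A ⊗̂_A B, and
restriction is induced by φˇ. The forward direction only uses two bimodules, the two representing
objects. -/
theorem derRestrict_bijective_iff_checkHom_isIso :
    (∀ X : FrechetBimod.{u} B B, Function.Bijective (derRestrict φ X)) ↔ (checkHom φ).IsIso := by
  constructor
  · intro h
    -- Surjectivity at the base change extends a ↦ 1 ⊗ da ⊗ 1 to a derivation of `B`; the morphism
    -- `derLift D` that it induces is the inverse of φˇ.
    obtain ⟨D, hD⟩ := (h (baseChange φ (Omega A))).2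
      ((baseChangeUnit φ (Omega A)).compDer (universalDer A))
    have hD' : ∀ a, (D : B →L[ℂ] baseChange φ (Omega A)) (φ a) =
        baseChangeUnit φ (Omega A) (universalDerCLM A a) := fun a => by
      rw [← derRestrict_apply, hD]; rfl
    have h₁ := comp_checkHom_eq φ (f := ⟨.id ℂ _, fun _ _ => rfl, fun _ _ => rfl⟩)
      (g := derLift D) fun a => by
        refine Eq.trans ?_ (derLift_universalDerCLM D (φ a)).symm
        exact (hD' a).symm
    -- Injectivity at Ω¹B: φˇ ∘ D and the universal derivation of `B` have the same restriction to
    -- `A`.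
    have h₂ : (checkHom φ).compDer D = universalDer B := by
      refine (h (Omega B)).1 (der_ext fun a => ?_)
      refine (congrArg (checkHom φ) (hD' a)).trans ?_
      exact checkHom_unit_universalDerCLM φ a
    have h₃ : (checkHom φ).comp (derLift D) = ⟨.id ℂ _, fun _ _ => rfl, fun _ _ => rfl⟩ := by
      refine omega_hom_ext fun b => ?_
      refine (congrArg (checkHom φ) (derLift_universalDerCLM D b)).trans ?_
      exact congrArg (fun E : Der B (Omega B) => (E : B →L[ℂ] Omega B) b) h₂
    exact ⟨derLift D, fun x => (congrArg (fun k => k.toCLM x) h₁).symm,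
      fun y => congrArg (fun k => k.toCLM y) h₃⟩
  · rintro ⟨g, hg₁, hg₂⟩ X
    constructor
    · intro D D' hDD
      have h : (derLift D).comp (checkHom φ) = (derLift D').comp (checkHom φ) := by
        refine comp_checkHom_eq φ fun a => ?_
        refine (congrArg (derLift D) (checkHom_unit_universalDerCLM φ a)).trans ?_
        rw [derLift_universalDerCLM, derLift_universalDerCLM, ← derRestrict_apply, hDD,
          derRestrict_apply]
      refine der_ext fun b => ?_
      rw [← derLift_universalDerCLM, ← derLift_universalDerCLM, ← hg₂ (universalDerCLM B b)]
      exact congrArg (fun k => k.toCLM (g (universalDerCLM B b))) h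
    · intro E
      -- The extension of `E` is obtained by lifting it to the base change, precomposing with the
      -- inverse `g` of φˇ, and applying the result to the universal derivation.
      refine ⟨((baseChangeLift (derLift E)).comp g).compDer (universalDer B), der_ext fun a => ?_⟩
      rw [derRestrict_apply]
      change baseChangeLift (derLift E) (g (universalDerCLM B (φ a))) = _
      rw [← checkHom_unit_universalDerCLM, hg₁]
      exact (baseChangeLift_unit (derLift E) _).trans (derLift_universalDerCLM E a)

end Restriction

end FrechetBimod

/-! ### Hausdorff quotients. -/

theorem Submodule.t2Space_quotient_iff {E : Type*} [AddCommGroup E] [Module ℂ E]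
    [TopologicalSpace E] [IsTopologicalAddGroup E] [ContinuousSMul ℂ E] (S : Submodule ℂ E) :
    T2Space (E ⧸ S) ↔ IsClosed (S : Set E) := by
  constructor
  · intro h
    have : (S : Set E) = S.mkQL ⁻¹' {0} := by
      ext x; simp
    rw [this]
    exact isClosed_singleton.preimage S.mkQL.continuous
  · intro h
    have : T3Space (E ⧸ S) := inferInstance
    infer_instance

namespace FrechetBimod

/-! ### Relations of K ⊗̂_A N and the first syzygy of K. -/

section Syzygy

variable {A : Type u} [Ring A] [Algebra ℂ A] [UniformSpace A] [IsFrechetAlgebra A]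
variable (K : FrechetRightMod.{u} A) (N : FrechetLeftMod.{u} A)

/-- The action map `K ⊗̂ A → K`, `x ⊗ a ↦ x · a`, on underlying spaces. -/
noncomputable def actMap : ProjTensor K A →L[ℂ] K := freeLiftAux K (.id ℂ K)

theorem actMap_mk (x : K) (a : A) : actMap K (ProjTensor.mk K A x a) = K.rsmul x a :=
  freeLiftAux_mk K (.id ℂ K) x a

/-- The inclusion of the kernel of the action map `K ⊗̂ A → K`. -/
noncomputable def syzIncl : ker (action K) →L[ℂ] ProjTensor K A := (kerIncl (action K)).toCLM

theorem syzIncl_injective : Function.Injective (syzIncl K) := Subtype.val_injective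

theorem actMap_syzIncl (k : ker (action K)) : actMap K (syzIncl K k) = 0 := k.2

/-- The map `K → K ⊗̂ A`, `x ↦ x ⊗ 1`, on underlying spaces. -/
noncomputable def unitMap : K →L[ℂ] ProjTensor K A := freeUnit K

theorem actMap_unitMap (x : K) : actMap K (unitMap K x) = x := action_unit K x

/-- The projection of `K ⊗̂ A` onto the kernel of the action map, `t ↦ t - action t ⊗ 1`. -/
noncomputable def syzProj : ProjTensor K A →L[ℂ] ker (action K) :=
  (ContinuousLinearMap.id ℂ (ProjTensor K A) -
    (unitMap K).comp (actMap K)).codRestrict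
      (LinearMap.ker (action K).toCLM.toLinearMap) fun t => by
        change actMap K (t - unitMap K (actMap K t)) = 0
        rw [map_sub, actMap_unitMap, sub_self]

theorem syzIncl_syzProj (t : ProjTensor K A) :
    syzIncl K (syzProj K t) = t - ProjTensor.mk K A (actMap K t) 1 := rfl

theorem syzProj_syzIncl (k : ker (action K)) : syzProj K (syzIncl K k) = k := by
  refine syzIncl_injective K ?_
  rw [syzIncl_syzProj, actMap_syzIncl]
  simp

theorem syzIncl_rsmul (k : ker (action K)) (a : A) :
    syzIncl K ((ker (action K)).rsmul k a) = (free K).rsmul (syzIncl K k) a := rfl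

/-- The map `a ↦ a · y`. -/
noncomputable def orbitMap : N →ₗ[ℂ] A →L[ℂ] N where
  toFun y :=
    { toFun a := N.lsmul a y
      map_add' a b := by simp [lsmul]
      map_smul' c a := by simp [lsmul]
      cont := N.continuous_lact.comp (f := fun a : A => (a, y)) (by fun_prop) }
  map_add' x y := by ext a; exact lsmul_add N a x y
  map_smul' c y := by ext a; exact map_smul (N.lact a) c y

theorem orbitMap_apply (y : N) (a : A) : orbitMap N y a = N.lsmul a y := rfl

/-- Separate continuity would not be enough to define a map on the projective tensor product; the
joint continuity comes from that of the trilinear map (y, x, a) ↦ x ⊗ a · y. -/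
theorem continuous_orbitMap_tensor :
    Continuous fun p : N × ProjTensor K A => ProjTensor.map (.id ℂ K) (orbitMap N p.1) p.2 := by
  let τ : N →ₗ[ℂ] K →ₗ[ℂ] A →ₗ[ℂ] ProjTensor K N :=
    { toFun y := (ProjTensor.mk K N).compl₂ (orbitMap N y).toLinearMap
      map_add' _ _ := by ext; simp
      map_smul' _ _ := by ext; simp }
  have hτ : Continuous fun p : N × K × A => τ p.1 p.2.1 p.2.2 :=
    ProjTensor.continuous_mk.comp (f := fun p : N × K × A => (p.2.1, N.lsmul p.2.2 p.1))
      ((by fun_prop : Continuous fun p : N × K × A => p.2.1).prodMk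
        (N.continuous_lact.comp (f := fun p : N × K × A => (p.2.2, p.1)) (by fun_prop)))
  refine ProjTensor.continuous_lift_param τ hτ
    (fun y => ProjTensor.map (.id ℂ K) (orbitMap N y)) fun y x a => ?_
  rw [ProjTensor.map_mk]
  rfl

/-- The bilinear map `(x ⊗ a, y) ↦ x ⊗ a · y`. -/
noncomputable def contrBilin : ProjTensor K A →ₗ[ℂ] N →ₗ[ℂ] ProjTensor K N :=
  LinearMap.flip
    { toFun y := (ProjTensor.map (.id ℂ K) (orbitMap N y)).toLinearMap
      map_add' y z := congrArg ContinuousLinearMap.toLinearMap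
        (ProjTensor.ext (g := ProjTensor.map (.id ℂ K) (orbitMap N y) +
          ProjTensor.map (.id ℂ K) (orbitMap N z)) fun x a => by simp)
      map_smul' c y := congrArg ContinuousLinearMap.toLinearMap
        (ProjTensor.ext (g := c • ProjTensor.map (.id ℂ K) (orbitMap N y)) fun x a => by simp) }

theorem contrBilin_mk (x : K) (a : A) (y : N) :
    contrBilin K N (ProjTensor.mk K A x a) y = ProjTensor.mk K N x (N.lsmul a y) :=
  ProjTensor.map_mk _ _ _ _

theorem continuous_contrBilin :
    Continuous fun p : ProjTensor K A × N => contrBilin K N p.1 p.2 :=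
  (continuous_orbitMap_tensor K N).comp (f := fun p : ProjTensor K A × N => (p.2, p.1))
    (continuous_snd.prodMk continuous_fst)

theorem contrBilin_balanced (t : ProjTensor K A) (a : A) (y : N) :
    contrBilin K N ((free K).rsmul t a) y = contrBilin K N t (N.lsmul a y) := by
  have : (ProjTensor.map (.id ℂ K) (orbitMap N y)).comp ((free K).ract (MulOpposite.op a)) =
      ProjTensor.map (.id ℂ K) (orbitMap N (N.lsmul a y)) := by
    refine ProjTensor.ext (E := K) (F := A) fun x b => ?_
    refine (congrArg (ProjTensor.map (.id ℂ K) (orbitMap N y)) (free_rsmul K x b a)).trans ?_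
    rw [ProjTensor.map_mk, ProjTensor.map_mk, orbitMap_apply, orbitMap_apply, lsmul_lsmul]
  exact DFunLike.congr_fun this t

/-- The map `(K ⊗̂ A) ⊗̂ N → K ⊗̂ N`, `(x ⊗ a) ⊗ y ↦ x ⊗ a · y`. -/
noncomputable def contr : ProjTensor (ProjTensor K A) N →L[ℂ] ProjTensor K N :=
  ProjTensor.lift (contrBilin K N) (continuous_contrBilin K N)

theorem contr_mk (t : ProjTensor K A) (y : N) :
    contr K N (ProjTensor.mk _ N t y) = contrBilin K N t y := ProjTensor.lift_mk _ _ _ _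

/-- The map `(K ⊗̂ A) ⊗̂ N → K ⊗̂ N`, `(x ⊗ a) ⊗ y ↦ x ⊗ a · y - x · a ⊗ y`, whose range generates
the relations that define `K ⊗̂_A N`. -/
noncomputable def relMap : ProjTensor (ProjTensor K A) N →L[ℂ] ProjTensor K N :=
  contr K N - ProjTensor.map (actMap K) (.id ℂ N)

theorem relMap_mk (x : K) (a : A) (y : N) :
    relMap K N (ProjTensor.mk _ N (ProjTensor.mk K A x a) y) =
      ProjTensor.mk K N x (N.lsmul a y) - ProjTensor.mk K N (K.rsmul x a) y := by
  simp [relMap, contr_mk, contrBilin_mk, actMap_mk]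

/-- The map `ker (K ⊗̂ A → K) ⊗̂ N → K ⊗̂ N` that is the restriction of `x ⊗ a ⊗ y ↦ x ⊗ a · y`. -/
noncomputable def syzMap : ProjTensor (ker (action K)) N →L[ℂ] ProjTensor K N :=
  (contr K N).comp (ProjTensor.map (syzIncl K) (.id ℂ N))

theorem syzMap_mk (k : ker (action K)) (y : N) :
    syzMap K N (ProjTensor.mk _ N k y) = contrBilin K N (syzIncl K k) y := by
  simp [syzMap, contr_mk]

/-- Continuous linear maps on `(E ⊗̂ F) ⊗̂ G` are determined by their values on elementary
tensors. -/
theorem _root_.ProjTensor.ext₃ {E F G H : Type*} [AddCommGroup E] [Module ℂ E] [UniformSpace E]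
    [IsFrechetSpace E] [AddCommGroup F] [Module ℂ F] [UniformSpace F] [IsFrechetSpace F]
    [AddCommGroup G] [Module ℂ G] [UniformSpace G] [IsFrechetSpace G]
    [AddCommGroup H] [Module ℂ H] [UniformSpace H] [T2Space H]
    {f g : ProjTensor (ProjTensor E F) G →L[ℂ] H}
    (h : ∀ x y z, f (ProjTensor.mk _ G (ProjTensor.mk E F x y) z) =
      g (ProjTensor.mk _ G (ProjTensor.mk E F x y) z)) : f = g := by
  refine ProjTensor.ext fun t z => ?_
  let ι : ProjTensor E F →L[ℂ] ProjTensor (ProjTensor E F) G :=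
    ⟨(ProjTensor.mk _ G).flip z, ProjTensor.continuous_mk.comp
      (f := fun t : ProjTensor E F => (t, z)) (by fun_prop)⟩
  have : f.comp ι = g.comp ι := ProjTensor.ext fun x y => h x y z
  exact DFunLike.congr_fun this t

/-- The projection sends x ⊗ a to x ⊗ a − xa ⊗ 1, and contracting this with y gives the relation x ⊗
ay − xa ⊗ y. -/
theorem syzMap_comp_syzProj :
    (syzMap K N).comp (ProjTensor.map (syzProj K) (.id ℂ N)) = relMap K N := by
  refine ProjTensor.ext₃ fun x a y => ?_
  rw [ContinuousLinearMap.comp_apply, ProjTensor.map_mk, syzMap_mk, syzIncl_syzProj, relMap_mk,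
    actMap_mk, map_sub, LinearMap.sub_apply, contrBilin_mk, contrBilin_mk]
  exact congrArg (fun z => _ - ProjTensor.mk K N (K.rsmul x a) z) (one_lsmul N y)

/-- The map `syzProj ⊗ 1` is onto, being split by `syzIncl ⊗ 1`, so composing with it does not
change the range. This equality of ranges, and not only of their closures, is what makes Tor_0 and
Tor_1 computable from the explicit relations. -/
theorem range_syzMap : Set.range (syzMap K N) = Set.range (relMap K N) := by
  refine Set.Subset.antisymm ?_ ?_
  · rintro _ ⟨u, rfl⟩
    refine ⟨ProjTensor.map (syzIncl K) (.id ℂ N) u, ?_⟩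
    have h : (ProjTensor.map (syzProj K) (.id ℂ N)).comp (ProjTensor.map (syzIncl K) (.id ℂ N)) =
        .id ℂ (ProjTensor (ker (action K)) N) :=
      ProjTensor.ext fun x y => by simp [syzProj_syzIncl]
    rw [← syzMap_comp_syzProj]
    exact congrArg (syzMap K N) (DFunLike.congr_fun h u)
  · rintro _ ⟨u, rfl⟩
    exact ⟨_, DFunLike.congr_fun (syzMap_comp_syzProj K N) u⟩

/-- The range of `relMap` contains every generating relation up to sign; conversely `relMap` dies in
K ⊗̂_A N by density of elementary tensors. The range itself may exceed the algebraic span, so only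
closures are compared. -/
theorem topologicalClosure_range_relMap :
    (LinearMap.range (relMap K N).toLinearMap).topologicalClosure =
      (balanceSpan K N).topologicalClosure := by
  refine le_antisymm ?_ ?_
  · refine Submodule.topologicalClosure_minimal _ ?_ (Submodule.isClosed_topologicalClosure _)
    rintro _ ⟨u, rfl⟩
    have h : (ClosedQuotient.mk (balanceSpan K N)).comp (relMap K N) = 0 := by
      refine ProjTensor.ext₃ fun x a y => ?_
      rw [ContinuousLinearMap.comp_apply, relMap_mk, map_sub]
      exact sub_eq_zero.2 (tmul_balanced K N x a y).symm
    exact (Submodule.Quotient.mk_eq_zero _).1 (DFunLike.congr_fun h u)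
  · refine Submodule.topologicalClosure_mono (Submodule.span_le.2 ?_)
    rintro _ ⟨x, a, y, rfl⟩
    refine ⟨- ProjTensor.mk _ N (ProjTensor.mk K A x a) y, ?_⟩
    change relMap K N _ = _
    rw [map_neg, relMap_mk, neg_sub]

theorem relMap_natural {K' : FrechetRightMod.{u} A} (f : K →L[ℂ] K')
    (hf : ∀ x a, f (K.rsmul x a) = K'.rsmul (f x) a)
    (u : ProjTensor (ProjTensor K A) N) :
    relMap K' N (ProjTensor.map (ProjTensor.map f (.id ℂ A)) (.id ℂ N) u) =
      ProjTensor.map f (.id ℂ N) (relMap K N u) := by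
  have : (relMap K' N).comp (ProjTensor.map (ProjTensor.map f (.id ℂ A)) (.id ℂ N)) =
      (ProjTensor.map f (.id ℂ N)).comp (relMap K N) := by
    refine ProjTensor.ext₃ fun x a y => ?_
    simp [relMap_mk, hf]
  exact DFunLike.congr_fun this u

end Syzygy

/-! ### Tor_0 and Tor_1 through the standard resolution. -/

section TorComputation

variable {A : Type u} [Ring A] [Algebra ℂ A] [UniformSpace A] [IsFrechetAlgebra A]
variable (K : FrechetRightMod.{u} A) (N : FrechetLeftMod.{u} A)

/-- The map `(K ⊗̂ A) ⊗̂_A N → K ⊗̂ N`, `(x ⊗ a) ⊗ y ↦ x ⊗ a · y`. -/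
noncomputable def freeTensor : (free K).tensor N →L[ℂ] ProjTensor K N :=
  tensorLift (free K) N (contrBilin K N) (continuous_contrBilin K N) (contrBilin_balanced K N)

theorem freeTensor_mk (t : free K) (y : N) :
    freeTensor K N (tensorMk (free K) N t y) = contrBilin K N t y :=
  tensorLift_tmul (free K) N _ _ _ t y

/-- The canonical bilinear map `K × A → K ⊗̂ A` with values in the free module. -/
noncomputable def freeMk : K →ₗ[ℂ] A →ₗ[ℂ] free K := ProjTensor.mk K A

theorem freeTensor_freeMk (x : K) (a : A) (y : N) :
    freeTensor K N (tensorMk (free K) N (freeMk K x a) y) = ProjTensor.mk K N x (N.lsmul a y) :=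
  (freeTensor_mk K N _ y).trans (contrBilin_mk K N x a y)

/-- The map `K ⊗̂ N → (K ⊗̂ A) ⊗̂_A N`, `x ⊗ y ↦ (x ⊗ 1) ⊗ y`. -/
noncomputable def freeTensorInv : ProjTensor K N →L[ℂ] (free K).tensor N :=
  ProjTensor.lift ((tensorMk (free K) N).comp (freeUnit K).toLinearMap)
    ((continuous_tensorMk (free K) N).comp (f := fun p : K × N => (freeUnit K p.1, p.2))
      (by fun_prop))

theorem freeTensorInv_mk (x : K) (y : N) :
    freeTensorInv K N (ProjTensor.mk K N x y) = tensorMk (free K) N (freeUnit K x) y :=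
  ProjTensor.lift_mk _ _ _ _

theorem freeTensor_freeTensorInv (t : ProjTensor K N) :
    freeTensor K N (freeTensorInv K N t) = t := by
  have : (freeTensor K N).comp (freeTensorInv K N) = .id ℂ _ := by
    refine ProjTensor.ext fun x y => ?_
    rw [ContinuousLinearMap.comp_apply, freeTensorInv_mk, freeTensor_mk]
    refine (contrBilin_mk K N x 1 y).trans ?_
    rw [one_lsmul]
    rfl
  exact DFunLike.congr_fun this t

theorem freeTensorInv_freeTensor (t : (free K).tensor N) :
    freeTensorInv K N (freeTensor K N t) = t := by
  have : (freeTensorInv K N).comp (freeTensor K N) = .id ℂ _ := by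
    refine tensorMk_ext fun t y => ?_
    have h : ((freeTensorInv K N).comp (freeTensor K N)).comp (tensorMkLeft (free K) N y) =
        tensorMkLeft (free K) N y := by
      refine ProjTensor.ext (E := K) (F := A) fun x a => ?_
      change freeTensorInv K N (freeTensor K N (tensorMk (free K) N (freeMk K x a) y)) =
        tensorMk (free K) N (freeMk K x a) y
      rw [freeTensor_freeMk, freeTensorInv_mk, ← tensorMk_balanced]
      refine congrArg (tensorMk (free K) N · y) ?_
      exact (free_rsmul K x 1 a).trans (by rw [one_mul]; rfl)
    exact DFunLike.congr_fun h t
  exact DFunLike.congr_fun this t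

/-- The isomorphism `(K ⊗̂ A) ⊗̂_A N ≅ K ⊗̂ N`. -/
noncomputable def freeTensorEquiv : (free K).tensor N ≃ₜ ProjTensor K N where
  toFun := freeTensor K N
  invFun := freeTensorInv K N
  left_inv := freeTensorInv_freeTensor K N
  right_inv := freeTensor_freeTensorInv K N
  continuous_toFun := (freeTensor K N).continuous
  continuous_invFun := (freeTensorInv K N).continuous

/-- The differential `ker (action K) ⊗̂ A → K ⊗̂ A` of the standard resolution. -/
noncomputable def syzD : Hom (free (ker (action K))) (free K) :=
  (kerIncl (action K)).comp (action (ker (action K)))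

theorem syzD_freeMk (k : ker (action K)) (a : A) :
    syzD K (freeMk (ker (action K)) k a) = (free K).rsmul (syzIncl K k) a :=
  (congrArg (syzIncl K) (actMap_mk (ker (action K)) k a)).trans (syzIncl_rsmul K k a)

/-- After the free factors are cancelled, the differential of the standard resolution becomes
contraction of the syzygy against `N`. -/
theorem freeTensor_syzD (t : (free (ker (action K))).tensor N) :
    freeTensor K N ((syzD K).tensorRight N t) = syzMap K N (freeTensor (ker (action K)) N t) := by
  have : (freeTensor K N).comp ((syzD K).tensorRight N).toCLM =
      (syzMap K N).comp (freeTensor (ker (action K)) N) := by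
    refine tensorMk_ext fun t y => ?_
    have h : ((freeTensor K N).comp ((syzD K).tensorRight N).toCLM).comp
          (tensorMkLeft (free (ker (action K))) N y) =
        ((syzMap K N).comp (freeTensor (ker (action K)) N)).comp
          (tensorMkLeft (free (ker (action K))) N y) := by
      refine ProjTensor.ext (E := ker (action K)) (F := A) fun k a => ?_
      have h₁ : (syzD K).tensorRight N (tensorMk _ N (freeMk (ker (action K)) k a) y) =
          tensorMk (free K) N (syzD K (freeMk (ker (action K)) k a)) y :=
        Hom.tensorRightAux_tmul (syzD K) N _ _
      change freeTensor K N ((syzD K).tensorRight N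
        (tensorMk _ N (freeMk (ker (action K)) k a) y)) =
        syzMap K N (freeTensor (ker (action K)) N (tensorMk _ N (freeMk (ker (action K)) k a) y))
      rw [h₁, freeTensor_mk, freeTensor_freeMk, syzMap_mk, ← contrBilin_balanced]
      exact congrArg (contrBilin K N · y) (syzD_freeMk K k a)
    exact DFunLike.congr_fun h t
  exact DFunLike.congr_fun this t

theorem mem_range_syzD_iff (t : (free K).tensor N) :
    (∃ s, (syzD K).tensorRight N s = t) ↔ freeTensor K N t ∈ Set.range (relMap K N) := by
  rw [← range_syzMap]
  constructor
  · rintro ⟨s, rfl⟩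
    exact ⟨_, (freeTensor_syzD K N s).symm⟩
  · rintro ⟨u, hu⟩
    -- The contraction isomorphism for the syzygy supplies the preimage; the one for `K` reduces the
    -- equality to `freeTensor_syzD`.
    refine ⟨freeTensorInv _ N u, (freeTensorEquiv K N).injective ?_⟩
    refine (freeTensor_syzD K N _).trans ?_
    rw [freeTensor_freeTensorInv]
    exact hu

theorem t2Space_tor_zero_iff : T2Space (Tor 0 K N) ↔ IsClosed (Set.range (relMap K N)) := by
  refine (Submodule.t2Space_quotient_iff _).trans ?_
  have h : Set.range (relMap K N) = (freeTensorEquiv K N).symm ⁻¹'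
      (LinearMap.range ((syzD K).tensorRight N).toCLM.toLinearMap : Set ((free K).tensor N)) := by
    ext u
    refine Iff.trans ?_ (mem_range_syzD_iff K N (freeTensorInv K N u)).symm
    rw [freeTensor_freeTensorInv]
  rw [h, (freeTensorEquiv K N).symm.isClosed_preimage]
  -- All 0-chains are cycles, so Tor_0 is formally a quotient of the top submodule, and one
  -- homeomorphism with the whole space remains to be undone.
  change IsClosed ((Subtype.val : (⊤ : Submodule ℂ ((free K).tensor N)) → _) ⁻¹'
    (LinearMap.range ((syzD K).tensorRight N).toCLM.toLinearMap : Set ((free K).tensor N))) ↔ _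
  exact (Homeomorph.Set.univ ((free K).tensor N)).isClosed_preimage

/-- Cycles correspond to the kernel of `syzMap` for `K`, boundaries to the range of `syzMap` for the
syzygy of `K`, which is the range of its relation map. -/
theorem subsingleton_tor_one_iff : Subsingleton (Tor 1 K N) ↔
    ∀ u, syzMap K N u = 0 → u ∈ Set.range (relMap (ker (action K)) N) := by
  rw [Submodule.Quotient.subsingleton_iff, Submodule.comap_subtype_eq_top]
  constructor
  · intro h u hu
    have h₁ := @h (freeTensorInv _ N u) (show (syzD K).tensorRight N (freeTensorInv _ N u) = 0 from
      (freeTensorEquiv K N).injective ((freeTensor_syzD K N _).trans (by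
        rw [freeTensor_freeTensorInv, hu]
        exact (map_zero (freeTensor K N)).symm)))
    have h₂ := (mem_range_syzD_iff (ker (action K)) N _).1 h₁
    exact (freeTensor_freeTensorInv (ker (action K)) N u) ▸ h₂
  · intro h t ht
    have ht : (syzD K).tensorRight N t = 0 := ht
    refine (mem_range_syzD_iff (ker (action K)) N t).2 (h _ ?_)
    refine (freeTensor_syzD K N t).symm.trans ?_
    exact (congrArg (freeTensor K N) ht).trans (map_zero (freeTensor K N))

end TorComputation

end FrechetBimod

namespace FrechetBimod

/-! ### Square-zero extensions. -/

section SquareZero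

variable {B : Type u} [Ring B] [Algebra ℂ B] [UniformSpace B] [IsFrechetAlgebra B]

/-- The square-zero extension of a Fréchet algebra `B` by a Fréchet `B`-bimodule `X`. -/
def SquareZero (X : FrechetBimod.{u} B B) : Type u := B × X

variable (X : FrechetBimod.{u} B B)

namespace SquareZero

noncomputable instance : AddCommGroup (SquareZero X) := inferInstanceAs (AddCommGroup (B × X))
noncomputable instance : Module ℂ (SquareZero X) := inferInstanceAs (Module ℂ (B × X))
instance : UniformSpace (SquareZero X) := inferInstanceAs (UniformSpace (B × X))
instance : IsFrechetSpace (SquareZero X) := inferInstanceAs (IsFrechetSpace (B × X))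

instance : Mul (SquareZero X) := ⟨fun p q => (p.1 * q.1, X.lsmul p.1 q.2 + X.rsmul p.2 q.1)⟩

instance : One (SquareZero X) := ⟨((1 : B), (0 : X))⟩

variable {X}

theorem ext {p q : SquareZero X} (h₁ : p.1 = q.1) (h₂ : p.2 = q.2) : p = q := Prod.ext h₁ h₂

theorem mul_fst (p q : SquareZero X) : (p * q).1 = p.1 * q.1 := rfl

theorem mul_snd (p q : SquareZero X) : (p * q).2 = X.lsmul p.1 q.2 + X.rsmul p.2 q.1 := rfl

theorem add_fst (p q : SquareZero X) : (p + q).1 = p.1 + q.1 := rfl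

theorem add_snd (p q : SquareZero X) : (p + q).2 = p.2 + q.2 := rfl

theorem smul_fst (c : ℂ) (p : SquareZero X) : (c • p).1 = c • p.1 := rfl

theorem smul_snd (c : ℂ) (p : SquareZero X) : (c • p).2 = c • p.2 := rfl

theorem zero_fst : (0 : SquareZero X).1 = 0 := rfl

theorem zero_snd : (0 : SquareZero X).2 = 0 := rfl

theorem one_fst : (1 : SquareZero X).1 = 1 := rfl

theorem one_snd : (1 : SquareZero X).2 = 0 := rfl

noncomputable instance : Ring (SquareZero X) :=
  { (inferInstance : AddCommGroup (SquareZero X)), (inferInstance : Mul (SquareZero X)),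
    (inferInstance : One (SquareZero X)) with
    left_distrib p q r := by
      refine ext (mul_add p.1 q.1 r.1) ?_
      simp only [mul_snd, add_fst, add_snd, lsmul_add, rsmul_add']
      abel
    right_distrib p q r := by
      refine ext (add_mul p.1 q.1 r.1) ?_
      simp only [mul_snd, add_fst, add_snd, add_lsmul, rsmul_add]
      abel
    zero_mul p := ext (zero_mul p.1) (by simp [mul_snd, zero_fst, zero_snd, lsmul, rsmul])
    mul_zero p := ext (mul_zero p.1) (by simp [mul_snd, zero_fst, zero_snd, lsmul, rsmul])
    mul_assoc p q r := by
      refine ext (mul_assoc p.1 q.1 r.1) ?_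
      simp only [mul_snd, mul_fst, lsmul_add, rsmul_add, lsmul_lsmul, rsmul_mul, lsmul_rsmul,
        add_assoc]
    one_mul p := ext (one_mul p.1) (by simp [mul_snd, one_fst, one_snd, lsmul, rsmul])
    mul_one p := ext (mul_one p.1) (by simp [mul_snd, one_fst, one_snd, lsmul, rsmul])
    zsmul := fun n p => n • p
    neg_add_cancel := neg_add_cancel }

noncomputable instance : Algebra ℂ (SquareZero X) :=
  Algebra.ofModule
    (fun c p q => ext (smul_mul_assoc c p.1 q.1) (by
      simp [mul_snd, smul_fst, smul_snd, lsmul, rsmul]))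
    (fun c p q => ext (mul_smul_comm c p.1 q.1) (by
      simp [mul_snd, smul_fst, smul_snd, lsmul, rsmul]))

instance : IsFrechetAlgebra (SquareZero X) where
  toIsFrechetSpace := inferInstanceAs (IsFrechetSpace (B × X))
  continuous_mul := by
    have h : Continuous fun p : (B × X) × (B × X) =>
        (p.1.1 * p.2.1, X.lact p.1.1 p.2.2 + X.ract (MulOpposite.op p.2.1) p.1.2) :=
      (by fun_prop : Continuous fun p : (B × X) × (B × X) => p.1.1 * p.2.1).prodMk
        ((X.continuous_lact.comp (f := fun p : (B × X) × (B × X) => (p.1.1, p.2.2))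
          (by fun_prop)).add
        (X.continuous_ract.comp (f := fun p : (B × X) × (B × X) => (p.2.1, p.1.2)) (by fun_prop)))
    exact h

/-- The homomorphism `b ↦ (b, D b)`. -/
noncomputable def ofDer (D : Der B X) : B →A[ℂ] SquareZero X where
  toAlgHom := AlgHom.ofLinearMap
    (LinearMap.prod LinearMap.id (D : B →L[ℂ] X).toLinearMap : B →ₗ[ℂ] B × X)
    (ext rfl (by
      have h : (D : B →L[ℂ] X) (1 * 1) = _ := D.2 1 1
      rw [one_lsmul, rsmul_one, one_mul] at h
      change (D : B →L[ℂ] X) 1 = 0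
      simpa using h))
    fun a b => ext rfl (D.2 a b)
  cont := (continuous_id.prodMk (D : B →L[ℂ] X).continuous : Continuous fun b : B =>
    (b, (D : B →L[ℂ] X) b))

end SquareZero

end SquareZero

/-! ### Epimorphisms, derivations and the kernel of multiplication on B. -/

section Epi

variable {A B : Type u} [Ring A] [Algebra ℂ A] [UniformSpace A] [IsFrechetAlgebra A]
  [Ring B] [Algebra ℂ B] [UniformSpace B] [IsFrechetAlgebra B] (φ : A →A[ℂ] B)

variable {φ} in
-- The homomorphisms b ↦ (b, Db) and b ↦ (b, 0) into the square-zero extension agree on the image of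
-- φ, hence everywhere.
theorem _root_.IsFrechetEpi.der_eq_zero (h : IsFrechetEpi φ) {X : FrechetBimod.{u} B B}
    (D : Der B X) (hD : ∀ a, (D : B →L[ℂ] X) (φ a) = 0) (b : B) : (D : B →L[ℂ] X) b = 0 := by
  have : SquareZero.ofDer D = SquareZero.ofDer 0 := by
    refine h _ _ _ (ContinuousAlgHom.ext fun a => ?_)
    exact SquareZero.ext rfl (hD a)
  exact congrArg (fun f : B →A[ℂ] SquareZero X => (f b).2) this

/-- The derivation `b ↦ 1 ⊗ b - b ⊗ 1` with values in `B ⊗̂_A B`. -/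
noncomputable def balancedDer : Der B ((selfBA φ).tensor (selfAB φ)) :=
  ⟨tensorMkRight (selfBA φ) (selfAB φ) (1 : B) - tensorMkLeft (selfBA φ) (selfAB φ) (1 : B),
    fun a b => by
      change tensorMk (selfBA φ) (selfAB φ) (1 : B) (a * b) -
          tensorMk (selfBA φ) (selfAB φ) (a * b) (1 : B) =
        ((selfBA φ).tensor (selfAB φ)).lsmul a (tensorMk (selfBA φ) (selfAB φ) (1 : B) b -
          tensorMk (selfBA φ) (selfAB φ) b (1 : B)) +
        ((selfBA φ).tensor (selfAB φ)).rsmul (tensorMk (selfBA φ) (selfAB φ) (1 : B) a -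
          tensorMk (selfBA φ) (selfAB φ) a (1 : B)) b
      rw [lsmul_sub, rsmul_sub, lsmul_tensorMk, lsmul_tensorMk, rsmul_tensorMk, rsmul_tensorMk]
      change _ = tensorMk (selfBA φ) (selfAB φ) (a * 1 : B) b -
          tensorMk (selfBA φ) (selfAB φ) (a * b : B) (1 : B) +
        (tensorMk (selfBA φ) (selfAB φ) (1 : B) (a * b : B) -
          tensorMk (selfBA φ) (selfAB φ) a (1 * b : B))
      rw [one_mul, mul_one]
      abel⟩

theorem balancedDer_apply (b : B) : (balancedDer φ : B →L[ℂ] (selfBA φ).tensor (selfAB φ)) b =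
    tensorMk (selfBA φ) (selfAB φ) (1 : B) b - tensorMk (selfBA φ) (selfAB φ) b (1 : B) := rfl

variable {φ} in
-- The derivation c ↦ 1 ⊗ c − c ⊗ 1 into B ⊗̂_A B vanishes on the image of φ because tensors are
-- balanced, so it is zero; multiplying on the left by b finishes.
theorem _root_.IsFrechetEpi.tensorMk_eq (h : IsFrechetEpi φ) (b c : B) :
    tensorMk (selfBA φ) (selfAB φ) b c = tensorMk (selfBA φ) (selfAB φ) (b * c : B) (1 : B) := by
  have h₁ := h.der_eq_zero (balancedDer φ) (fun a => by
    rw [balancedDer_apply, sub_eq_zero]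
    have := tensorMk_balanced (selfBA φ) (selfAB φ) (1 : B) a (1 : B)
    change tensorMk (selfBA φ) (selfAB φ) (1 * φ a : B) (1 : B) =
      tensorMk (selfBA φ) (selfAB φ) (1 : B) (φ a * 1 : B) at this
    rw [one_mul, mul_one] at this
    exact this.symm) c
  rw [balancedDer_apply, sub_eq_zero] at h₁
  have h₂ := congrArg (((selfBA φ).tensor (selfAB φ)).lsmul b) h₁
  rw [lsmul_tensorMk, lsmul_tensorMk] at h₂
  change tensorMk (selfBA φ) (selfAB φ) (b * 1 : B) c = _ at h₂
  rwa [mul_one] at h₂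

/-- The quotient map `B ⊗̂ B → B ⊗̂_A B`. -/
noncomputable def balancedMk : ProjTensor B B →L[ℂ] (selfBA φ).tensor (selfAB φ) :=
  ClosedQuotient.mk (balanceSpan (selfBA φ) (selfAB φ))

variable {φ} in
-- For an epimorphism the quotient map B ⊗̂ B → B ⊗̂_A B factors through μ_B, so it kills ker μ_B.
-- Only membership in the closure follows; removing the closure is the role of Hausdorff Tor_0.
theorem _root_.IsFrechetEpi.omegaIncl_mem (h : IsFrechetEpi φ) (ω : Omega B) :
    omegaIncl B ω ∈ closure (Set.range (relMap (selfBA φ).toRight (selfAB φ).toLeft)) := by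
  have h₁ : balancedMk φ =
      (tensorMkLeft (selfBA φ) (selfAB φ) (1 : B)).comp (mulMap B) := by
    refine ProjTensor.ext (E := B) (F := B) fun b c => ?_
    rw [ContinuousLinearMap.comp_apply, mulMap_mk]
    exact h.tensorMk_eq b c
  have h₂ : balancedMk φ (omegaIncl B ω) = 0 := by
    rw [h₁, ContinuousLinearMap.comp_apply, mulMap_omegaIncl, map_zero]
  have h₃ : omegaIncl B ω ∈
      (balanceSpan (selfBA φ).toRight (selfAB φ).toLeft).topologicalClosure :=
    (Submodule.Quotient.mk_eq_zero _).1 h₂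
  rw [← topologicalClosure_range_relMap] at h₃
  exact h₃

theorem mulMap_relMap (u : ProjTensor (ProjTensor B A) B) :
    mulMap B (relMap (selfBA φ).toRight (selfAB φ).toLeft u) = 0 := by
  have : (mulMap B).comp (relMap (selfBA φ).toRight (selfAB φ).toLeft) = 0 := by
    refine ProjTensor.ext₃ (E := B) (F := A) (G := B) fun b a c => ?_
    refine (congrArg (mulMap B) (relMap_mk (selfBA φ).toRight (selfAB φ).toLeft b a c)).trans ?_
    change mulMap B (ProjTensor.mk B B b (φ a * c) - ProjTensor.mk B B (b * φ a) c) = 0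
    rw [map_sub, mulMap_mk, mulMap_mk, mul_assoc, sub_self]
  exact DFunLike.congr_fun this u

/-- If ψ and ψ' agree on `A`, then b ⊗ c ↦ ψ(b)ψ'(c) kills all relations, hence kills 1 ⊗ b − b ⊗ 1,
which gives ψ'(b) = ψ(b). -/
theorem isFrechetEpi_of_omegaIncl_mem
    (h : ∀ ω, omegaIncl B ω ∈ Set.range (relMap (selfBA φ).toRight (selfAB φ).toLeft)) :
    IsFrechetEpi φ := by
  intro C _ _ _ _ ψ ψ' hψ
  let m : ProjTensor B B →L[ℂ] C :=
    ProjTensor.lift ((LinearMap.mul ℂ C).compl₁₂ ψ.toAlgHom.toLinearMap ψ'.toAlgHom.toLinearMap)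
      ((ψ.cont.comp continuous_fst).mul (ψ'.cont.comp continuous_snd))
  have hm : ∀ b c, m (ProjTensor.mk B B b c) = ψ b * ψ' c := fun b c => ProjTensor.lift_mk _ _ b c
  have h₀ : m.comp (relMap (selfBA φ).toRight (selfAB φ).toLeft) = 0 := by
    refine ProjTensor.ext₃ (E := B) (F := A) (G := B) fun b a c => ?_
    refine (congrArg m (relMap_mk (selfBA φ).toRight (selfAB φ).toLeft b a c)).trans ?_
    change m (ProjTensor.mk B B b (φ a * c) - ProjTensor.mk B B (b * φ a) c) = 0
    have ha : ψ (φ a) = ψ' (φ a) := DFunLike.congr_fun hψ a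
    rw [map_sub, hm, hm, map_mul, map_mul, ha, mul_assoc, sub_self]
  refine ContinuousAlgHom.ext fun b => ?_
  obtain ⟨u, hu⟩ := h (universalDerCLM B b)
  have h₁ := DFunLike.congr_fun h₀ u
  rw [ContinuousLinearMap.comp_apply, hu, omegaIncl_universalDerCLM, map_sub, hm, hm, map_one,
    map_one, one_mul, mul_one] at h₁
  exact (sub_eq_zero.1 h₁).symm

end Epi

/-! ### B ⊗̂_A Ω¹A as the first syzygy of B, and φˇ as contraction. -/

section Comparison

variable {A B : Type u} [Ring A] [Algebra ℂ A] [UniformSpace A] [IsFrechetAlgebra A]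
  [Ring B] [Algebra ℂ B] [UniformSpace B] [IsFrechetAlgebra B] (φ : A →A[ℂ] B)

/-- The map `φ ⊗ 1 : A ⊗̂ A → B ⊗̂ A`. -/
noncomputable def leftMap : ProjTensor A A →L[ℂ] outer (self B) (self A) :=
  ProjTensor.map φ.toContinuousLinearMap (.id ℂ A)

theorem lsmul_leftMap_mk (b : B) (x y : A) :
    (outer (self B) (self A)).lsmul b (leftMap φ (ProjTensor.mk A A x y)) =
      ProjTensor.mk B A (b * φ x) y :=
  (congrArg ((outer (self B) (self A)).lact b) (ProjTensor.map_mk _ _ x y)).trans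
    (ProjTensor.map_mk _ _ _ _)

theorem rsmul_outer_mk (b : B) (x a : A) :
    (outer (self B) (self A)).rsmul (ProjTensor.mk B A b x) a = ProjTensor.mk B A b (x * a) :=
  ProjTensor.map_mk _ _ _ _

/-- The map `B ⊗̂_A Ω¹A → B ⊗̂ A`, `b ⊗ ω ↦ b · (φ ⊗ 1)(ω)`. -/
noncomputable def omegaSyzAux : (selfBA φ).tensor (Omega A) →L[ℂ] ProjTensor B A :=
  tensorLift (G := outer (self B) (self A)) (selfBA φ) (Omega A)
    ({ toFun b := ((outer (self B) (self A)).lact b).toLinearMap ∘ₗ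
        ((leftMap φ).comp (omegaIncl A)).toLinearMap
       map_add' b c := by ext; simp
       map_smul' b c := by ext; simp } : B →ₗ[ℂ] Omega A →ₗ[ℂ] outer (self B) (self A))
    ((outer (self B) (self A)).continuous_lact.comp
      (f := fun p : B × Omega A => (p.1, leftMap φ (omegaIncl A p.2))) (by fun_prop))
    fun b a ω => by
      have : (((outer (self B) (self A)).lact (b * φ a)).comp (leftMap φ)) =
          (((outer (self B) (self A)).lact b).comp (leftMap φ)).comp
            ((outer (self A) (self A)).lact a) := by
        refine ProjTensor.ext (E := A) (F := A) fun x y => ?_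
        refine (lsmul_leftMap_mk φ (b * φ a) x y).trans ?_
        refine Eq.trans ?_ (congrArg (fun t => (outer (self B) (self A)).lsmul b (leftMap φ t))
          (outer_self_lsmul a x y)).symm
        rw [lsmul_leftMap_mk, map_mul φ, mul_assoc b]
      exact DFunLike.congr_fun this (omegaIncl A ω)

theorem omegaSyzAux_mk (b : B) (ω : Omega A) : omegaSyzAux φ (tensorMk (selfBA φ) (Omega A) b ω) =
    (outer (self B) (self A)).lsmul b (leftMap φ (omegaIncl A ω)) :=
  tensorLift_tmul (G := outer (self B) (self A)) (selfBA φ) (Omega A) _ _ _ b ω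

theorem actMap_omegaSyzAux (t : (selfBA φ).tensor (Omega A)) :
    actMap (selfBA φ).toRight (omegaSyzAux φ t) = 0 := by
  have : (actMap (selfBA φ).toRight).comp (omegaSyzAux φ) = 0 := by
    refine tensorMk_ext fun (b : B) ω => ?_
    have h : (actMap (selfBA φ).toRight).comp
          (((outer (self B) (self A)).lact b).comp (leftMap φ)) =
        ((self B).lact b).comp (φ.toContinuousLinearMap.comp (mulMap A)) := by
      refine ProjTensor.ext (E := A) (F := A) fun x y => ?_
      refine (congrArg (actMap (selfBA φ).toRight) (lsmul_leftMap_mk φ b x y)).trans ?_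
      refine (actMap_mk (selfBA φ).toRight _ _).trans ?_
      rw [ContinuousLinearMap.comp_apply, ContinuousLinearMap.comp_apply, mulMap_mk]
      change b * φ x * φ y = b * φ (x * y)
      rw [map_mul, mul_assoc]
    refine (congrArg (actMap (selfBA φ).toRight) (omegaSyzAux_mk φ b ω)).trans ?_
    refine (DFunLike.congr_fun h (omegaIncl A ω)).trans ?_
    rw [ContinuousLinearMap.comp_apply, ContinuousLinearMap.comp_apply, mulMap_omegaIncl, map_zero,
      map_zero]
    rfl
  exact DFunLike.congr_fun this t

/-- The isomorphism `B ⊗̂_A Ω¹A → ker (B ⊗̂ A → B)`, `b ⊗ ω ↦ b · (φ ⊗ 1)(ω)`. -/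
noncomputable def omegaSyz :
    (selfBA φ).tensor (Omega A) →L[ℂ] ker (action (selfBA φ).toRight) :=
  (omegaSyzAux φ).codRestrict (LinearMap.ker (action (selfBA φ).toRight).toCLM.toLinearMap)
    (actMap_omegaSyzAux φ)

theorem syzIncl_omegaSyz (t : (selfBA φ).tensor (Omega A)) :
    syzIncl (selfBA φ).toRight (omegaSyz φ t) = omegaSyzAux φ t := rfl

/-- The map `B ⊗̂ A → B ⊗̂_A Ω¹A`, `b ⊗ a ↦ b ⊗ da`. -/
noncomputable def syzOmegaAux : ProjTensor B A →L[ℂ] (selfBA φ).tensor (Omega A) :=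
  ProjTensor.lift ((tensorMk (selfBA φ) (Omega A)).compl₂ (universalDerCLM A).toLinearMap)
    ((continuous_tensorMk (selfBA φ) (Omega A)).comp
      (f := fun p : B × A => (p.1, universalDerCLM A p.2)) (by fun_prop))

theorem syzOmegaAux_mk (b : B) (a : A) : syzOmegaAux φ (ProjTensor.mk B A b a) =
    tensorMk (selfBA φ) (Omega A) b (universalDerCLM A a) := ProjTensor.lift_mk _ _ b a

/-- The inverse of `omegaSyz`. -/
noncomputable def syzOmega :
    ker (action (selfBA φ).toRight) →L[ℂ] (selfBA φ).tensor (Omega A) :=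
  (syzOmegaAux φ).comp (syzIncl (selfBA φ).toRight)

/-- On b ⊗ (x ⊗ y) the composite gives bφ(x) ⊗ dy = b ⊗ x dy, which is b tensored with the
retraction of x ⊗ y onto Ω¹A. -/
theorem syzOmega_omegaSyz (t : (selfBA φ).tensor (Omega A)) : syzOmega φ (omegaSyz φ t) = t := by
  have : (syzOmegaAux φ).comp (omegaSyzAux φ) = .id ℂ _ := by
    refine tensorMk_ext fun (b : B) ω => ?_
    have h : (syzOmegaAux φ).comp (((outer (self B) (self A)).lact b).comp (leftMap φ)) =
        (tensorMkRight (selfBA φ) (Omega A) b).comp (omegaProj A) := by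
      refine ProjTensor.ext (E := A) (F := A) fun x y => ?_
      refine (congrArg (syzOmegaAux φ) (lsmul_leftMap_mk φ b x y)).trans ?_
      rw [syzOmegaAux_mk, ContinuousLinearMap.comp_apply, omegaProj_mk]
      exact tensorMk_balanced (selfBA φ) (Omega A) b x _
    refine (congrArg (syzOmegaAux φ) (omegaSyzAux_mk φ b ω)).trans ?_
    refine (DFunLike.congr_fun h (omegaIncl A ω)).trans ?_
    rw [ContinuousLinearMap.comp_apply, omegaProj_omegaIncl]
    rfl
  exact DFunLike.congr_fun this t

/-- The composite on b ⊗ a is b ⊗ a − bφ(a) ⊗ 1, the projection of B ⊗̂ A onto the syzygy, which is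
the identity there. -/
theorem omegaSyz_syzOmega (k : ker (action (selfBA φ).toRight)) :
    omegaSyz φ (syzOmega φ k) = k := by
  have : (omegaSyzAux φ).comp (syzOmegaAux φ) =
      (syzIncl (selfBA φ).toRight).comp (syzProj (selfBA φ).toRight) := by
    refine ProjTensor.ext (E := B) (F := A) fun b a => ?_
    have h₁ := omegaSyzAux_mk φ b (universalDerCLM A a)
    rw [omegaIncl_universalDerCLM, map_sub, lsmul_sub, lsmul_leftMap_mk, lsmul_leftMap_mk] at h₁
    rw [ContinuousLinearMap.comp_apply, syzOmegaAux_mk]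
    refine h₁.trans ?_
    refine Eq.trans ?_ (syzIncl_syzProj (selfBA φ).toRight _).symm
    refine congrArg₂ (· - ·) ?_ (congrArg (ProjTensor.mk B A · 1) ?_)
    · rw [map_one, mul_one]
    · exact (actMap_mk (selfBA φ).toRight b a).symm
  refine syzIncl_injective _ ?_
  refine (DFunLike.congr_fun this (syzIncl (selfBA φ).toRight k)).trans ?_
  rw [ContinuousLinearMap.comp_apply, syzProj_syzIncl]

theorem omegaSyz_rsmul (t : (selfBA φ).tensor (Omega A)) (a : A) :
    omegaSyz φ (((selfBA φ).tensor (Omega A)).rsmul t a) =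
      (ker (action (selfBA φ).toRight)).rsmul (omegaSyz φ t) a := by
  have : (omegaSyzAux φ).comp (((selfBA φ).tensor (Omega A)).ract (MulOpposite.op a)) =
      ((outer (self B) (self A)).ract (MulOpposite.op a)).comp (omegaSyzAux φ) := by
    refine tensorMk_ext fun (b : B) ω => ?_
    refine (congrArg (omegaSyzAux φ) (rsmul_tensorMk (selfBA φ) (Omega A) b ω a)).trans ?_
    refine (omegaSyzAux_mk φ b _).trans ?_
    refine Eq.trans ?_ (congrArg ((outer (self B) (self A)).rsmul · a) (omegaSyzAux_mk φ b ω)).symm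
    rw [omegaIncl_rsmul]
    have h : (((outer (self B) (self A)).lact b).comp (leftMap φ)).comp
          ((outer (self A) (self A)).ract (MulOpposite.op a)) =
        ((outer (self B) (self A)).ract (MulOpposite.op a)).comp
          (((outer (self B) (self A)).lact b).comp (leftMap φ)) := by
      refine ProjTensor.ext (E := A) (F := A) fun x y => ?_
      refine (congrArg (fun t => (outer (self B) (self A)).lsmul b (leftMap φ t))
        (outer_self_rsmul x y a)).trans ?_
      refine (lsmul_leftMap_mk φ b _ _).trans ?_
      refine Eq.trans ?_ (congrArg ((outer (self B) (self A)).rsmul · a)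
        (lsmul_leftMap_mk φ b x y)).symm
      exact (rsmul_outer_mk (b * φ x) y a).symm
    exact DFunLike.congr_fun h (omegaIncl A ω)
  exact syzIncl_injective _ (DFunLike.congr_fun this t)

theorem syzOmega_rsmul (k : ker (action (selfBA φ).toRight)) (a : A) :
    syzOmega φ ((ker (action (selfBA φ).toRight)).rsmul k a) =
      ((selfBA φ).tensor (Omega A)).rsmul (syzOmega φ k) a := by
  conv_lhs => rw [← omegaSyz_syzOmega φ k]
  rw [← omegaSyz_rsmul, syzOmega_omegaSyz]

/-- The map `omegaSyz ⊗ 1`. -/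
noncomputable def omegaSyzTensor : ProjTensor ((selfBA φ).tensor (Omega A)) B →L[ℂ]
    ProjTensor (ker (action (selfBA φ).toRight)) B :=
  ProjTensor.map (omegaSyz φ) (.id ℂ B)

/-- The map `syzOmega ⊗ 1`. -/
noncomputable def syzOmegaTensor : ProjTensor (ker (action (selfBA φ).toRight)) B →L[ℂ]
    ProjTensor ((selfBA φ).tensor (Omega A)) B :=
  ProjTensor.map (syzOmega φ) (.id ℂ B)

theorem omegaSyzTensor_syzOmegaTensor (u) : omegaSyzTensor φ (syzOmegaTensor φ u) = u := by
  have : (omegaSyzTensor φ).comp (syzOmegaTensor φ) = .id ℂ _ :=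
    ProjTensor.ext fun k c => by simp [omegaSyzTensor, syzOmegaTensor, omegaSyz_syzOmega]
  exact DFunLike.congr_fun this u

theorem syzOmegaTensor_omegaSyzTensor (u) : syzOmegaTensor φ (omegaSyzTensor φ u) = u := by
  have : (syzOmegaTensor φ).comp (omegaSyzTensor φ) = .id ℂ _ :=
    ProjTensor.ext fun k c => by simp [omegaSyzTensor, syzOmegaTensor, syzOmega_omegaSyz]
  exact DFunLike.congr_fun this u

/-- `relMap` is natural in right modules, and `omegaSyz` and its inverse are both right `A`-linear.
Ranges are matched exactly, which is needed because Tor_1 concerns the range and not its closure. -/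
theorem omegaSyzTensor_mem_iff (u : ProjTensor ((selfBA φ).tensor (Omega A)) B) :
    omegaSyzTensor φ u ∈
      Set.range (relMap (ker (action (selfBA φ).toRight)) (selfAB φ).toLeft) ↔
    u ∈ Set.range (relMap ((selfBA φ).tensor (Omega A)).toRight (selfAB φ).toLeft) := by
  constructor
  · rintro ⟨v, hv⟩
    have h := relMap_natural (ker (action (selfBA φ).toRight)) (selfAB φ).toLeft
      (K' := ((selfBA φ).tensor (Omega A)).toRight) (syzOmega φ) (syzOmega_rsmul φ) v
    rw [hv] at h
    exact ⟨_, h.trans (syzOmegaTensor_omegaSyzTensor φ u)⟩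
  · rintro ⟨v, rfl⟩
    exact ⟨_, relMap_natural ((selfBA φ).tensor (Omega A)).toRight (selfAB φ).toLeft
      (K' := ker (action (selfBA φ).toRight)) (omegaSyz φ) (omegaSyz_rsmul φ) v⟩

/-- The quotient map `(B ⊗̂_A Ω¹A) ⊗̂ B → B ⊗̂_A Ω¹A ⊗̂_A B`. -/
noncomputable def baseChangeMk :
    ProjTensor ((selfBA φ).tensor (Omega A)) B →L[ℂ] baseChange φ (Omega A) :=
  ClosedQuotient.mk (balanceSpan ((selfBA φ).tensor (Omega A)) (selfAB φ))

theorem baseChangeMk_surjective : Function.Surjective (baseChangeMk φ) :=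
  (ClosedQuotient.isOpenQuotientMap_mk _).surjective

theorem baseChangeMk_eq_zero_iff (u : ProjTensor ((selfBA φ).tensor (Omega A)) B) :
    baseChangeMk φ u = 0 ↔ u ∈ closure
      (Set.range (relMap ((selfBA φ).tensor (Omega A)).toRight (selfAB φ).toLeft)) := by
  have h : baseChangeMk φ u = 0 ↔ u ∈
      (balanceSpan ((selfBA φ).tensor (Omega A)).toRight (selfAB φ).toLeft).topologicalClosure :=
    Submodule.Quotient.mk_eq_zero _
  rw [h, ← topologicalClosure_range_relMap]
  rfl

/-- The map `B ⊗̂ A → B ⊗̂ B`, `b ⊗ a ↦ b ⊗ φ a · c`. -/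
noncomputable def rightContr (c : B) : ProjTensor B A →L[ℂ] ProjTensor B B :=
  ProjTensor.map (.id ℂ B) (orbitMap (selfAB φ).toLeft c)

theorem rightContr_mk (c b : B) (a : A) :
    rightContr φ c (ProjTensor.mk B A b a) = ProjTensor.mk B B b (φ a * c) :=
  ProjTensor.map_mk _ _ _ _

/-- On b ⊗ ω ⊗ c with ω a combination of x ⊗ y, both sides give the corresponding combination of
bφ(x) ⊗ φ(y)c. This square turns statements about φˇ into statements about Tor. -/
theorem omegaIncl_checkHom_baseChangeMk (u : ProjTensor ((selfBA φ).tensor (Omega A)) B) :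
    omegaIncl B (checkHom φ (baseChangeMk φ u)) =
      syzMap (selfBA φ).toRight (selfAB φ).toLeft (omegaSyzTensor φ u) := by
  have : ((omegaIncl B).comp (checkHom φ).toCLM).comp (baseChangeMk φ) =
      (syzMap (selfBA φ).toRight (selfAB φ).toLeft).comp (omegaSyzTensor φ) := by
    refine ProjTensor.ext fun t (c : B) => ?_
    have h₁ : ∀ t, omegaSyzTensor φ (ProjTensor.mk _ B t c) =
      ProjTensor.mk _ B (omegaSyz φ t) c := fun t => ProjTensor.map_mk _ _ _ _
    have h₂ : ((omegaIncl B).comp (checkHom φ).toCLM).comp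
          (tensorMkLeft ((selfBA φ).tensor (Omega A)) (selfAB φ) c) =
        (rightContr φ c).comp (omegaSyzAux φ) := by
      refine tensorMk_ext fun (b : B) ω => ?_
      -- The two formulas already agree on all of `A ⊗̂ A`, where elementary tensors suffice; the
      -- identity is then applied to the inclusion of ω.
      have h₃ : ((outer (self B) (self B)).ract (MulOpposite.op c)).comp
            (((outer (self B) (self B)).lact b).comp (tensorSq φ)) =
          (rightContr φ c).comp
            (((outer (self B) (self A)).lact b).comp (leftMap φ)) := by
        refine ProjTensor.ext (E := A) (F := A) fun x y => ?_
        refine (congrArg (fun t => (outer (self B) (self B)).rsmul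
          ((outer (self B) (self B)).lsmul b t) c) (tensorSq_mk φ x y)).trans ?_
        refine (congrArg (fun t => (outer (self B) (self B)).rsmul t c)
          (outer_self_lsmul b (φ x) (φ y))).trans ?_
        refine (outer_self_rsmul (b * φ x) (φ y) c).trans ?_
        refine Eq.trans ?_ (congrArg (rightContr φ c)
          (lsmul_leftMap_mk φ b x y)).symm
        exact (rightContr_mk φ c (b * φ x) y).symm
      refine (congrArg (omegaIncl B) (baseChangeLift_baseTmul (omegaMap φ) b ω c)).trans ?_
      rw [omegaIncl_rsmul, omegaIncl_lsmul, omegaIncl_omegaMap]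
      refine (DFunLike.congr_fun h₃ (omegaIncl A ω)).trans ?_
      exact (congrArg (rightContr φ c)
        (omegaSyzAux_mk φ b ω)).symm
    refine (DFunLike.congr_fun h₂ t).trans ?_
    rw [ContinuousLinearMap.comp_apply, ContinuousLinearMap.comp_apply, h₁]
    refine Eq.trans ?_ (syzMap_mk (selfBA φ).toRight (selfAB φ).toLeft _ _).symm
    rw [syzIncl_omegaSyz]
    rfl
  exact DFunLike.congr_fun this u

theorem isPseudoflat_one_iff : IsPseudoflat φ 1 ↔
    (∀ u, syzMap (selfBA φ).toRight (selfAB φ).toLeft u = 0 →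
      u ∈ Set.range (relMap (ker (action (selfBA φ).toRight)) (selfAB φ).toLeft)) ∧
    IsClosed (Set.range (relMap (selfBA φ).toRight (selfAB φ).toLeft)) := by
  rw [← t2Space_tor_zero_iff, ← subsingleton_tor_one_iff]
  refine and_congr_left fun _ => ⟨fun h => h 1 le_rfl le_rfl, fun h m h₁ h₂ => ?_⟩
  obtain rfl := le_antisymm h₂ h₁
  exact h

theorem conditionStar_iff : ConditionStar φ ↔
    IsClosed (Set.range (relMap ((selfBA φ).tensor (Omega A)).toRight (selfAB φ).toLeft)) :=
  t2Space_tor_zero_iff _ _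

theorem isPseudoflat_epi_iff : IsPseudoflat φ 1 ∧ IsFrechetEpi φ ↔
    (checkHom φ).IsIso ∧ ConditionStar φ := by
  rw [isPseudoflat_one_iff, conditionStar_iff]
  constructor
  · rintro ⟨⟨h₁, h₀⟩, hφ⟩
    -- Vanishing of Tor_1, transported to B ⊗̂_A Ω¹A; this single statement yields both injectivity
    -- of φˇ and (*).
    have key : ∀ u, checkHom φ (baseChangeMk φ u) = 0 → u ∈
        Set.range (relMap ((selfBA φ).tensor (Omega A)).toRight (selfAB φ).toLeft) := by
      intro u hu
      refine (omegaSyzTensor_mem_iff φ u).1 (h₁ _ ?_)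
      rw [← omegaIncl_checkHom_baseChangeMk, hu, map_zero]
    refine ⟨Hom.isIso_of_bijective _ ⟨?_, fun ω => ?_⟩, ?_⟩
    · refine (injective_iff_map_eq_zero (checkHom φ).toCLM).2 fun x hx => ?_
      obtain ⟨u, rfl⟩ := baseChangeMk_surjective φ x
      exact (baseChangeMk_eq_zero_iff φ u).2 (subset_closure (key u hx))
    -- Surjectivity: the epimorphism property puts ω in the closure of the relations, Hausdorff
    -- Tor_0 removes the closure, and a preimage under `syzMap` is carried back to B ⊗̂_A Ω¹A.
    · have hω := hφ.omegaIncl_mem ω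
      rw [h₀.closure_eq, ← range_syzMap] at hω
      obtain ⟨u, hu⟩ := hω
      refine ⟨baseChangeMk φ (syzOmegaTensor φ u), omegaIncl_injective ?_⟩
      rw [omegaIncl_checkHom_baseChangeMk, omegaSyzTensor_syzOmegaTensor, hu]
    -- A point of the closure dies in the base change, so φˇ kills its class, and `key` puts it in
    -- the range itself.
    · refine isClosed_of_closure_subset fun u hu => key u ?_
      rw [(baseChangeMk_eq_zero_iff φ u).2 hu, map_zero]
  · rintro ⟨hiso, hstar⟩
    obtain ⟨hinj, hsurj⟩ := hiso.bijective
    -- Surjectivity of φˇ places ker μ_B inside the range of the relations with no closure, which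
    -- serves both the epimorphism property and closedness.
    have hmem : ∀ ω, omegaIncl B ω ∈
        Set.range (relMap (selfBA φ).toRight (selfAB φ).toLeft) := by
      intro ω
      obtain ⟨x, rfl⟩ := hsurj ω
      obtain ⟨u, rfl⟩ := baseChangeMk_surjective φ x
      rw [← range_syzMap]
      exact ⟨_, (omegaIncl_checkHom_baseChangeMk φ u).symm⟩
    refine ⟨⟨fun u hu => ?_, ?_⟩, isFrechetEpi_of_omegaIncl_mem φ hmem⟩
    · rw [← omegaSyzTensor_syzOmegaTensor φ u] at hu ⊢
      refine (omegaSyzTensor_mem_iff φ _).2 ?_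
      -- (*) replaces the range by its closure, the kernel of the quotient map to the base change,
      -- and injectivity of φˇ then applies.
      rw [← hstar.closure_eq]
      refine (baseChangeMk_eq_zero_iff φ _).1 (hinj (omegaIncl_injective ?_))
      rw [omegaIncl_checkHom_baseChangeMk, map_zero, map_zero]
      exact hu
    -- The range of relations coincides with ker μ_B, which is closed because μ_B is continuous.
    · have h : Set.range (relMap (selfBA φ).toRight (selfAB φ).toLeft) = mulMap B ⁻¹' {0} := by
        refine Set.Subset.antisymm ?_ fun t ht => ?_
        · rintro _ ⟨u, rfl⟩
          exact mulMap_relMap φ u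
        · exact hmem ⟨t, ht⟩
      rw [h]
      exact isClosed_singleton.preimage (mulMap B).continuous

end Comparison

end FrechetBimod

theorem mainTheorem3 {A B : Type u}
    [Ring A] [Algebra ℂ A] [UniformSpace A] [IsFrechetAlgebra A]
    [Ring B] [Algebra ℂ B] [UniformSpace B] [IsFrechetAlgebra B] (φ : A →A[ℂ] B) :
    List.TFAE
      [IsPseudoflat φ 1 ∧ IsFrechetEpi φ,
       (∀ X : FrechetBimod.{u} B B, Function.Bijective (derRestrict φ X)) ∧ ConditionStar φ,
       (FrechetBimod.checkHom φ).IsIso ∧ ConditionStar φ] := by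
  tfae_have 1 ↔ 3 := FrechetBimod.isPseudoflat_epi_iff φ
  tfae_have 2 ↔ 3 :=
    and_congr_left fun _ => FrechetBimod.derRestrict_bijective_iff_checkHom_isIso φ
  tfae_finish
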